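/- **Setting.** Let $M$ be a finite-dimensional smooth Hausdorff manifold with a smooth, geodesically complete affine connection $\nabla$ whose torsion $\tau(X,Y)=\nabla_XY-\nabla_YX-[X,Y]$ is parallel, and let $R$ denote its curvature. Let $V$ be a finite-dimensional vector space and $u\mapsto W^u$ a dynamics: vector fields $W^u$ on $M$ depending smoothly on $(u,x)\in V\times M$. A *local vector-error representation* $(\Phi^t,\mathfrak{er},u_t)$ in an open set $U\subseteq M$ consists of the following. - An *error function* $\mathfrak{er}:U\times U\to TM$. Any $p,q\in U$ are joined by exactly one geodesic $s\mapsto\exp_p(sv)$, $0\le s\le1$, lying in $U$; one puts $\mathfrak{er}(q,p)=v\in T_pM$, so $\exp_p(\mathfrak{er}(q,p))=q$, and $\mathfrak{er}$ is smooth. - A continuous input $u_t\in V$, $|t|<\varepsilon$, where $\varepsilon>0$. - The flow $\Phi^t:U\to M$, $|t|<\varepsilon$: it is continuous in $(t,p)$, each $\Phi^t$ is a (smooth) local diffeomorphism on $U$, $\Phi^0=\mathrm{id}$, and $\frac{d}{dt}\Phi^t(p)=W^{u_t}(\Phi^t(p))$. Let $U_t$ be the set of $p\in U$ whose flow line stays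 in $U$ between the times $0$ and $t$. A *local affine transformation* on an open set $N$ is a diffeomorphism $\psi$ of $N$ onto its image with $d\psi(\nabla_XY)=\nabla_{X'}Y'$ whenever $(X,X')$ and $(Y,Y')$ are $\psi$-related. For $p_1,p_2\in U_t$ the *patch* is $$H(t,s)=\exp_{\Phi^t(p_2)}\bigl(s\,\mathfrak{er}(\Phi^t(p_1),\Phi^t(p_2))\bigr),\qquad 0\le s\le1 .$$ **Preintegrable** means that for all $|t|<\varepsilon$ and all $p_1,p_2\in U_t$: 1. (self-similarity) $H(t,s)=\Phi^t(H(0,s))$ for all $s\in[0,1]$, i.e. the intermediate curves of the patch are flow lines; 2. the vector transport by the initial value problem of the Jacobi equation $$D_s\bigl(D_sJ+\tau(J,\gamma')\bigr)+R(J,\gamma')\gamma'=0$$ along $\gamma=H(t,\cdot)$ is the one calculated beforehand along $H(0,\cdot)$: if the Jacobi field along $H(0,\cdot)$ with initial data $J(0)=a$, $D_sJ(0)=a'$ has $J(1)=b$, then the Jacobi field along $H(t,\cdot)$ with initial data $d\Phi^t(a)$, $d\Phi^t(a')$ has the value $d\Phi^t(b)$ at $s=1$. **Exact linearization with state-independent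 Jacobian** means that there are maps $\psi_{\hat p,t}$ ($\hat p\in U$, $|t|<\varepsilon$) and, for each $u\in V$, a field $A_u$ of endomorphisms of the tangent spaces of $M$, depending only on $u$, such that: 1. for all $|t|<\varepsilon$ and $\hat p\in U_t$, $\psi_{\hat p,t}$ is a local affine transformation on $U_t$ (in particular, $U_t$ is open) with $\psi_{\hat p,t}(\hat p)=\Phi^t(\hat p)$, and, with $F_t^{\hat p}:=(d\psi_{\hat p,t})_{\hat p}:T_{\hat p}M\to T_{\Phi^t(\hat p)}M$, every $p=\exp_{\hat p}(v)\in U_t$, $v=\mathfrak{er}(p,\hat p)$, satisfies $$\Phi^t(p)=\exp_{\Phi^t(\hat p)}\bigl(F_t^{\hat p}v\bigr);$$ 2. $F_t^{\hat p}$ satisfies the linear equation $D_tF_t^{\hat p}=A_{u_t}F_t^{\hat p}$ along $t\mapsto\Phi^t(\hat p)$, as long as the flow line of $\hat p$ stays in $U$ (here $D_t$ is the covariant derivative along this curve and $A_{u_t}$ is taken at $\Phi^t(\hat p)$); 3. in normal frames $F_t^{\hat p}$ does not depend on the estimate $\hat p$: for $p_0,\hat p\in U_t$, $$F_t^{\hat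 p}\circ P_{p_0\to\hat p}=P_{\Phi^t(p_0)\to\Phi^t(\hat p)}\circ F_t^{p_0},$$ where $P_{p\to q}$ is parallel transport along the geodesic of $U$ from $p$ to $q$. **Theorem.** A local vector-error representation $(\Phi^t,\mathfrak{er},u_t)$ of a dynamics on $(M,\nabla)$ with these properties possesses exact linearization with state-independent Jacobian if and only if it is preintegrable. -/

import Mathlib

open Set Filter Topology Bundle
open scoped Manifold ContDiff

noncomputable section

namespace LinObs

section Connection

variable {E : Type*} [NormedAddCommGroup E] [NormedSpace ℝ E] [FiniteDimensional ℝ E]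
  {M : Type*} [TopologicalSpace M] [ChartedSpace E M] [IsManifold 𝓘(ℝ, E) ∞ M]

/-- Affine connections on `M`: covariant derivatives on the tangent bundle.
`cov Y x v` is `(∇_v Y)(x)`. -/
abbrev AffineConnection (E : Type*) [NormedAddCommGroup E] [NormedSpace ℝ E]
    (M : Type*) [TopologicalSpace M] [ChartedSpace E M] [IsManifold 𝓘(ℝ, E) ∞ M] :=
  CovariantDerivative 𝓘(ℝ, E) E (TangentSpace 𝓘(ℝ, E) : M → Type _)

variable (cov : AffineConnection E M)

/-- The torsion tensor is parallel: `∇_z (τ(X, Y)) = τ(∇_z X, Y) + τ(X, ∇_z Y)` for all smooth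
vector fields `X`, `Y` and all tangent vectors `z`. -/
def ParallelTorsion : Prop :=
  ∀ X Y : (x : M) → TangentSpace 𝓘(ℝ, E) x,
    ContMDiff 𝓘(ℝ, E) 𝓘(ℝ, E).tangent ∞ (fun x ↦ (⟨x, X x⟩ : TangentBundle 𝓘(ℝ, E) M)) →
    ContMDiff 𝓘(ℝ, E) 𝓘(ℝ, E).tangent ∞ (fun x ↦ (⟨x, Y x⟩ : TangentBundle 𝓘(ℝ, E) M)) →
    ∀ (x : M) (z : TangentSpace 𝓘(ℝ, E) x),
      cov (fun y ↦ cov.torsion y (X y) (Y y)) x z =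
        cov.torsion x (cov X x z) (Y x) + cov.torsion x (X x) (cov Y x z)

/-- The curvature `R(u, v)w = ∇_U ∇_V W - ∇_V ∇_U W - ∇_{[U, V]} W` at `x`, where `U`, `V`, `W`
are local extensions of `u`, `v`, `w` (for a smooth connection the value does not depend on the
choice of the extensions). -/
def curvature (x : M) (u v w : TangentSpace 𝓘(ℝ, E) x) : TangentSpace 𝓘(ℝ, E) x :=
  cov (fun y ↦ cov (FiberBundle.extend E w) y (FiberBundle.extend E v y)) x u
    - cov (fun y ↦ cov (FiberBundle.extend E w) y (FiberBundle.extend E u y)) x v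
    - cov (FiberBundle.extend E w) x
        (VectorField.mlieBracket 𝓘(ℝ, E) (FiberBundle.extend E u) (FiberBundle.extend E v) x)

/-- The velocity `γ'(s)`. -/
def velocity (E : Type*) [NormedAddCommGroup E] [NormedSpace ℝ E]
    {M : Type*} [TopologicalSpace M] [ChartedSpace E M]
    (γ : ℝ → M) (s : ℝ) : TangentSpace 𝓘(ℝ, E) (γ s) :=
  mfderiv 𝓘(ℝ, ℝ) 𝓘(ℝ, E) γ s (1 : ℝ)

/-- `D` is the covariant derivative at `s₀` (within `S`) of the vector field `X` along the
curve `γ`. In the trivialization of the tangent bundle around `γ s₀`, with `f` the coordinates of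
`X`, it is the Leibniz formula `D = f'(s₀) + ∇_{γ'(s₀)} Y`, where `Y` is the local vector field with
the constant coordinates `f(s₀)`. -/
def HasCovDerivWithinAt (γ : ℝ → M) (X : (s : ℝ) → TangentSpace 𝓘(ℝ, E) (γ s))
    (S : Set ℝ) (s₀ : ℝ) (D : TangentSpace 𝓘(ℝ, E) (γ s₀)) : Prop :=
  ∃ (γ' : TangentSpace 𝓘(ℝ, E) (γ s₀)) (f' : E),
    HasMFDerivWithinAt 𝓘(ℝ, ℝ) 𝓘(ℝ, E) γ S s₀ ((1 : ℝ →L[ℝ] ℝ).smulRight γ') ∧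
    HasDerivWithinAt
      (fun s ↦ (trivializationAt E (TangentSpace 𝓘(ℝ, E)) (γ s₀)).continuousLinearMapAt ℝ
        (γ s) (X s)) f' S s₀ ∧
    D = (trivializationAt E (TangentSpace 𝓘(ℝ, E)) (γ s₀)).symmL ℝ (γ s₀) f'
      + cov (FiberBundle.extend E (X s₀)) (γ s₀) γ'

/-- `γ : ℝ → M` is a geodesic: `∇_{γ'} γ' = 0`. -/
def IsGeodesic (γ : ℝ → M) : Prop :=
  ∀ s, HasCovDerivWithinAt cov γ (velocity E γ) univ s 0

/-- Every tangent vector is the initial velocity of a geodesic defined on all of `ℝ`. -/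
def GeodesicallyComplete : Prop :=
  ∀ a : TangentBundle 𝓘(ℝ, E) M, ∃ γ : ℝ → M, IsGeodesic cov γ ∧
    (⟨γ 0, velocity E γ 0⟩ : TangentBundle 𝓘(ℝ, E) M) = a

open Classical in
/-- The geodesic exponential `exp_p v`: the value at time `1` of the geodesic through `p` with
initial velocity `v` (and `p` by convention if there is no such geodesic on `ℝ`). -/
def expMap (p : M) (v : TangentSpace 𝓘(ℝ, E) p) : M :=
  if h : ∃ γ : ℝ → M, IsGeodesic cov γ ∧
      (⟨γ 0, velocity E γ 0⟩ : TangentBundle 𝓘(ℝ, E) M) = ⟨p, v⟩ then h.choose 1 else p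

/-- `b` is the parallel transport of `a` along `γ : [0, 1] → M`. -/
def IsParallelTransport (γ : ℝ → M) (a b : TangentBundle 𝓘(ℝ, E) M) : Prop :=
  ∃ X : (s : ℝ) → TangentSpace 𝓘(ℝ, E) (γ s),
    (∀ s ∈ Icc (0 : ℝ) 1, HasCovDerivWithinAt cov γ X (Icc 0 1) s 0) ∧
    (⟨γ 0, X 0⟩ : TangentBundle 𝓘(ℝ, E) M) = a ∧ (⟨γ 1, X 1⟩ : TangentBundle 𝓘(ℝ, E) M) = b

/-- `J` is a Jacobi field along the geodesic `γ` on `[0, 1]` with covariant derivative `J'`: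
`D_s (D_s J + τ(J, γ')) + R(J, γ')γ' = 0`. -/
def IsJacobiField (γ : ℝ → M) (J J' : (s : ℝ) → TangentSpace 𝓘(ℝ, E) (γ s)) : Prop :=
  ∀ s ∈ Icc (0 : ℝ) 1,
    HasCovDerivWithinAt cov γ J (Icc 0 1) s (J' s) ∧
    HasCovDerivWithinAt cov γ (fun r ↦ J' r + cov.torsion (γ r) (J r) (velocity E γ r))
      (Icc 0 1) s (-curvature cov (γ s) (J s) (velocity E γ s) (velocity E γ s))

/-- The vector transport along `γ : [0, 1] → M` by the initial value problem of the Jacobi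
equation: the Jacobi field with initial value `a` and initial covariant derivative `a'` (two tangent
vectors at `γ 0`) takes the value `b` at `γ 1`. -/
def IsJacobiTransport (γ : ℝ → M) (a a' b : TangentBundle 𝓘(ℝ, E) M) : Prop :=
  ∃ J J' : (s : ℝ) → TangentSpace 𝓘(ℝ, E) (γ s), IsJacobiField cov γ J J' ∧
    (⟨γ 0, J 0⟩ : TangentBundle 𝓘(ℝ, E) M) = a ∧
    (⟨γ 0, J' 0⟩ : TangentBundle 𝓘(ℝ, E) M) = a' ∧
    (⟨γ 1, J 1⟩ : TangentBundle 𝓘(ℝ, E) M) = b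

/-- `f` is a local affine transformation on the open set `N`: a diffeomorphism of `N` onto its image
such that `df(∇_v Y) = ∇_{df(v)} Y'` for `f`-related vector fields `Y` on `N` and `Y'` on `f(N)`. -/
structure IsLocalAffine (f : M → M) (N : Set M) : Prop where
  isOpen : IsOpen N
  injOn : InjOn f N
  isLocalDiffeomorphOn : IsLocalDiffeomorphOn 𝓘(ℝ, E) 𝓘(ℝ, E) ∞ f N
  map_cov : ∀ Y Y' : (x : M) → TangentSpace 𝓘(ℝ, E) x,
    ContMDiffOn 𝓘(ℝ, E) 𝓘(ℝ, E).tangent ∞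
      (fun x ↦ (⟨x, Y x⟩ : TangentBundle 𝓘(ℝ, E) M)) N →
    ContMDiffOn 𝓘(ℝ, E) 𝓘(ℝ, E).tangent ∞
      (fun x ↦ (⟨x, Y' x⟩ : TangentBundle 𝓘(ℝ, E) M)) (f '' N) →
    (∀ x ∈ N, mfderiv 𝓘(ℝ, E) 𝓘(ℝ, E) f x (Y x) = Y' (f x)) →
    ∀ x ∈ N, ∀ v : TangentSpace 𝓘(ℝ, E) x,
      mfderiv 𝓘(ℝ, E) 𝓘(ℝ, E) f x (cov Y x v)
        = cov Y' (f x) (mfderiv 𝓘(ℝ, E) 𝓘(ℝ, E) f x v)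

/-- `er` is the error function of `U`: any two points `p, q ∈ U` are joined by exactly one geodesic
`s ↦ exp_p (s v)`, `0 ≤ s ≤ 1`, lying in `U`, its initial velocity is `er q p = v ∈ T_p M`, and
this vector depends smoothly on `(q, p) ∈ U × U`. Equivalently, `U` is a normal neighbourhood of
each of its points `p` and `er (·, p)` is the inverse of the diffeomorphism `exp_p` onto `U`. -/
structure IsErrorFunction (U : Set M) (er : (q p : M) → TangentSpace 𝓘(ℝ, E) p) : Prop where
  exp_er : ∀ p ∈ U, ∀ q ∈ U, expMap cov p (er q p) = q
  mem : ∀ p ∈ U, ∀ q ∈ U, ∀ s ∈ Icc (0 : ℝ) 1, expMap cov p (s • er q p) ∈ U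
  unique : ∀ p ∈ U, ∀ q ∈ U, ∀ v : TangentSpace 𝓘(ℝ, E) p,
    (∀ s ∈ Icc (0 : ℝ) 1, expMap cov p (s • v) ∈ U) → expMap cov p v = q → v = er q p
  smooth : ContMDiffOn (𝓘(ℝ, E).prod 𝓘(ℝ, E)) 𝓘(ℝ, E).tangent ∞
    (fun z : M × M ↦ (⟨z.2, er z.1 z.2⟩ : TangentBundle 𝓘(ℝ, E) M)) (U ×ˢ U)

end Connection

section System

variable {E : Type*} [NormedAddCommGroup E] [NormedSpace ℝ E]
  {M : Type*} [TopologicalSpace M] [ChartedSpace E M] [IsManifold 𝓘(ℝ, E) ∞ M]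

/-- A dynamics on `M` with controls in `V`: a smooth assignment `u ↦ W^u` of smooth vector fields
on `M`, i.e. `(u, x) ↦ W^u x` is smooth. -/
structure Dynamics (V : Type*) [NormedAddCommGroup V] [NormedSpace ℝ V]
    (E : Type*) [NormedAddCommGroup E] [NormedSpace ℝ E]
    (M : Type*) [TopologicalSpace M] [ChartedSpace E M] [IsManifold 𝓘(ℝ, E) ∞ M] where
  field : V → (x : M) → TangentSpace 𝓘(ℝ, E) x
  smooth : ContMDiff (𝓘(ℝ, V).prod 𝓘(ℝ, E)) 𝓘(ℝ, E).tangent ∞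
    (fun z : V × M ↦ (⟨z.2, field z.1 z.2⟩ : TangentBundle 𝓘(ℝ, E) M))

variable {V : Type*} [NormedAddCommGroup V] [NormedSpace ℝ V]

/-- A local vector-error representation of the dynamics `W` in the open set `U`: the flow
`Φ^t : U → M`, `|t| < ε`, of `W^{u_t}`, the error function on `U × U`, and a continuous input `u`. -/
structure VectorErrorRep [FiniteDimensional ℝ E] (cov : AffineConnection E M)
    (W : Dynamics V E M) where
  U : Set M
  isOpen : IsOpen U
  er : (q p : M) → TangentSpace 𝓘(ℝ, E) p
  isErrorFunction : IsErrorFunction cov U er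
  ε : ℝ
  ε_pos : 0 < ε
  u : ℝ → V
  continuousOn_u : ContinuousOn u (Ioo (-ε) ε)
  Φ : ℝ → M → M
  Φ_zero : ∀ p ∈ U, Φ 0 p = p
  continuousOn_Φ : ContinuousOn (fun z : ℝ × M ↦ Φ z.1 z.2) (Ioo (-ε) ε ×ˢ U)
  isLocalDiffeomorphOn_Φ : ∀ t ∈ Ioo (-ε) ε, IsLocalDiffeomorphOn 𝓘(ℝ, E) 𝓘(ℝ, E) ∞ (Φ t) U
  flow : ∀ p ∈ U, ∀ t ∈ Ioo (-ε) ε,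
    HasMFDerivAt 𝓘(ℝ, ℝ) 𝓘(ℝ, E) (fun τ ↦ Φ τ p) t
      ((1 : ℝ →L[ℝ] ℝ).smulRight (W.field (u t) (Φ t p)))

namespace VectorErrorRep

variable [FiniteDimensional ℝ E] {cov : AffineConnection E M} {W : Dynamics V E M}
  (R : VectorErrorRep cov W)

/-- The points of `U` whose flow line stays in `U` between the times `0` and `t`. -/
def domain (t : ℝ) : Set M :=
  {p ∈ R.U | ∀ τ ∈ uIcc 0 t, R.Φ τ p ∈ R.U}

/-- The times up to which the flow line from `p` stays in `U`. -/
def times (p : M) : Set ℝ :=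
  {t ∈ Ioo (-R.ε) R.ε | p ∈ R.domain t}

/-- The patch `H(t, s)` spanned by the flow lines of `p₂` (at `s = 0`) and `p₁` (at `s = 1`): the
curve `s ↦ H(t, s)` is the geodesic from `Φ^t(p₂)` to `Φ^t(p₁)` in `U`, whose initial velocity is
the error vector, so that its velocity `∂_s H` is the parallel transport of the error vector. -/
def patch (p₁ p₂ : M) (t s : ℝ) : M :=
  expMap cov (R.Φ t p₂) (s • R.er (R.Φ t p₁) (R.Φ t p₂))

/-- On every patch, each intermediate curve `t ↦ H(t, s)` is a flow line. -/
def SelfSimilar : Prop :=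
  ∀ t ∈ Ioo (-R.ε) R.ε, ∀ p₁ ∈ R.domain t, ∀ p₂ ∈ R.domain t, ∀ s ∈ Icc (0 : ℝ) 1,
    R.patch p₁ p₂ t s = R.Φ t (R.patch p₁ p₂ 0 s)

/-- Preintegrability: the flow field is self-similar, and on every patch the Jacobi vector transport
along the geodesic `H(t, ·)` from `Φ^t(p₂)` to `Φ^t(p₁)` is the one calculated beforehand along the
geodesic `H(0, ·)` from `p₂` to `p₁`, tangent spaces at times `0` and `t` being identified
by `dΦ^t`. -/
structure Preintegrable : Prop where
  selfSimilar : R.SelfSimilar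
  jacobi : ∀ t ∈ Ioo (-R.ε) R.ε, ∀ p₁ ∈ R.domain t, ∀ p₂ ∈ R.domain t,
    ∀ a a' b : TangentBundle 𝓘(ℝ, E) M,
      IsJacobiTransport cov (R.patch p₁ p₂ 0) a a' b →
      IsJacobiTransport cov (R.patch p₁ p₂ t)
        (tangentMap 𝓘(ℝ, E) 𝓘(ℝ, E) (R.Φ t) a) (tangentMap 𝓘(ℝ, E) 𝓘(ℝ, E) (R.Φ t) a')
        (tangentMap 𝓘(ℝ, E) 𝓘(ℝ, E) (R.Φ t) b)

/-- Exact linearization with state-independent Jacobian. For every estimate `p̂` there are local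
affine transformations `ψ_t` (here `ψ p̂ t`) with `ψ_t(p̂) = Φ^t(p̂)` such that, writing
`F_t = (dψ_t)_p̂ : T_p̂ M → T_{Φ^t(p̂)} M`,
* every flow line is `Φ^t(p) = exp_{Φ^t(p̂)} (F_t v)`, where `p = exp_p̂ v`;
* `F_t` solves the linear equation `D_t F_t = A_{u_t} F_t`, where `A_u` is a field of endomorphisms
  of the tangent spaces that depends only on the value `u` of the input;
* in normal frames, i.e. in a frame at `p₀` and a frame at `Φ^t(p₀)` that are both carried to the
  other points of `U` by parallel transport along the geodesics issuing from `p₀` and `Φ^t(p₀)`,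
  the matrix of `F_t` is the same at all estimates `p̂`. -/
def ExactLinearization : Prop :=
  ∃ (ψ : M → ℝ → M → M)
    (A : V → (q : M) → TangentSpace 𝓘(ℝ, E) q →L[ℝ] TangentSpace 𝓘(ℝ, E) q),
    (∀ t ∈ Ioo (-R.ε) R.ε, ∀ p' ∈ R.domain t,
      IsLocalAffine cov (ψ p' t) (R.domain t) ∧
      ψ p' t p' = R.Φ t p' ∧
      ∀ p ∈ R.domain t, R.Φ t p =
        expMap cov (ψ p' t p') (mfderiv 𝓘(ℝ, E) 𝓘(ℝ, E) (ψ p' t) p' (R.er p p'))) ∧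
    (∀ p' ∈ R.U, ∀ t ∈ R.times p', ∀ v : TangentSpace 𝓘(ℝ, E) p',
      HasCovDerivWithinAt cov (fun τ ↦ ψ p' τ p')
        (fun τ ↦ mfderiv 𝓘(ℝ, E) 𝓘(ℝ, E) (ψ p' τ) p' v) (R.times p') t
        (A (R.u t) (ψ p' t p') (mfderiv 𝓘(ℝ, E) 𝓘(ℝ, E) (ψ p' t) p' v))) ∧
    (∀ t ∈ Ioo (-R.ε) R.ε, ∀ p₀ ∈ R.domain t, ∀ p' ∈ R.domain t,
      ∀ a b : TangentBundle 𝓘(ℝ, E) M,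
        IsParallelTransport cov (R.patch p' p₀ 0) a b →
        IsParallelTransport cov (R.patch p' p₀ t)
          (tangentMap 𝓘(ℝ, E) 𝓘(ℝ, E) (ψ p₀ t) a) (tangentMap 𝓘(ℝ, E) 𝓘(ℝ, E) (ψ p' t) b))

end VectorErrorRep

end System

end LinObs

end

/-! The pivot of both directions is that each condition forces the flow maps `Φ t` to be affine on
`R.domain t`, and forces this set to contain the geodesic segments of `U` between its points.
Affinity is tested in coordinates. A local diffeomorphism `f` pushes a coordinate system `e` forward
to a system `e'` in which `f` becomes the identity, and `f` is affine near a point exactly when the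
Christoffel symbols in `e` and `e'` agree there (`AffineAt`). Naturality of covariant derivatives,
geodesics, torsion, curvature, parallel transport and Jacobi fields can then be read off.

From exact linearization to preintegrability, the obstacle is that the formula for `Φ t p` is
available only at points of `R.domain t`, which is not known beforehand to contain the segment
between two of its points. `segment_mem_domain` settles this by a continuity argument in time, with
a second one along the segment at each time. As long as the segment stays in the domain, `F_t`
carries its error vector to the current error vector. The relation survives limits in time because
the linear equation makes `F_t v` continuous, and it keeps the image of the segment on a geodesic of
`U`. This gives self-similarity. Moreover `ψ x t`, being affine, maps geodesics to geodesics, so it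
agrees with `Φ t` on `R.domain t`; hence `Φ t` is affine and carries Jacobi fields to Jacobi fields.

Conversely, take the Jacobi field with value `a` and covariant derivative zero at the start of a
geodesic with velocity `v`. In coordinates its derivative there is `-Γ(a, v)`. Preintegrability says
that this field and the one along the image geodesic have equal coordinates in `e` and `e'` at all
small times, so their derivatives agree and `Γ = Γ'` (`Preintegrable.chris_eq`). Thus `Φ t` is
affine and serves as `ψ` for every estimate. For the Jacobian, self-similarity makes the error of
`exp_p (r v)` with respect to `p` evolve as `r • dΦ^t v`. Its covariant rate of change is a function
of the input value and the two current positions alone (`errorRate`), so the linear map it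
determines depends only on the input value and the point. Independence of the estimate in normal
frames is naturality of parallel transport. -/

open Set Filter Topology Bundle
open scoped Manifold ContDiff

noncomputable section

namespace LinObs

/-! ### Coordinate systems and coordinate expressions of vector fields -/

section Coordinates

variable {E : Type*} [NormedAddCommGroup E] [NormedSpace ℝ E]
  {M : Type*} [TopologicalSpace M] [ChartedSpace E M]

/-- A smooth coordinate system on an open subset of `M`. -/
structure IsCoord (e : OpenPartialHomeomorph M E) : Prop where
  contMDiffOn : ContMDiffOn 𝓘(ℝ, E) 𝓘(ℝ, E) ∞ e e.source
  contMDiffOn_symm : ContMDiffOn 𝓘(ℝ, E) 𝓘(ℝ, E) ∞ e.symm e.target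

theorem isCoord_chartAt [IsManifold 𝓘(ℝ, E) ∞ M] (x : M) : IsCoord (chartAt E x) where
  contMDiffOn := contMDiffOn_chart
  contMDiffOn_symm := contMDiffOn_chart_symm

/-- The coordinates of tangent vectors at `y`. -/
def dcoord (e : OpenPartialHomeomorph M E) (y : M) : TangentSpace 𝓘(ℝ, E) y →L[ℝ] E :=
  mfderiv 𝓘(ℝ, E) 𝓘(ℝ, E) e y

/-- The tangent vector at `y` with given coordinates. -/
def dframe (e : OpenPartialHomeomorph M E) (y : M) : E →L[ℝ] TangentSpace 𝓘(ℝ, E) y :=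
  (dcoord e y).inverse

/-- The coordinate expression of a vector field. -/
def rep (e : OpenPartialHomeomorph M E) (Y : (x : M) → TangentSpace 𝓘(ℝ, E) x) (z : E) : E :=
  dcoord e (e.symm z) (Y (e.symm z))

theorem mdifferentiableAt_vectorSpace_iff {V : (x : E) → TangentSpace 𝓘(ℝ, E) x} {x : E} :
    MDifferentiableAt 𝓘(ℝ, E) 𝓘(ℝ, E).tangent (fun x ↦ (⟨x, V x⟩ : TangentBundle 𝓘(ℝ, E) E)) x ↔
      DifferentiableAt ℝ (fun x ↦ (V x : E)) x := by
  rw [mdifferentiableAt_section, mdifferentiableAt_iff_differentiableAt]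
  simp

namespace IsCoord

variable {e : OpenPartialHomeomorph M E} (he : IsCoord e)
include he

theorem contMDiffAt {y : M} (hy : y ∈ e.source) :
    ContMDiffAt 𝓘(ℝ, E) 𝓘(ℝ, E) ∞ e y :=
  he.contMDiffOn.contMDiffAt (e.open_source.mem_nhds hy)

theorem contMDiffAt_symm {z : E} (hz : z ∈ e.target) :
    ContMDiffAt 𝓘(ℝ, E) 𝓘(ℝ, E) ∞ e.symm z :=
  he.contMDiffOn_symm.contMDiffAt (e.open_target.mem_nhds hz)

theorem mdifferentiable : e.MDifferentiable 𝓘(ℝ, E) 𝓘(ℝ, E) :=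
  ⟨he.contMDiffOn.mdifferentiableOn (by simp), he.contMDiffOn_symm.mdifferentiableOn (by simp)⟩

theorem mdifferentiableAt {y : M} (hy : y ∈ e.source) :
    MDifferentiableAt 𝓘(ℝ, E) 𝓘(ℝ, E) e y :=
  (he.contMDiffAt hy).mdifferentiableAt (by simp)

theorem isInvertible {y : M} (hy : y ∈ e.source) : (dcoord e y).IsInvertible :=
  ⟨he.mdifferentiable.mfderiv hy, rfl⟩

theorem dcoord_dframe {y : M} (hy : y ∈ e.source) (f : E) : dcoord e y (dframe e y f) = f :=
  (he.isInvertible hy).self_apply_inverse f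

theorem dframe_dcoord {y : M} (hy : y ∈ e.source) (v : TangentSpace 𝓘(ℝ, E) y) :
    dframe e y (dcoord e y v) = v :=
  (he.isInvertible hy).inverse_apply_self v

theorem dcoord_injective {y : M} (hy : y ∈ e.source) : Function.Injective (dcoord e y) :=
  Function.LeftInverse.injective (he.dframe_dcoord hy)

theorem mfderiv_symm_inverse {z : E} (hz : z ∈ e.target) :
    (mfderiv 𝓘(ℝ, E) 𝓘(ℝ, E) e.symm z).inverse = dcoord e (e.symm z) := by
  have h1 := he.mdifferentiable.comp_symm_deriv hz
  have h2 := he.mdifferentiable.symm_comp_deriv (e.map_target hz)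
  rw [e.right_inv hz] at h2
  exact ContinuousLinearMap.inverse_eq h2 h1

theorem mfderiv_symm {z : E} (hz : z ∈ e.target) :
    mfderiv 𝓘(ℝ, E) 𝓘(ℝ, E) e.symm z = dframe e (e.symm z) := by
  have h1 := he.mdifferentiable.comp_symm_deriv hz
  have h2 := he.mdifferentiable.symm_comp_deriv (e.map_target hz)
  rw [e.right_inv hz] at h2
  exact (ContinuousLinearMap.inverse_eq h1 h2).symm

theorem isInvertible_symm {z : E} (hz : z ∈ e.target) :
    (mfderiv 𝓘(ℝ, E) 𝓘(ℝ, E) e.symm z).IsInvertible :=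
  ⟨he.mdifferentiable.symm.mfderiv hz, rfl⟩

/-- Identifies `rep` with the pullback along `e.symm`, so that regularity and Lie bracket results
for pullbacks apply to it. -/
theorem rep_eventuallyEq (Y : (x : M) → TangentSpace 𝓘(ℝ, E) x) {y : M} (hy : y ∈ e.source) :
    VectorField.mpullback 𝓘(ℝ, E) 𝓘(ℝ, E) e.symm Y =ᶠ[𝓝 (e y)] rep e Y := by
  filter_upwards [e.open_target.mem_nhds (e.map_source hy)] with z hz
  rw [VectorField.mpullback_apply, he.mfderiv_symm_inverse hz]
  rfl

variable [IsManifold 𝓘(ℝ, E) ∞ M] [CompleteSpace E]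

theorem contDiffAt_rep {Y : (x : M) → TangentSpace 𝓘(ℝ, E) x} {y : M} (hy : y ∈ e.source)
    (hY : ContMDiffAt 𝓘(ℝ, E) 𝓘(ℝ, E).tangent ∞
      (fun x ↦ (⟨x, Y x⟩ : TangentBundle 𝓘(ℝ, E) M)) y) : ContDiffAt ℝ ∞ (rep e Y) (e y) := by
  have hz := e.map_source hy
  have h := ContMDiffAt.mpullback_vectorField_preimage (m := ∞) (n := ∞) (f := e.symm)
    (x₀ := e y) (V := Y) (by rwa [e.left_inv hy]) (he.contMDiffAt_symm hz)
    (he.isInvertible_symm hz) (by simp)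
  rw [contMDiffAt_vectorSpace_iff_contDiffAt] at h
  exact h.congr_of_eventuallyEq (he.rep_eventuallyEq Y hy).symm

theorem differentiableAt_rep {Y : (x : M) → TangentSpace 𝓘(ℝ, E) x} {y : M} (hy : y ∈ e.source)
    (hY : MDifferentiableAt 𝓘(ℝ, E) 𝓘(ℝ, E).tangent
      (fun x ↦ (⟨x, Y x⟩ : TangentBundle 𝓘(ℝ, E) M)) y) :
    DifferentiableAt ℝ (rep e Y) (e y) := by
  have hz := e.map_source hy
  have h := MDifferentiableAt.mpullback_vectorField (n := ∞) (f := e.symm)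
    (x₀ := e y) (V := Y) (by rwa [e.left_inv hy]) (he.contMDiffAt_symm hz)
    (he.isInvertible_symm hz) (by norm_cast)
  exact (mdifferentiableAt_vectorSpace_iff.1 h).congr_of_eventuallyEq (he.rep_eventuallyEq Y hy).symm

theorem contMDiffAt_of_rep {g : E → E} {y : M} (hy : y ∈ e.source)
    (hg : ContDiffAt ℝ ∞ g (e y)) :
    ContMDiffAt 𝓘(ℝ, E) 𝓘(ℝ, E).tangent ∞
      (fun x ↦ (⟨x, dframe e x (g (e x))⟩ : TangentBundle 𝓘(ℝ, E) M)) y :=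
  ContMDiffAt.mpullback_vectorField_preimage (m := ∞) (n := ∞) (f := e) (V := g)
    (contMDiffAt_vectorSpace_iff_contDiffAt.2 hg) (he.contMDiffAt hy) (he.isInvertible hy) (by simp)

theorem mdifferentiableAt_of_rep {g : E → E} {y : M} (hy : y ∈ e.source)
    (hg : DifferentiableAt ℝ g (e y)) :
    MDifferentiableAt 𝓘(ℝ, E) 𝓘(ℝ, E).tangent
      (fun x ↦ (⟨x, dframe e x (g (e x))⟩ : TangentBundle 𝓘(ℝ, E) M)) y := by
  exact MDifferentiableAt.mpullback_vectorField (n := ∞) (f := e) (V := g)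
    (mdifferentiableAt_vectorSpace_iff.2 hg) (he.contMDiffAt hy) (he.isInvertible hy)
    (by norm_cast)

end IsCoord

theorem rep_apply {e : OpenPartialHomeomorph M E} {Y : (x : M) → TangentSpace 𝓘(ℝ, E) x} {x : M}
    (hx : x ∈ e.source) : rep e Y (e x) = dcoord e x (Y x) := by
  rw [rep, e.left_inv hx]

theorem rep_dframe {e : OpenPartialHomeomorph M E} (he : IsCoord e) (g : E → E) {z : E}
    (hz : z ∈ e.target) : rep e (fun x ↦ dframe e x (g (e x))) z = g z := by
  rw [rep, he.dcoord_dframe (e.map_target hz), e.right_inv hz]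

end Coordinates

/-! ### Christoffel symbols -/

section Christoffel

variable {E : Type*} [NormedAddCommGroup E] [NormedSpace ℝ E] [FiniteDimensional ℝ E]
  {M : Type*} [TopologicalSpace M] [ChartedSpace E M] [IsManifold 𝓘(ℝ, E) ∞ M]

/-- The flat covariant derivative of a coordinate system. -/
def flatCov (e : OpenPartialHomeomorph M E) (Y : (x : M) → TangentSpace 𝓘(ℝ, E) x) (x : M) :
    TangentSpace 𝓘(ℝ, E) x →L[ℝ] TangentSpace 𝓘(ℝ, E) x :=
  (dframe e x).comp ((fderiv ℝ (rep e Y) (e x)).comp (dcoord e x))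

/-- The difference of two covariant derivatives is a tensor; with the flat one as reference, this
makes the Christoffel symbols well defined point by point. -/
theorem isCovariantDerivativeOn_flatCov {e : OpenPartialHomeomorph M E} (he : IsCoord e) :
    IsCovariantDerivativeOn E (I := 𝓘(ℝ, E)) (V := (TangentSpace 𝓘(ℝ, E) : M → Type _))
      (flatCov e) e.source where
  add {Y Y' x} hY hY' hx := by
    have : rep e (Y + Y') = rep e Y + rep e Y' := by
      funext z
      simp [rep]
    ext v
    simp [flatCov, this, fderiv_add (he.differentiableAt_rep hx hY) (he.differentiableAt_rep hx hY')]
  leibniz {Y g x} hY hg hx := by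
    have h1 : rep e (g • Y) = (g ∘ e.symm) • rep e Y := by
      funext z
      simp [rep]
    have hG : MDifferentiableAt 𝓘(ℝ, E) 𝓘(ℝ, ℝ) (g ∘ e.symm) (e x) :=
      MDifferentiableAt.comp _ (by rwa [e.left_inv hx])
        ((he.contMDiffAt_symm (e.map_source hx)).mdifferentiableAt (by simp))
    have h2 : (g ∘ e.symm) ∘ e =ᶠ[𝓝 x] g := by
      filter_upwards [e.open_source.mem_nhds hx] with y hy
      simp [e.left_inv hy]
    have h3 := mfderiv_comp x hG (he.mdifferentiableAt hx)
    rw [h2.mfderiv_eq] at h3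
    ext v
    refine he.dcoord_injective hx ?_
    have h4 : mvfderiv 𝓘(ℝ, E) g x v = fderiv ℝ (g ∘ e.symm) (e x) (dcoord e x v) := by
      rw [← mfderiv_eq_fderiv]
      exact DFunLike.congr_fun h3 v
    rw [flatCov, h1, fderiv_smul (mdifferentiableAt_iff_differentiableAt.1 hG)
      (he.differentiableAt_rep hx hY)]
    simp [flatCov, he.dcoord_dframe hx, e.left_inv hx, h4, rep_apply hx, Function.comp_def]

variable (cov : AffineConnection E M)

/-- The difference between a connection and the flat connection of a coordinate system. -/
def chrisAt {e : OpenPartialHomeomorph M E} (he : IsCoord e) (y : M) :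
    TangentSpace 𝓘(ℝ, E) y →L[ℝ] TangentSpace 𝓘(ℝ, E) y →L[ℝ] TangentSpace 𝓘(ℝ, E) y :=
  IsCovariantDerivativeOn.difference (cov.isCovariantDerivativeOn (s := e.source))
    (isCovariantDerivativeOn_flatCov he) y

/-- The Christoffel symbols of a connection in a coordinate system: `chris cov he z f v` is the
coordinate expression of `∇_v Y` at `z` for the field `Y` with the constant coordinates `f`. -/
def chris {e : OpenPartialHomeomorph M E} (he : IsCoord e) (z : E) : E →L[ℝ] E →L[ℝ] E :=
  LinearMap.toContinuousLinearMap
    { toFun := fun f ↦ (dcoord e (e.symm z)).comp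
        ((chrisAt cov he (e.symm z) (dframe e (e.symm z) f)).comp (dframe e (e.symm z)))
      map_add' := fun f g ↦ by ext v; simp
      map_smul' := fun c f ↦ by ext v; simp }

theorem chris_apply {e : OpenPartialHomeomorph M E} (he : IsCoord e) (z : E) (f v : E) :
    chris cov he z f v = dcoord e (e.symm z)
      (chrisAt cov he (e.symm z) (dframe e (e.symm z) f) (dframe e (e.symm z) v)) := rfl

theorem dcoord_cov {e : OpenPartialHomeomorph M E} (he : IsCoord e) {y : M} (hy : y ∈ e.source)
    {Y : (x : M) → TangentSpace 𝓘(ℝ, E) x}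
    (hY : MDifferentiableAt 𝓘(ℝ, E) 𝓘(ℝ, E).tangent
      (fun x ↦ (⟨x, Y x⟩ : TangentBundle 𝓘(ℝ, E) M)) y) (v : TangentSpace 𝓘(ℝ, E) y) :
    dcoord e y (cov Y y v) = fderiv ℝ (rep e Y) (e y) (dcoord e y v)
      + chris cov he (e y) (dcoord e y (Y y)) (dcoord e y v) := by
  obtain ⟨z, hz, rfl⟩ : ∃ z ∈ e.target, e.symm z = y := ⟨e y, e.map_source hy, e.left_inv hy⟩
  rw [e.right_inv hz, chris_apply, he.dframe_dcoord hy, he.dframe_dcoord hy, chrisAt,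
    IsCovariantDerivativeOn.difference_apply _ _ hy hY]
  simp [flatCov, e.right_inv hz, he.dcoord_dframe hy]

/-- A vector field with constant coordinates has a globally smooth modification off a point. -/
theorem exists_contMDiff_eventuallyEq [T2Space M] {e : OpenPartialHomeomorph M E} (he : IsCoord e)
    {y : M} (hy : y ∈ e.source) (f : E) :
    ∃ Y : (x : M) → TangentSpace 𝓘(ℝ, E) x,
      ContMDiff 𝓘(ℝ, E) 𝓘(ℝ, E).tangent ∞ (fun x ↦ (⟨x, Y x⟩ : TangentBundle 𝓘(ℝ, E) M)) ∧
      ∀ᶠ x in 𝓝 y, Y x = dframe e x f := by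
  obtain ⟨ρ, -, hρ⟩ := (SmoothBumpFunction.nhds_basis_tsupport (I := 𝓘(ℝ, E)) y).mem_iff.1
    (e.open_source.mem_nhds hy)
  refine ⟨(ρ : M → ℝ) • (fun x ↦ dframe e x f), ?_, ?_⟩
  · refine ContMDiffOn.smul_section_of_tsupport ρ.contMDiff.contMDiffOn e.open_source hρ ?_
    exact fun x hx ↦ (he.contMDiffAt_of_rep hx contDiffAt_const).contMDiffWithinAt
  · filter_upwards [ρ.eventuallyEq_one] with x hx
    simp [hx]

/-- Smoothness of the connection is tested on globally smooth fields, so the field with constant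
coordinates `f` is first cut off by a bump function. Near the point its coordinates are still
constant, and those of its covariant derivative are exactly the Christoffel symbols. -/
theorem contDiffOn_chris [T2Space M] (hcov : CovariantDerivative.ContMDiffCovariantDerivative cov ∞)
    {e : OpenPartialHomeomorph M E} (he : IsCoord e) :
    ContDiffOn ℝ ∞ (chris cov he) e.target := by
  refine contDiffOn_clm_apply.2 fun f ↦ contDiffOn_clm_apply.2 fun v z hz ↦ ?_
  refine ContDiffAt.contDiffWithinAt ?_
  obtain ⟨Y, hY, hY'⟩ := exists_contMDiff_eventuallyEq he (e.map_target hz) f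
  have h1 : ContMDiffAt 𝓘(ℝ, E) 𝓘(ℝ, E).tangent ∞
      (fun x ↦ (⟨x, cov Y x (dframe e x v)⟩ : TangentBundle 𝓘(ℝ, E) M)) (e.symm z) :=
    ContMDiffAt.clm_bundle_apply
      ((hcov.contMDiff.contMDiff (by simpa using hY.contMDiffOn)).contMDiffAt univ_mem)
      (he.contMDiffAt_of_rep (e.map_target hz) contDiffAt_const)
  have h2 := he.contDiffAt_rep (e.map_target hz) h1
  rw [e.right_inv hz] at h2
  refine h2.congr_of_eventuallyEq ?_
  filter_upwards [e.open_target.mem_nhds hz,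
    (e.symm.continuousAt hz).eventually hY'.eventually_nhds] with w hw hw'
  have hws := e.map_target hw
  have h3 : fderiv ℝ (rep e Y) w = 0 := by
    have : rep e Y =ᶠ[𝓝 w] fun _ ↦ f := by
      filter_upwards [(e.symm.continuousAt hw).eventually hw', e.open_target.mem_nhds hw]
        with u hu hu'
      rw [rep, hu, he.dcoord_dframe (e.map_target hu')]
    rw [this.fderiv_eq]
    simp
  rw [rep, dcoord_cov cov he hws ((hY _).mdifferentiableAt (by simp)), e.right_inv hw, h3,
    hw'.self_of_nhds, he.dcoord_dframe hws, he.dcoord_dframe hws]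
  simp

end Christoffel

/-! ### Change of coordinates and covariant differentiation along curves -/

section CovDerivCoord

variable {E : Type*} [NormedAddCommGroup E] [NormedSpace ℝ E]
  {M : Type*} [TopologicalSpace M] [ChartedSpace E M]

theorem hasMFDerivWithinAt_curve_iff {e : OpenPartialHomeomorph M E} (he : IsCoord e)
    {γ : ℝ → M} {S : Set ℝ} {s₀ : ℝ} (hs : γ s₀ ∈ e.source) (v : TangentSpace 𝓘(ℝ, E) (γ s₀)) :
    HasMFDerivWithinAt 𝓘(ℝ, ℝ) 𝓘(ℝ, E) γ S s₀ ((1 : ℝ →L[ℝ] ℝ).smulRight v) ↔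
      ContinuousWithinAt γ S s₀ ∧
        HasDerivWithinAt (fun s ↦ e (γ s)) (dcoord e (γ s₀) v) S s₀ := by
  constructor
  · intro h
    refine ⟨h.continuousWithinAt, ?_⟩
    have h1 := ((he.mdifferentiableAt hs).hasMFDerivAt).comp_hasMFDerivWithinAt s₀ h
    rw [hasMFDerivWithinAt_iff_hasFDerivWithinAt] at h1
    rw [hasDerivWithinAt_iff_hasFDerivWithinAt]
    refine h1.congr_fderiv ?_
    ext
    exact (dcoord e (γ s₀)).map_smul (1 : ℝ) v
  · rintro ⟨h, h1⟩
    rw [hasDerivWithinAt_iff_hasFDerivWithinAt] at h1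
    have h2 := (((he.contMDiffAt_symm (e.map_source hs)).mdifferentiableAt
      (by simp)).hasMFDerivAt).comp_hasMFDerivWithinAt s₀
      (hasMFDerivWithinAt_iff_hasFDerivWithinAt.2 h1)
    rw [he.mfderiv_symm (e.map_source hs)] at h2
    have h3 : γ =ᶠ[𝓝[S] s₀] e.symm ∘ (fun s ↦ e (γ s)) := by
      filter_upwards [h.eventually (e.open_source.mem_nhds hs)] with s hs
      simp [e.left_inv hs]
    have h4 := h2.congr_of_eventuallyEq h3 (by simp [e.left_inv hs])
    have h5 : (dframe e (e.symm (e (γ s₀))) : E →L[ℝ] E) (dcoord e (γ s₀) v) = v := by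
      rw [e.left_inv hs]
      exact he.dframe_dcoord hs v
    refine h4.congr_mfderiv ?_
    ext
    change dframe e (e.symm (e (γ s₀))) ((1 : ℝ) • dcoord e (γ s₀) v) = (1 : ℝ) • v
    rw [one_smul, one_smul]
    exact h5

theorem IsCoord.contDiffAt_transition {e e' : OpenPartialHomeomorph M E} (he : IsCoord e)
    (he' : IsCoord e') {y : M} (hy : y ∈ e.source) (hy' : y ∈ e'.source) :
    ContDiffAt ℝ ∞ (e' ∘ e.symm) (e y) := by
  rw [← contMDiffAt_iff_contDiffAt]
  exact ContMDiffAt.comp _ (by rw [e.left_inv hy]; exact he'.contMDiffAt hy')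
    (he.contMDiffAt_symm (e.map_source hy))

theorem dcoord_transition {e e' : OpenPartialHomeomorph M E} (he : IsCoord e)
    (he' : IsCoord e') {y : M} (hy : y ∈ e.source) (hy' : y ∈ e'.source)
    (v : TangentSpace 𝓘(ℝ, E) y) :
    dcoord e' y v = fderiv ℝ (e' ∘ e.symm) (e y) (dcoord e y v) := by
  have h2 : (e' ∘ e.symm) ∘ e =ᶠ[𝓝 y] e' := by
    filter_upwards [e.open_source.mem_nhds hy] with x hx
    simp [e.left_inv hx]
  have h3 := mfderiv_comp y (((he.contDiffAt_transition he' hy hy').differentiableAt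
    (by simp)).mdifferentiableAt) (he.mdifferentiableAt hy)
  rw [h2.mfderiv_eq, mfderiv_eq_fderiv] at h3
  exact DFunLike.congr_fun h3 v

section

variable [FiniteDimensional ℝ E] [IsManifold 𝓘(ℝ, E) ∞ M] (cov : AffineConnection E M)

/-- The transformation rule of the Christoffel symbols. -/
theorem chris_transition {e e' : OpenPartialHomeomorph M E} (he : IsCoord e) (he' : IsCoord e')
    {y : M} (hy : y ∈ e.source) (hy' : y ∈ e'.source) (f v : E) :
    fderiv ℝ (e' ∘ e.symm) (e y) (chris cov he (e y) f v) =
      fderiv ℝ (fderiv ℝ (e' ∘ e.symm)) (e y) v f +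
        chris cov he' (e' y) (fderiv ℝ (e' ∘ e.symm) (e y) f)
          (fderiv ℝ (e' ∘ e.symm) (e y) v) := by
  set φ := e' ∘ e.symm
  have hφ := he.contDiffAt_transition he' hy hy'
  have hφy : φ (e y) = e' y := by simp [φ, e.left_inv hy]
  have hY := he.mdifferentiableAt_of_rep hy (differentiableAt_const f)
  have h1 := dcoord_cov cov he hy hY (dframe e y v)
  have h1' : rep e (fun x ↦ dframe e x f) =ᶠ[𝓝 (e y)] fun _ ↦ f := by
    filter_upwards [e.open_target.mem_nhds (e.map_source hy)] with z hz
    exact rep_dframe he (fun _ ↦ f) hz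
  rw [h1'.fderiv_eq, he.dcoord_dframe hy, he.dcoord_dframe hy] at h1
  simp only [fderiv_fun_const, Pi.zero_apply, _root_.zero_apply, zero_add] at h1
  have h2 := dcoord_cov cov he' hy' hY (dframe e y v)
  -- The field with constant coordinates `f` in `e` has coordinates `dφ f` in `e'`; differentiating
  -- it yields the inhomogeneous term `D²φ`.
  have h3 : rep e' (fun x ↦ dframe e x f) ∘ φ =ᶠ[𝓝 (e y)] fun z ↦ fderiv ℝ φ z f := by
    filter_upwards [e.open_target.mem_nhds (e.map_source hy),
      (e.symm.continuousAt (e.map_source hy)).eventually_mem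
        (e'.open_source.mem_nhds (by rwa [e.left_inv hy]))] with z hz hz'
    have := e.map_target hz
    simp only [φ, Function.comp_apply]
    rw [rep_apply hz', dcoord_transition he he' this hz', he.dcoord_dframe this, e.right_inv hz]
  have h4 : fderiv ℝ (rep e' (fun x ↦ dframe e x f)) (e' y) (fderiv ℝ φ (e y) v) =
      fderiv ℝ (fderiv ℝ φ) (e y) v f := by
    have hd : DifferentiableAt ℝ (rep e' fun x ↦ dframe e x f) (φ (e y)) := by
      rw [hφy]
      exact he'.differentiableAt_rep hy' hY
    have h5 := fderiv_comp (e y) hd (hφ.differentiableAt (by simp))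
    rw [h3.fderiv_eq, hφy] at h5
    have h6 : DifferentiableAt ℝ (fderiv ℝ φ) (e y) :=
      (hφ.fderiv_right (m := 1) (by norm_cast)).differentiableAt (by simp)
    rw [fderiv_clm_apply h6 (differentiableAt_const f)] at h5
    simpa using (DFunLike.congr_fun h5 v).symm
  rw [dcoord_transition he he' hy hy', dcoord_transition he he' hy hy',
    dcoord_transition he he' hy hy', h1, he.dcoord_dframe hy, he.dcoord_dframe hy, h4] at h2
  exact h2

/-- The coordinate expression of covariant differentiation along a curve. -/
def HasCoordCovDeriv {e : OpenPartialHomeomorph M E} (he : IsCoord e) (γ : ℝ → M)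
    (X : (s : ℝ) → TangentSpace 𝓘(ℝ, E) (γ s)) (S : Set ℝ) (s₀ : ℝ)
    (D : TangentSpace 𝓘(ℝ, E) (γ s₀)) : Prop :=
  ContinuousWithinAt γ S s₀ ∧ ∃ c' j' : E,
    HasDerivWithinAt (fun s ↦ e (γ s)) c' S s₀ ∧
    HasDerivWithinAt (fun s ↦ dcoord e (γ s) (X s)) j' S s₀ ∧
    dcoord e (γ s₀) D = j' + chris cov he (e (γ s₀)) (dcoord e (γ s₀) (X s₀)) c'

variable {cov}

/-- The product rule for `dφ (X)` produces a term `D²φ (c') X`, which is exactly the inhomogeneous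
term in the transformation rule of the Christoffel symbols. -/
theorem HasCoordCovDeriv.transition {e e' : OpenPartialHomeomorph M E} {he : IsCoord e}
    {γ : ℝ → M} {X : (s : ℝ) → TangentSpace 𝓘(ℝ, E) (γ s)} {S : Set ℝ} {s₀ : ℝ}
    {D : TangentSpace 𝓘(ℝ, E) (γ s₀)} (h : HasCoordCovDeriv cov he γ X S s₀ D) (he' : IsCoord e')
    (hy : γ s₀ ∈ e.source) (hy' : γ s₀ ∈ e'.source) : HasCoordCovDeriv cov he' γ X S s₀ D := by
  obtain ⟨hc, c', j', h1, h2, h3⟩ := h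
  have hφ := he.contDiffAt_transition he' hy hy'
  have h6 : DifferentiableAt ℝ (fderiv ℝ (e' ∘ e.symm)) (e (γ s₀)) :=
    (hφ.fderiv_right (m := 1) (by norm_cast)).differentiableAt (by simp)
  have h4 : HasDerivWithinAt (fun s ↦ (e' ∘ e.symm) (e (γ s)))
      (fderiv ℝ (e' ∘ e.symm) (e (γ s₀)) c') S s₀ :=
    (hφ.differentiableAt (by simp)).hasFDerivAt.comp_hasDerivWithinAt s₀ h1
  have h7 : HasDerivWithinAt (fun s ↦ fderiv ℝ (e' ∘ e.symm) (e (γ s)))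
      (fderiv ℝ (fderiv ℝ (e' ∘ e.symm)) (e (γ s₀)) c') S s₀ :=
    h6.hasFDerivAt.comp_hasDerivWithinAt s₀ h1
  have h5 := h7.clm_apply h2
  have hev : ∀ᶠ s in 𝓝[S] s₀, γ s ∈ e.source ∧ γ s ∈ e'.source :=
    (hc.eventually (e.open_source.mem_nhds hy)).and (hc.eventually (e'.open_source.mem_nhds hy'))
  refine ⟨hc, fderiv ℝ (e' ∘ e.symm) (e (γ s₀)) c', _,
    h4.congr_of_eventuallyEq ?_ ?_, h5.congr_of_eventuallyEq ?_ ?_, ?_⟩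
  · filter_upwards [hev] with s hs
    simp [e.left_inv hs.1]
  · simp [e.left_inv hy]
  · filter_upwards [hev] with s hs
    exact dcoord_transition he he' hs.1 hs.2 _
  · exact dcoord_transition he he' hy hy' _
  · rw [dcoord_transition he he' hy hy', dcoord_transition he he' hy hy', h3, map_add,
      chris_transition cov he he' hy hy']
    abel

omit [FiniteDimensional ℝ E] in
theorem dcoord_chartAt {x₀ x : M} (hx : x ∈ (chartAt E x₀).source) (v : TangentSpace 𝓘(ℝ, E) x) :
    (trivializationAt E (TangentSpace 𝓘(ℝ, E)) x₀).continuousLinearMapAt ℝ x v =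
      dcoord (chartAt E x₀) x v := by
  rw [TangentBundle.continuousLinearMapAt_trivializationAt hx]
  rfl

omit [FiniteDimensional ℝ E] in
theorem rep_extend {x₀ : M} (w : TangentSpace 𝓘(ℝ, E) x₀) {z : E}
    (hz : z ∈ (chartAt E x₀).target) :
    rep (chartAt E x₀) (FiberBundle.extend E w) z = dcoord (chartAt E x₀) x₀ w := by
  have hx := (chartAt E x₀).map_target hz
  have hx' : (chartAt E x₀).symm z ∈
      (trivializationAt E (TangentSpace 𝓘(ℝ, E)) x₀).baseSet := by simpa using hx
  rw [rep, ← dcoord_chartAt hx, ← dcoord_chartAt (mem_chart_source E x₀), FiberBundle.extend]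
  have h := Bundle.Trivialization.continuousLinearMapAt_symmL (R := ℝ)
    (trivializationAt E (TangentSpace 𝓘(ℝ, E)) x₀) hx'
    (trivializationAt E (TangentSpace 𝓘(ℝ, E)) x₀ ⟨x₀, w⟩).2
  rw [Bundle.Trivialization.symmL_apply] at h
  refine h.trans ?_
  rw [Bundle.Trivialization.continuousLinearMapAt_apply,
    Bundle.Trivialization.coe_linearMapAt_of_mem _ (mem_baseSet_trivializationAt _ _ _)]
  exact hx'

/-- The trivialization in the definition is the differential of the preferred chart at `γ s₀`, and
the field extending `X s₀` has constant coordinates there. The gain is that any coordinate system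
may be used, in particular one pushed forward by a local diffeomorphism. -/
theorem hasCovDerivWithinAt_iff {e : OpenPartialHomeomorph M E} (he : IsCoord e)
    {γ : ℝ → M} {X : (s : ℝ) → TangentSpace 𝓘(ℝ, E) (γ s)} {S : Set ℝ} {s₀ : ℝ}
    {D : TangentSpace 𝓘(ℝ, E) (γ s₀)} (hy : γ s₀ ∈ e.source) :
    HasCovDerivWithinAt cov γ X S s₀ D ↔ HasCoordCovDeriv cov he γ X S s₀ D := by
  have he₀ := isCoord_chartAt (E := E) (γ s₀)
  have hy₀ := mem_chart_source E (γ s₀)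
  suffices HasCovDerivWithinAt cov γ X S s₀ D ↔ HasCoordCovDeriv cov he₀ γ X S s₀ D from
    this.trans ⟨fun h ↦ h.transition he hy₀ hy, fun h ↦ h.transition he₀ hy hy₀⟩
  have h1 : ∀ v, dcoord (chartAt E (γ s₀)) (γ s₀) (cov (FiberBundle.extend E (X s₀)) (γ s₀) v) =
      chris cov he₀ (chartAt E (γ s₀) (γ s₀)) (dcoord (chartAt E (γ s₀)) (γ s₀) (X s₀))
        (dcoord (chartAt E (γ s₀)) (γ s₀) v) := by
    intro v
    rw [dcoord_cov cov he₀ hy₀ (FiberBundle.mdifferentiableAt_extend _ _ _)]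
    have : rep (chartAt E (γ s₀)) (FiberBundle.extend E (X s₀)) =ᶠ[𝓝 (chartAt E (γ s₀) (γ s₀))]
        fun _ ↦ dcoord (chartAt E (γ s₀)) (γ s₀) (X s₀) := by
      filter_upwards [(chartAt E (γ s₀)).open_target.mem_nhds (mem_chart_target E _)] with z hz
      exact rep_extend _ hz
    rw [this.fderiv_eq]
    simp
  have h2 : ∀ f, dcoord (chartAt E (γ s₀)) (γ s₀)
      ((trivializationAt E (TangentSpace 𝓘(ℝ, E)) (γ s₀)).symmL ℝ (γ s₀) f) = f := by
    intro f
    rw [← dcoord_chartAt hy₀]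
    exact Bundle.Trivialization.continuousLinearMapAt_symmL _ (by simp) _
  have h3 : ∀ f', ContinuousWithinAt γ S s₀ → (HasDerivWithinAt
      (fun s ↦ (trivializationAt E (TangentSpace 𝓘(ℝ, E)) (γ s₀)).continuousLinearMapAt ℝ
        (γ s) (X s)) f' S s₀ ↔
      HasDerivWithinAt (fun s ↦ dcoord (chartAt E (γ s₀)) (γ s) (X s)) f' S s₀) := by
    intro f' hc
    refine Filter.EventuallyEq.hasDerivWithinAt_iff ?_ ?_
    · filter_upwards [hc.eventually ((chartAt E (γ s₀)).open_source.mem_nhds hy₀)] with s hs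
      exact dcoord_chartAt hs _
    · exact dcoord_chartAt hy₀ _
  constructor
  · rintro ⟨γ', f', h4, h5, rfl⟩
    have h6 := (hasMFDerivWithinAt_curve_iff he₀ hy₀ γ').1 h4
    refine ⟨h6.1, _, f', h6.2, (h3 _ h6.1).1 h5, ?_⟩
    rw [map_add, h1, h2]
  · rintro ⟨hc, c', j', h4, h5, h6⟩
    refine ⟨dframe (chartAt E (γ s₀)) _ c', j', (hasMFDerivWithinAt_curve_iff he₀ hy₀ _).2 ⟨hc, ?_⟩,
      (h3 _ hc).2 h5, he₀.dcoord_injective hy₀ ?_⟩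
    · rwa [he₀.dcoord_dframe hy₀]
    · rw [h6, map_add, h1, h2, he₀.dcoord_dframe hy₀]

end

end CovDerivCoord

/-! ### Torsion and curvature in coordinates -/

section Tensors

variable {E : Type*} [NormedAddCommGroup E] [NormedSpace ℝ E] [FiniteDimensional ℝ E]
  {M : Type*} [TopologicalSpace M] [ChartedSpace E M] [IsManifold 𝓘(ℝ, E) ∞ M]
  (cov : AffineConnection E M)

omit [FiniteDimensional ℝ E] in
theorem mlieBracket_vectorSpace (V W : (x : E) → TangentSpace 𝓘(ℝ, E) x) (z : E) :
    VectorField.mlieBracket 𝓘(ℝ, E) V W z = VectorField.lieBracket ℝ V W z := by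
  rw [← VectorField.mlieBracketWithin_univ, VectorField.mlieBracketWithin_eq_lieBracketWithin]
  exact congrFun (VectorField.lieBracketWithin_univ (𝕜 := ℝ) (V := V) (W := W)) z

omit [FiniteDimensional ℝ E] in
theorem dcoord_mlieBracket [CompleteSpace E] {e : OpenPartialHomeomorph M E} (he : IsCoord e)
    {y : M} (hy : y ∈ e.source) {Y Z : (x : M) → TangentSpace 𝓘(ℝ, E) x}
    (hY : MDifferentiableAt 𝓘(ℝ, E) 𝓘(ℝ, E).tangent
      (fun x ↦ (⟨x, Y x⟩ : TangentBundle 𝓘(ℝ, E) M)) y)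
    (hZ : MDifferentiableAt 𝓘(ℝ, E) 𝓘(ℝ, E).tangent
      (fun x ↦ (⟨x, Z x⟩ : TangentBundle 𝓘(ℝ, E) M)) y) :
    dcoord e y (VectorField.mlieBracket 𝓘(ℝ, E) Y Z y) =
      fderiv ℝ (rep e Z) (e y) (dcoord e y (Y y)) - fderiv ℝ (rep e Y) (e y) (dcoord e y (Z y)) := by
  obtain ⟨z, hz, rfl⟩ : ∃ z ∈ e.target, e.symm z = y := ⟨e y, e.map_source hy, e.left_inv hy⟩
  have : IsManifold 𝓘(ℝ, E) (minSmoothness ℝ 2) M :=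
    IsManifold.of_le (n := ∞) (by rw [minSmoothness_of_isRCLikeNormedField]; norm_cast)
  have h := VectorField.mpullback_mlieBracket (n := ∞) (f := e.symm) (x₀ := z) hY hZ
    (he.contMDiffAt_symm hz) (by rw [minSmoothness_of_isRCLikeNormedField]; norm_cast)
  have h1 := he.rep_eventuallyEq Y hy
  have h2 := he.rep_eventuallyEq Z hy
  rw [e.right_inv hz] at h1 h2 ⊢
  rw [h1.mlieBracket_vectorField_eq h2] at h
  have h3 : VectorField.mpullback 𝓘(ℝ, E) 𝓘(ℝ, E) e.symm (VectorField.mlieBracket 𝓘(ℝ, E) Y Z) z =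
      dcoord e (e.symm z) (VectorField.mlieBracket 𝓘(ℝ, E) Y Z (e.symm z)) := by
    rw [VectorField.mpullback_apply, he.mfderiv_symm_inverse hz]
    rfl
  exact h3.symm.trans (h.trans (mlieBracket_vectorSpace _ _ z))

theorem dcoord_torsion {e : OpenPartialHomeomorph M E} (he : IsCoord e) {y : M}
    (hy : y ∈ e.source) (v w : TangentSpace 𝓘(ℝ, E) y) :
    dcoord e y (cov.torsion y v w) =
      chris cov he (e y) (dcoord e y w) (dcoord e y v) -
        chris cov he (e y) (dcoord e y v) (dcoord e y w) := by
  have hv := FiberBundle.mdifferentiableAt_extend 𝓘(ℝ, E) E v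
  have hw := FiberBundle.mdifferentiableAt_extend 𝓘(ℝ, E) E w
  have h := cov.torsion_apply hv hw
  rw [FiberBundle.extend_apply_self, FiberBundle.extend_apply_self] at h
  rw [h, map_sub, map_sub, dcoord_mlieBracket he hy hv hw, dcoord_cov cov he hy hv,
    dcoord_cov cov he hy hw, FiberBundle.extend_apply_self, FiberBundle.extend_apply_self]
  abel

/-- The coordinate expression of the curvature. -/
def coordCurvature {e : OpenPartialHomeomorph M E} (he : IsCoord e) (z u v w : E) : E :=
  fderiv ℝ (chris cov he) z u w v - fderiv ℝ (chris cov he) z v w u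
    + (chris cov he z (chris cov he z w v) u - chris cov he z (chris cov he z w u) v)

/-- The coordinate formula for `∇` applied twice. The terms with derivatives of `V` and `W` are kept
explicit because they have to cancel in the curvature. -/
theorem dcoord_cov_cov [T2Space M] (hcov : CovariantDerivative.ContMDiffCovariantDerivative cov ∞)
    {e : OpenPartialHomeomorph M E} (he : IsCoord e) {y : M}
    (hy : y ∈ e.source) {V W : (x : M) → TangentSpace 𝓘(ℝ, E) x}
    (hV : ContMDiffAt 𝓘(ℝ, E) 𝓘(ℝ, E).tangent ∞
      (fun x ↦ (⟨x, V x⟩ : TangentBundle 𝓘(ℝ, E) M)) y)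
    (hW : ContMDiffAt 𝓘(ℝ, E) 𝓘(ℝ, E).tangent ∞
      (fun x ↦ (⟨x, W x⟩ : TangentBundle 𝓘(ℝ, E) M)) y) (u : TangentSpace 𝓘(ℝ, E) y) :
    dcoord e y (cov (fun x ↦ cov W x (V x)) y u) =
      fderiv ℝ (fderiv ℝ (rep e W)) (e y) (dcoord e y u) (rep e V (e y)) +
      fderiv ℝ (rep e W) (e y) (fderiv ℝ (rep e V) (e y) (dcoord e y u)) +
      (fderiv ℝ (chris cov he) (e y) (dcoord e y u) (rep e W (e y)) (rep e V (e y)) +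
        chris cov he (e y) (fderiv ℝ (rep e W) (e y) (dcoord e y u)) (rep e V (e y)) +
        chris cov he (e y) (rep e W (e y)) (fderiv ℝ (rep e V) (e y) (dcoord e y u))) +
      chris cov he (e y) (fderiv ℝ (rep e W) (e y) (rep e V (e y)) +
        chris cov he (e y) (rep e W (e y)) (rep e V (e y))) (dcoord e y u) := by
  set g : E → E := fun z ↦ fderiv ℝ (rep e W) z (rep e V z) + chris cov he z (rep e W z) (rep e V z)
  have hrV := he.contDiffAt_rep hy hV
  have hrW := he.contDiffAt_rep hy hW
  have hdV := hrV.differentiableAt (n := ∞) (by simp)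
  have hdW := hrW.differentiableAt (n := ∞) (by simp)
  have hdW' : DifferentiableAt ℝ (fderiv ℝ (rep e W)) (e y) :=
    (hrW.fderiv_right (m := 1) (by norm_cast)).differentiableAt (by simp)
  have hΓ : DifferentiableAt ℝ (chris cov he) (e y) :=
    ((contDiffOn_chris cov hcov he).contDiffAt (e.open_target.mem_nhds (e.map_source hy))
      ).differentiableAt (by simp)
  have hg1 := hdW'.hasFDerivAt.clm_apply hdV.hasFDerivAt
  have hg2 := (hΓ.hasFDerivAt.clm_apply hdW.hasFDerivAt).clm_apply hdV.hasFDerivAt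
  have hg := hg1.add hg2
  have hev : ∀ᶠ x in 𝓝 y, cov W x (V x) = dframe e x (g (e x)) := by
    -- Regularity of finite order at a point spreads to a neighbourhood, whereas order `∞` at a
    -- point need not.
    have hW' : ∀ᶠ x in 𝓝 y, ContMDiffAt 𝓘(ℝ, E) 𝓘(ℝ, E).tangent 1
      (fun x ↦ (⟨x, W x⟩ : TangentBundle 𝓘(ℝ, E) M)) x :=
      (contMDiffAt_iff_contMDiffAt_nhds (by simp)).1 (hW.of_le (by norm_cast))
    filter_upwards [hW', e.open_source.mem_nhds hy] with x hx hx'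
    refine he.dcoord_injective hx' ?_
    rw [he.dcoord_dframe hx', dcoord_cov cov he hx' (hx.mdifferentiableAt (by simp))]
    simp only [g, rep_apply hx']
  have hevT : (fun x ↦ (⟨x, cov W x (V x)⟩ : TangentBundle 𝓘(ℝ, E) M)) =ᶠ[𝓝 y]
      fun x ↦ ⟨x, dframe e x (g (e x))⟩ := by
    filter_upwards [hev] with x hx
    rw [hx]
  have hY : MDifferentiableAt 𝓘(ℝ, E) 𝓘(ℝ, E).tangent
      (fun x ↦ (⟨x, cov W x (V x)⟩ : TangentBundle 𝓘(ℝ, E) M)) y :=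
    (he.mdifferentiableAt_of_rep hy (g := g) hg.differentiableAt).congr_of_eventuallyEq hevT
  rw [dcoord_cov cov he hy hY]
  have hrep : rep e (fun x ↦ cov W x (V x)) =ᶠ[𝓝 (e y)] g := by
    filter_upwards [(e.symm.continuousAt (e.map_source hy)).eventually
      (by rwa [e.left_inv hy] :
        ∀ᶠ x in 𝓝 (e.symm (e y)), cov W x (V x) = dframe e x (g (e x))),
      e.open_target.mem_nhds (e.map_source hy)] with z hz hz'
    rw [rep, hz, he.dcoord_dframe (e.map_target hz'), e.right_inv hz']
  have hyv : dcoord e y (cov W y (V y)) = g (e y) := by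
    rw [hev.self_of_nhds, he.dcoord_dframe hy]
  rw [hrep.fderiv_eq, hyv, (show HasFDerivAt g _ _ from hg).fderiv]
  simp [g, ContinuousLinearMap.flip_apply]
  abel

/-- Second derivatives of the extension of `w` cancel by symmetry, and the first-derivative terms of
the extensions of `u` and `v` cancel against the bracket term. Only values at `y` remain. -/
theorem dcoord_curvature [T2Space M]
    (hcov : CovariantDerivative.ContMDiffCovariantDerivative cov ∞)
    {e : OpenPartialHomeomorph M E} (he : IsCoord e) {y : M} (hy : y ∈ e.source)
    (u v w : TangentSpace 𝓘(ℝ, E) y) :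
    dcoord e y (curvature cov y u v w) =
      coordCurvature cov he (e y) (dcoord e y u) (dcoord e y v) (dcoord e y w) := by
  have hs : ∀ v : TangentSpace 𝓘(ℝ, E) y, ContMDiffAt 𝓘(ℝ, E) 𝓘(ℝ, E).tangent ∞
      (fun x ↦ (⟨x, FiberBundle.extend E v x⟩ : TangentBundle 𝓘(ℝ, E) M)) y :=
    fun v ↦ FiberBundle.contMDiffAt_extend 𝓘(ℝ, E) E v
  have hd : ∀ v : TangentSpace 𝓘(ℝ, E) y, MDifferentiableAt 𝓘(ℝ, E) 𝓘(ℝ, E).tangent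
      (fun x ↦ (⟨x, FiberBundle.extend E v x⟩ : TangentBundle 𝓘(ℝ, E) M)) y :=
    fun v ↦ (hs v).mdifferentiableAt (by simp)
  have hsymm : fderiv ℝ (fderiv ℝ (rep e (FiberBundle.extend E w))) (e y) (dcoord e y u)
      (dcoord e y v) = fderiv ℝ (fderiv ℝ (rep e (FiberBundle.extend E w))) (e y) (dcoord e y v)
      (dcoord e y u) :=
    ((he.contDiffAt_rep hy (hs w)).isSymmSndFDerivAt (by simp; norm_cast)) _ _
  rw [curvature, map_sub, map_sub, dcoord_cov_cov cov hcov he hy (hs v) (hs w),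
    dcoord_cov_cov cov hcov he hy (hs u) (hs w), dcoord_cov cov he hy (hd w),
    dcoord_mlieBracket he hy (hd u) (hd v)]
  simp only [rep_apply hy, FiberBundle.extend_apply_self, coordCurvature, map_add, map_sub,
    _root_.add_apply, hsymm]
  abel

end Tensors

/-! ### Coordinates pushed forward by a local diffeomorphism -/

section RelatedCoordinates

variable {E : Type*} [NormedAddCommGroup E] [NormedSpace ℝ E]
  {M : Type*} [TopologicalSpace M] [ChartedSpace E M]

/-- Near `x` the map `f` is the identity in the coordinates `e` and `e'`. -/
def RelCoord (f : M → M) (e e' : OpenPartialHomeomorph M E) (x : M) : Prop :=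
  ∀ᶠ y in 𝓝 x, y ∈ e.source ∧ f y ∈ e'.source ∧ e' (f y) = e y

/-- Take `e' = e ∘ f⁻¹` for a local inverse of `f`. -/
theorem exists_relCoord {f : M → M} {x : M} (hf : IsLocalDiffeomorphAt 𝓘(ℝ, E) 𝓘(ℝ, E) ∞ f x)
    {e : OpenPartialHomeomorph M E} (he : IsCoord e) (hx : x ∈ e.source) :
    ∃ e', IsCoord e' ∧ RelCoord f e e' x := by
  obtain ⟨φ, hxφ, hφ⟩ := hf
  refine ⟨φ.symm.toOpenPartialHomeomorph.trans e, ⟨?_, ?_⟩, ?_⟩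
  · refine he.contMDiffOn.comp (φ.contMDiffOn_invFun.mono ?_) ?_
    · exact fun y hy ↦ hy.1
    · exact fun y hy ↦ hy.2
  · refine φ.contMDiffOn_toFun.comp (he.contMDiffOn_symm.mono ?_) ?_
    · exact fun y hy ↦ hy.1
    · exact fun y hy ↦ hy.2
  · filter_upwards [e.open_source.mem_nhds hx, φ.open_source.mem_nhds hxφ] with y hy hyφ
    have h : φ.symm (f y) = y := by
      rw [hφ hyφ]
      exact φ.left_inv' hyφ
    refine ⟨hy, ⟨?_, ?_⟩, ?_⟩
    · rw [hφ hyφ]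
      exact φ.map_source' hyφ
    · change φ.symm (f y) ∈ e.source
      rwa [h]
    · change e (φ.symm (f y)) = e y
      rw [h]

namespace RelCoord

variable {f : M → M} {e e' : OpenPartialHomeomorph M E} {x : M} (h : RelCoord f e e' x)
include h

theorem mem_source : x ∈ e.source := h.self_of_nhds.1

theorem map_mem_source : f x ∈ e'.source := h.self_of_nhds.2.1

theorem apply_eq : e' (f x) = e x := h.self_of_nhds.2.2

protected theorem eventually : ∀ᶠ y in 𝓝 x, RelCoord f e e' y := h.eventually_nhds

theorem eventuallyEq : f =ᶠ[𝓝 x] e'.symm ∘ e := by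
  filter_upwards [h] with y hy
  rw [Function.comp_apply, ← hy.2.2, e'.left_inv hy.2.1]

theorem continuousAt : ContinuousAt f x := by
  have h1 := h.map_mem_source
  refine ContinuousAt.congr (ContinuousAt.comp ?_ (e.continuousAt h.mem_source)) h.eventuallyEq.symm
  rw [← h.apply_eq]
  exact e'.continuousAt_symm (e'.map_source h1)

theorem mdifferentiableAt (he : IsCoord e) (he' : IsCoord e') :
    MDifferentiableAt 𝓘(ℝ, E) 𝓘(ℝ, E) f x := by
  refine MDifferentiableAt.congr_of_eventuallyEq ?_ h.eventuallyEq
  refine MDifferentiableAt.comp x ?_ (he.mdifferentiableAt h.mem_source)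
  rw [← h.apply_eq]
  exact (he'.contMDiffAt_symm (e'.map_source h.map_mem_source)).mdifferentiableAt (by simp)

theorem dcoord_mfderiv (he : IsCoord e) (he' : IsCoord e') (v : TangentSpace 𝓘(ℝ, E) x) :
    dcoord e' (f x) (mfderiv 𝓘(ℝ, E) 𝓘(ℝ, E) f x v) = dcoord e x v := by
  have h1 := mfderiv_comp x (he'.mdifferentiableAt h.map_mem_source) (h.mdifferentiableAt he he')
  have h2 : e' ∘ f =ᶠ[𝓝 x] e := h.mono fun y hy ↦ hy.2.2
  rw [h2.mfderiv_eq] at h1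
  exact (DFunLike.congr_fun h1 v).symm

/-- The map `e.symm ∘ e'` is the local inverse of `f`; it transports local properties from `x` to `f
x`. -/
theorem eventually_image {P : M → Prop} (hP : ∀ᶠ y in 𝓝 x, P y) :
    ∀ᶠ q in 𝓝 (f x), P (e.symm (e' q)) ∧ f (e.symm (e' q)) = q ∧ e (e.symm (e' q)) = e' q := by
  have h1 : Tendsto (e.symm ∘ e') (𝓝 (f x)) (𝓝 x) := by
    have := e.continuousAt_symm (e.map_source h.mem_source)
    rw [ContinuousAt, e.left_inv h.mem_source] at this
    refine this.comp ?_
    rw [← h.apply_eq]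
    exact e'.continuousAt h.map_mem_source
  have h2 : ∀ᶠ q in 𝓝 (f x), e' q ∈ e.target :=
    (e'.continuousAt h.map_mem_source).eventually_mem
      (e.open_target.mem_nhds (by rw [h.apply_eq]; exact e.map_source h.mem_source))
  filter_upwards [h1.eventually hP, h1.eventually h, h2,
    e'.open_source.mem_nhds h.map_mem_source] with q hq hq1 hq2 hq3
  refine ⟨hq, e'.injOn hq1.2.1 hq3 ?_, e.right_inv hq2⟩
  exact hq1.2.2.trans (e.right_inv hq2)

theorem image_mem_nhds {N : Set M} (hN : N ∈ 𝓝 x) : f '' N ∈ 𝓝 (f x) := by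
  filter_upwards [h.eventually_image hN] with q hq
  exact ⟨_, hq.1, hq.2.1⟩

theorem rep_eventuallyEq (he : IsCoord e) (he' : IsCoord e')
    {Y Y' : (x : M) → TangentSpace 𝓘(ℝ, E) x}
    (hY : ∀ᶠ y in 𝓝 x, mfderiv 𝓘(ℝ, E) 𝓘(ℝ, E) f y (Y y) = Y' (f y)) :
    rep e' Y' =ᶠ[𝓝 (e x)] rep e Y := by
  have h1 := e.continuousAt_symm (e.map_source h.mem_source)
  rw [ContinuousAt, e.left_inv h.mem_source] at h1
  filter_upwards [h1.eventually hY, h1.eventually h.eventually,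
    e.open_target.mem_nhds (e.map_source h.mem_source)] with z hz hz1 hz2
  have h2 : e' (f (e.symm z)) = z := by rw [hz1.apply_eq, e.right_inv hz2]
  have h3 := rep_apply (Y := Y') hz1.map_mem_source
  rw [h2] at h3
  rw [h3, ← hz, hz1.dcoord_mfderiv he he', rep]

end RelCoord

end RelatedCoordinates

/-! ### Affine maps as equality of Christoffel symbols -/

section Affine

variable {E : Type*} [NormedAddCommGroup E] [NormedSpace ℝ E] [FiniteDimensional ℝ E]
  {M : Type*} [TopologicalSpace M] [ChartedSpace E M] [IsManifold 𝓘(ℝ, E) ∞ M]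
  (cov : AffineConnection E M)

/-- `f` preserves the connection near `x`. -/
def AffineAt (f : M → M) (x : M) : Prop :=
  ∃ (e e' : OpenPartialHomeomorph M E) (he : IsCoord e) (he' : IsCoord e'), RelCoord f e e' x ∧
    ∀ᶠ z in 𝓝 (e x), chris cov he' z = chris cov he z

variable {cov}

/-- Apply `map_cov` to a field with constant coordinates near the point and to its push-forward,
which has the same constant coordinates in the related system. The derivative terms vanish on both
sides and the Christoffel terms are left. -/
theorem IsLocalAffine.affineAt [T2Space M] {f : M → M} {N : Set M} (h : IsLocalAffine cov f N)
    {x : M} (hx : x ∈ N) : AffineAt cov f x := by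
  obtain ⟨e', he', hrel⟩ := exists_relCoord (h.isLocalDiffeomorphOn ⟨x, hx⟩)
    (isCoord_chartAt (E := E) x) (mem_chart_source E x)
  set e := chartAt E x
  have he : IsCoord e := isCoord_chartAt x
  refine ⟨e, e', he, he', hrel, ?_⟩
  have h1 := e.continuousAt_symm (e.map_source hrel.mem_source)
  rw [ContinuousAt, e.left_inv hrel.mem_source] at h1
  filter_upwards [h1.eventually hrel.eventually, h1.eventually (h.isOpen.mem_nhds hx),
    e.open_target.mem_nhds (e.map_source hrel.mem_source)] with z hz hzN hz2
  set y := e.symm z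
  have hzy : z = e y := (e.right_inv hz2).symm
  rw [hzy]
  ext c v
  obtain ⟨Y, hY, hYy⟩ := exists_contMDiff_eventuallyEq he hz.mem_source c
  have : Nonempty M := ⟨x⟩
  set g := Function.invFunOn f N
  have hg : ∀ q ∈ N, g (f q) = q := fun q hq ↦ h.injOn.leftInvOn_invFunOn hq
  -- The push-forward of `Y`, defined through the inverse of `f` on `f '' N`. It is smooth because,
  -- near each `f q`, it has the coordinate expression of `Y` in related coordinates.
  let Y' : (x : M) → TangentSpace 𝓘(ℝ, E) x :=
    fun q ↦ (mfderiv 𝓘(ℝ, E) 𝓘(ℝ, E) f (g q) (Y (g q)) : E)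
  have hYY' : ∀ q ∈ N, mfderiv 𝓘(ℝ, E) 𝓘(ℝ, E) f q (Y q) = Y' (f q) := by
    intro q hq
    change _ = (mfderiv 𝓘(ℝ, E) 𝓘(ℝ, E) f (g (f q)) (Y (g (f q))) : E)
    rw [hg q hq]
  have hY' : ContMDiffOn 𝓘(ℝ, E) 𝓘(ℝ, E).tangent ∞
      (fun x ↦ (⟨x, Y' x⟩ : TangentBundle 𝓘(ℝ, E) M)) (f '' N) := by
    rintro _ ⟨q, hq, rfl⟩
    refine ContMDiffAt.contMDiffWithinAt ?_
    obtain ⟨e₁', he₁', hrel₁⟩ := exists_relCoord (h.isLocalDiffeomorphOn ⟨q, hq⟩)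
      (isCoord_chartAt (E := E) q) (mem_chart_source E q)
    have he₁ := isCoord_chartAt (E := E) q
    have h2 : ContDiffAt ℝ ∞ (rep (chartAt E q) Y) (e₁' (f q)) := by
      rw [hrel₁.apply_eq]
      exact he₁.contDiffAt_rep hrel₁.mem_source hY.contMDiffAt
    refine (he₁'.contMDiffAt_of_rep hrel₁.map_mem_source h2).congr_of_eventuallyEq ?_
    filter_upwards [hrel₁.eventually_image (hrel₁.eventually.and (h.isOpen.mem_nhds hq)),
      e₁'.open_source.mem_nhds hrel₁.map_mem_source] with p ⟨⟨hp1, hp2⟩, hp3, hp4⟩ hp5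
    have h3 : Y' p = dframe e₁' p (rep (chartAt E q) Y (e₁' p)) := by
      refine he₁'.dcoord_injective hp5 ?_
      rw [he₁'.dcoord_dframe hp5, rep, ← hp1.dcoord_mfderiv he₁ he₁', hYY' _ hp2, hp3]
    rw [h3]
  have h2 := h.map_cov Y Y' hY.contMDiffOn hY' hYY' y hzN (dframe e y v)
  have h3 := congrArg (dcoord e' (f y)) h2
  have h4 : rep e Y =ᶠ[𝓝 (e y)] fun _ ↦ c := by
    have h5 := e.continuousAt_symm (e.map_source hz.mem_source)
    rw [ContinuousAt, e.left_inv hz.mem_source] at h5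
    filter_upwards [h5.eventually hYy, e.open_target.mem_nhds (e.map_source hz.mem_source)]
      with w hw hw'
    rw [rep, hw, he.dcoord_dframe (e.map_target hw')]
  have h6 : rep e' Y' =ᶠ[𝓝 (e y)] fun _ ↦ c :=
    (hz.rep_eventuallyEq he he' (eventually_of_mem (h.isOpen.mem_nhds hzN) hYY')).trans h4
  have h7 : dcoord e y (Y y) = c := by rw [hYy.self_of_nhds, he.dcoord_dframe hz.mem_source]
  rw [hz.dcoord_mfderiv he he', dcoord_cov cov he hz.mem_source
      (hY.contMDiffAt.mdifferentiableAt (by simp)), dcoord_cov cov he' hz.map_mem_source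
      ((hY'.contMDiffAt (hz.image_mem_nhds (h.isOpen.mem_nhds hzN))).mdifferentiableAt (by simp)),
    hz.apply_eq, h4.fderiv_eq, h6.fderiv_eq, ← hYY' y hzN, hz.dcoord_mfderiv he he',
    hz.dcoord_mfderiv he he', h7, he.dcoord_dframe hz.mem_source] at h3
  simpa using h3.symm

theorem isLocalAffine_of_affineAt {f : M → M} {N : Set M} (hN : IsOpen N) (hinj : InjOn f N)
    (hf : IsLocalDiffeomorphOn 𝓘(ℝ, E) 𝓘(ℝ, E) ∞ f N) (h : ∀ x ∈ N, AffineAt cov f x) :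
    IsLocalAffine cov f N := by
  refine ⟨hN, hinj, hf, fun Y Y' hY hY' hYY' x hx v ↦ ?_⟩
  obtain ⟨e, e', he, he', hrel, hΓ⟩ := h x hx
  refine he'.dcoord_injective hrel.map_mem_source ?_
  rw [hrel.dcoord_mfderiv he he', dcoord_cov cov he hrel.mem_source
      ((hY.contMDiffAt (hN.mem_nhds hx)).mdifferentiableAt (by simp)),
      dcoord_cov cov he' hrel.map_mem_source
      ((hY'.contMDiffAt (hrel.image_mem_nhds (hN.mem_nhds hx))).mdifferentiableAt (by simp)),
      hrel.apply_eq, (hrel.rep_eventuallyEq he he'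
      (eventually_of_mem (hN.mem_nhds hx) hYY')).fderiv_eq, ← hYY' x hx,
      hrel.dcoord_mfderiv he he', hrel.dcoord_mfderiv he he', hΓ.self_of_nhds]

/-- In related coordinates the curve, the field and the Christoffel symbols have the same
expressions before and after applying `f`. -/
theorem HasCovDerivWithinAt.map {f : M → M} {γ : ℝ → M}
    {X : (s : ℝ) → TangentSpace 𝓘(ℝ, E) (γ s)} {S : Set ℝ} {s₀ : ℝ}
    {D : TangentSpace 𝓘(ℝ, E) (γ s₀)} (h : HasCovDerivWithinAt cov γ X S s₀ D)
    (hf : AffineAt cov f (γ s₀)) :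
    HasCovDerivWithinAt cov (fun s ↦ f (γ s))
      (fun s ↦ mfderiv 𝓘(ℝ, E) 𝓘(ℝ, E) f (γ s) (X s)) S s₀
      (mfderiv 𝓘(ℝ, E) 𝓘(ℝ, E) f (γ s₀) D) := by
  obtain ⟨e, e', he, he', hrel, hΓ⟩ := hf
  rw [hasCovDerivWithinAt_iff he hrel.mem_source] at h
  rw [hasCovDerivWithinAt_iff he' hrel.map_mem_source]
  obtain ⟨hc, c', j', h1, h2, h3⟩ := h
  have hev := hc.eventually hrel.eventually
  refine ⟨hrel.continuousAt.comp_continuousWithinAt hc, c', j',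
    h1.congr_of_eventuallyEq ?_ ?_, h2.congr_of_eventuallyEq ?_ ?_, ?_⟩
  · filter_upwards [hev] with s hs using hs.apply_eq
  · exact hrel.apply_eq
  · filter_upwards [hev] with s hs using hs.dcoord_mfderiv he he' _
  · exact hrel.dcoord_mfderiv he he' _
  · rw [hrel.dcoord_mfderiv he he', h3, hrel.apply_eq, hΓ.self_of_nhds,
      hrel.dcoord_mfderiv he he']

theorem AffineAt.mfderiv_torsion {f : M → M} {x : M} (hf : AffineAt cov f x)
    (v w : TangentSpace 𝓘(ℝ, E) x) :
    mfderiv 𝓘(ℝ, E) 𝓘(ℝ, E) f x (cov.torsion x v w) =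
      cov.torsion (f x) (mfderiv 𝓘(ℝ, E) 𝓘(ℝ, E) f x v) (mfderiv 𝓘(ℝ, E) 𝓘(ℝ, E) f x w) := by
  obtain ⟨e, e', he, he', hrel, hΓ⟩ := hf
  refine he'.dcoord_injective hrel.map_mem_source ?_
  rw [hrel.dcoord_mfderiv he he', dcoord_torsion cov he hrel.mem_source,
    dcoord_torsion cov he' hrel.map_mem_source, hrel.dcoord_mfderiv he he',
    hrel.dcoord_mfderiv he he', hrel.apply_eq, hΓ.self_of_nhds]

/-- Curvature involves first derivatives of the Christoffel symbols, so their equality on a whole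
neighbourhood is needed here. -/
theorem AffineAt.mfderiv_curvature [T2Space M]
    (hcov : CovariantDerivative.ContMDiffCovariantDerivative cov ∞) {f : M → M} {x : M}
    (hf : AffineAt cov f x) (u v w : TangentSpace 𝓘(ℝ, E) x) :
    mfderiv 𝓘(ℝ, E) 𝓘(ℝ, E) f x (curvature cov x u v w) =
      curvature cov (f x) (mfderiv 𝓘(ℝ, E) 𝓘(ℝ, E) f x u) (mfderiv 𝓘(ℝ, E) 𝓘(ℝ, E) f x v)
        (mfderiv 𝓘(ℝ, E) 𝓘(ℝ, E) f x w) := by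
  obtain ⟨e, e', he, he', hrel, hΓ⟩ := hf
  refine he'.dcoord_injective hrel.map_mem_source ?_
  rw [hrel.dcoord_mfderiv he he', dcoord_curvature cov hcov he hrel.mem_source,
    dcoord_curvature cov hcov he' hrel.map_mem_source, hrel.dcoord_mfderiv he he',
    hrel.dcoord_mfderiv he he', hrel.dcoord_mfderiv he he', hrel.apply_eq, coordCurvature,
    coordCurvature, hΓ.self_of_nhds, (show chris cov he' =ᶠ[𝓝 (e x)] chris cov he from hΓ).fderiv_eq]

end Affine

/-! ### Velocities in coordinates -/

section Curves

variable {E : Type*} [NormedAddCommGroup E] [NormedSpace ℝ E]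
  {M : Type*} [TopologicalSpace M] [ChartedSpace E M]

/-- The coordinates of a point of the tangent bundle, depending only on this point. -/
theorem dcoord_congr {e : OpenPartialHomeomorph M E} {x y : M} {v : TangentSpace 𝓘(ℝ, E) x}
    {w : TangentSpace 𝓘(ℝ, E) y}
    (h : (⟨x, v⟩ : TangentBundle 𝓘(ℝ, E) M) = ⟨y, w⟩) : dcoord e x v = dcoord e y w :=
  congrArg (fun a : TangentBundle 𝓘(ℝ, E) M ↦ dcoord e a.1 a.2) h

theorem IsCoord.totalSpace_ext {e : OpenPartialHomeomorph M E} (he : IsCoord e) {x y : M}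
    {v : TangentSpace 𝓘(ℝ, E) x} {w : TangentSpace 𝓘(ℝ, E) y} (hx : x ∈ e.source) (hxy : x = y)
    (h : dcoord e x v = dcoord e y w) :
    (⟨x, v⟩ : TangentBundle 𝓘(ℝ, E) M) = ⟨y, w⟩ := by
  subst hxy
  rw [he.dcoord_injective hx h]

theorem hasDerivAt_coord {e : OpenPartialHomeomorph M E} (he : IsCoord e) {γ : ℝ → M} {s : ℝ}
    (hs : γ s ∈ e.source) (h : MDifferentiableAt 𝓘(ℝ, ℝ) 𝓘(ℝ, E) γ s) :
    HasDerivAt (fun r ↦ e (γ r)) (dcoord e (γ s) (velocity E γ s)) s := by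
  have h1 : HasMFDerivWithinAt 𝓘(ℝ, ℝ) 𝓘(ℝ, E) γ univ s
      ((1 : ℝ →L[ℝ] ℝ).smulRight (velocity E γ s)) := by
    refine hasMFDerivWithinAt_univ.2 (h.hasMFDerivAt.congr_mfderiv ?_)
    ext
    exact (one_smul ℝ _).symm
  simpa using ((hasMFDerivWithinAt_curve_iff he hs _).1 h1).2

theorem mdifferentiableAt_curve {e : OpenPartialHomeomorph M E} (he : IsCoord e) {γ : ℝ → M}
    {s : ℝ} (hs : γ s ∈ e.source) (hc : ContinuousAt γ s) {c' : E}
    (h : HasDerivAt (fun r ↦ e (γ r)) c' s) :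
    MDifferentiableAt 𝓘(ℝ, ℝ) 𝓘(ℝ, E) γ s := by
  have h1 := (hasMFDerivWithinAt_curve_iff he hs (dframe e (γ s) c') (S := univ)).2
    ⟨hc.continuousWithinAt, by rw [he.dcoord_dframe hs]; exact h.hasDerivWithinAt⟩
  exact (hasMFDerivWithinAt_univ.1 h1).mdifferentiableAt

theorem dcoord_velocity {e : OpenPartialHomeomorph M E} (he : IsCoord e) {γ : ℝ → M}
    {s : ℝ} (hs : γ s ∈ e.source) (hc : ContinuousAt γ s) {c' : E}
    (h : HasDerivAt (fun r ↦ e (γ r)) c' s) : dcoord e (γ s) (velocity E γ s) = c' :=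
  (hasDerivAt_coord he hs (mdifferentiableAt_curve he hs hc h)).unique h

theorem velocity_eq_of_hasMFDerivAt {γ : ℝ → M} {s : ℝ} {v : TangentSpace 𝓘(ℝ, E) (γ s)}
    (h : HasMFDerivAt 𝓘(ℝ, ℝ) 𝓘(ℝ, E) γ s ((1 : ℝ →L[ℝ] ℝ).smulRight v)) :
    velocity E γ s = v := by
  rw [velocity, h.mfderiv]
  exact one_smul ℝ v

theorem velocity_comp_mul [IsManifold 𝓘(ℝ, E) ∞ M] {γ : ℝ → M} {a s : ℝ}
    (h : MDifferentiableAt 𝓘(ℝ, ℝ) 𝓘(ℝ, E) γ (a * s)) :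
    velocity E (fun r ↦ γ (a * r)) s = a • velocity E γ (a * s) := by
  have he := isCoord_chartAt (E := E) (γ (a * s))
  have hs := mem_chart_source E (γ (a * s))
  refine he.dcoord_injective hs ?_
  have h1 : HasDerivAt (fun r ↦ a * r) a s := by simpa using (hasDerivAt_id s).const_mul a
  rw [dcoord_velocity (γ := fun r ↦ γ (a * r)) he hs
    (ContinuousAt.comp (g := γ) (f := fun r ↦ a * r) h.continuousAt h1.continuousAt)
    (HasDerivAt.scomp (g₁ := fun r ↦ chartAt E (γ (a * s)) (γ r)) (h := fun r ↦ a * r) s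
      (hasDerivAt_coord he hs h) h1), map_smul]

theorem velocity_comp {f : M → M} {γ : ℝ → M} {s : ℝ}
    (hf : MDifferentiableAt 𝓘(ℝ, E) 𝓘(ℝ, E) f (γ s))
    (h : MDifferentiableAt 𝓘(ℝ, ℝ) 𝓘(ℝ, E) γ s) :
    velocity E (fun r ↦ f (γ r)) s = mfderiv 𝓘(ℝ, E) 𝓘(ℝ, E) f (γ s) (velocity E γ s) := by
  have h1 := mfderiv_comp s hf h
  exact DFunLike.congr_fun h1 (1 : ℝ)

end Curves

/-! ### Uniqueness of geodesics and the exponential map -/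

section Geodesics

variable {E : Type*} [NormedAddCommGroup E] [NormedSpace ℝ E] [FiniteDimensional ℝ E]
  {M : Type*} [TopologicalSpace M] [ChartedSpace E M] [IsManifold 𝓘(ℝ, E) ∞ M]
  {cov : AffineConnection E M}

/-- Covariant differentiation along a curve only depends on the restriction to `S`. -/
theorem HasCovDerivWithinAt.congr_set {γ γ' : ℝ → M} {X : (s : ℝ) → TangentSpace 𝓘(ℝ, E) (γ s)}
    {X' : (s : ℝ) → TangentSpace 𝓘(ℝ, E) (γ' s)} {S : Set ℝ} {s₀ : ℝ}
    {D : TangentSpace 𝓘(ℝ, E) (γ s₀)} {D' : TangentSpace 𝓘(ℝ, E) (γ' s₀)}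
    (h : HasCovDerivWithinAt cov γ X S s₀ D)
    (hX : ∀ᶠ s in 𝓝[S] s₀, (⟨γ s, X s⟩ : TangentBundle 𝓘(ℝ, E) M) = ⟨γ' s, X' s⟩)
    (hX₀ : (⟨γ s₀, X s₀⟩ : TangentBundle 𝓘(ℝ, E) M) = ⟨γ' s₀, X' s₀⟩)
    (hD : (⟨γ s₀, D⟩ : TangentBundle 𝓘(ℝ, E) M) = ⟨γ' s₀, D'⟩) :
    HasCovDerivWithinAt cov γ' X' S s₀ D' := by
  have he := isCoord_chartAt (E := E) (γ s₀)
  have hs := mem_chart_source E (γ s₀)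
  have hγ₀ : γ s₀ = γ' s₀ := congrArg TotalSpace.proj hX₀
  have hγ : ∀ᶠ s in 𝓝[S] s₀, γ s = γ' s := hX.mono fun s hs ↦ congrArg TotalSpace.proj hs
  rw [hasCovDerivWithinAt_iff he hs] at h
  rw [hasCovDerivWithinAt_iff he (hγ₀ ▸ hs)]
  obtain ⟨hc, c', j', h1, h2, h3⟩ := h
  refine ⟨hc.congr_of_eventuallyEq (hγ.mono fun _ h ↦ h.symm) hγ₀.symm, c', j',
    h1.congr_of_eventuallyEq (hγ.mono fun _ h ↦ ?_) ?_,
    h2.congr_of_eventuallyEq (hX.mono fun _ h ↦ ?_) ?_, ?_⟩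
  · exact congrArg (chartAt E (γ s₀)) h.symm
  · exact congrArg (chartAt E (γ s₀)) hγ₀.symm
  · exact (dcoord_congr h).symm
  · exact (dcoord_congr hX₀).symm
  · rw [← dcoord_congr hD, h3, dcoord_congr hX₀,
      show chartAt E (γ s₀) (γ s₀) = chartAt E (γ s₀) (γ' s₀) from congrArg _ hγ₀]

theorem HasCovDerivWithinAt.mono {γ : ℝ → M} {X : (s : ℝ) → TangentSpace 𝓘(ℝ, E) (γ s)}
    {S T : Set ℝ} {s₀ : ℝ} {D : TangentSpace 𝓘(ℝ, E) (γ s₀)}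
    (h : HasCovDerivWithinAt cov γ X S s₀ D) (hT : T ⊆ S) :
    HasCovDerivWithinAt cov γ X T s₀ D := by
  have he := isCoord_chartAt (E := E) (γ s₀)
  have hs := mem_chart_source E (γ s₀)
  rw [hasCovDerivWithinAt_iff he hs] at h ⊢
  obtain ⟨hc, c', j', h1, h2, h3⟩ := h
  exact ⟨hc.mono hT, c', j', h1.mono hT, h2.mono hT, h3⟩

variable (cov) in
/-- The geodesic equation for a curve at a time. -/
def IsGeodesicAt (γ : ℝ → M) (s : ℝ) : Prop :=
  HasCovDerivWithinAt cov γ (velocity E γ) univ s 0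

theorem IsGeodesicAt.mdifferentiableAt {γ : ℝ → M} {s : ℝ} (h : IsGeodesicAt cov γ s) :
    MDifferentiableAt 𝓘(ℝ, ℝ) 𝓘(ℝ, E) γ s := by
  obtain ⟨_, _, h, -⟩ := h
  exact (hasMFDerivWithinAt_univ.1 h).mdifferentiableAt

theorem isGeodesicAt_iff {e : OpenPartialHomeomorph M E} (he : IsCoord e) {γ : ℝ → M} {s : ℝ}
    (hs : γ s ∈ e.source) : IsGeodesicAt cov γ s ↔ MDifferentiableAt 𝓘(ℝ, ℝ) 𝓘(ℝ, E) γ s ∧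
      HasDerivAt (fun r ↦ dcoord e (γ r) (velocity E γ r))
        (-chris cov he (e (γ s)) (dcoord e (γ s) (velocity E γ s))
          (dcoord e (γ s) (velocity E γ s))) s := by
  constructor
  · intro h
    have hd := h.mdifferentiableAt
    rw [IsGeodesicAt, hasCovDerivWithinAt_iff he hs] at h
    obtain ⟨hc, c', j', h1, h2, h3⟩ := h
    rw [hasDerivWithinAt_univ] at h1 h2
    refine ⟨hd, h2.congr_deriv ?_⟩
    rw [map_zero, ← dcoord_velocity he hs hd.continuousAt h1] at h3
    exact eq_neg_of_add_eq_zero_left h3.symm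
  · rintro ⟨h1, h2⟩
    rw [IsGeodesicAt, hasCovDerivWithinAt_iff he hs]
    refine ⟨h1.continuousAt.continuousWithinAt, _, _, (hasDerivAt_coord he hs h1).hasDerivWithinAt,
      h2.hasDerivWithinAt, ?_⟩
    simp

theorem IsGeodesicAt.comp_mul {γ : ℝ → M} {a s : ℝ} (h : ∀ᶠ r in 𝓝 (a * s), IsGeodesicAt cov γ r) :
    IsGeodesicAt cov (fun r ↦ γ (a * r)) s := by
  have he := isCoord_chartAt (E := E) (γ (a * s))
  have hs := mem_chart_source E (γ (a * s))
  have h0 := h.self_of_nhds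
  have h1 : HasDerivAt (fun r ↦ a * r) a s := by simpa using (hasDerivAt_id s).const_mul a
  have hd : MDifferentiableAt 𝓘(ℝ, ℝ) 𝓘(ℝ, E) (fun r ↦ γ (a * r)) s :=
    mdifferentiableAt_curve he hs (ContinuousAt.comp (g := γ) (f := fun r ↦ a * r)
      h0.mdifferentiableAt.continuousAt h1.continuousAt)
      (HasDerivAt.scomp (g₁ := fun r ↦ chartAt E (γ (a * s)) (γ r)) (h := fun r ↦ a * r) s
        (hasDerivAt_coord he hs h0.mdifferentiableAt) h1)
  have h2 := ((isGeodesicAt_iff he hs).1 h0).2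
  refine (isGeodesicAt_iff (γ := fun r ↦ γ (a * r)) he hs).2 ⟨hd, ?_⟩
  have h3 := (HasDerivAt.scomp s h2 h1).const_smul a
  have h4 := velocity_comp_mul h0.mdifferentiableAt
  refine HasDerivAt.congr_of_eventuallyEq (h3.congr_deriv ?_) ?_
  · rw [h4]
    simp
  · filter_upwards [h1.continuousAt.eventually h] with r hr
    rw [velocity_comp_mul hr.mdifferentiableAt, map_smul]
    rfl

theorem IsGeodesicAt.map {f : M → M} {γ : ℝ → M} {s : ℝ} (h : ∀ᶠ r in 𝓝 s, IsGeodesicAt cov γ r)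
    (hf : AffineAt cov f (γ s)) : IsGeodesicAt cov (fun r ↦ f (γ r)) s := by
  have h1 := HasCovDerivWithinAt.map h.self_of_nhds hf
  obtain ⟨e, e', he, he', hrel, -⟩ := hf
  have h2 : ∀ᶠ r in 𝓝 s, velocity E (fun r ↦ f (γ r)) r =
      mfderiv 𝓘(ℝ, E) 𝓘(ℝ, E) f (γ r) (velocity E γ r) := by
    filter_upwards [h, h.self_of_nhds.mdifferentiableAt.continuousAt.eventually hrel.eventually]
      with r hr hr'
    exact velocity_comp (hr'.mdifferentiableAt he he') hr.mdifferentiableAt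
  refine h1.congr_set ?_ ?_ ?_
  · rw [nhdsWithin_univ]
    filter_upwards [h2] with r hr
    rw [hr]
  · rw [h2.self_of_nhds]
  · rw [map_zero]

/-- Position and velocity solve the first-order system `x' = y`, `y' = -Γ_x(y, y)`, whose right-hand
side is smooth and hence locally Lipschitz. -/
theorem geodesic_eventuallyEq [T2Space M]
    (hcov : CovariantDerivative.ContMDiffCovariantDerivative cov ∞) {γ₁ γ₂ : ℝ → M} {s : ℝ}
    (h₁ : ∀ᶠ r in 𝓝 s, IsGeodesicAt cov γ₁ r) (h₂ : ∀ᶠ r in 𝓝 s, IsGeodesicAt cov γ₂ r)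
    (h : (⟨γ₁ s, velocity E γ₁ s⟩ : TangentBundle 𝓘(ℝ, E) M) = ⟨γ₂ s, velocity E γ₂ s⟩) :
    γ₁ =ᶠ[𝓝 s] γ₂ := by
  set e := chartAt E (γ₁ s)
  have he : IsCoord e := isCoord_chartAt (γ₁ s)
  have hs : γ₁ s ∈ e.source := mem_chart_source E (γ₁ s)
  have hp : γ₁ s = γ₂ s := congrArg TotalSpace.proj h
  set F : E × E → E × E := fun y ↦ (y.2, -chris cov he y.1 y.2 y.2)
  set c : (ℝ → M) → ℝ → E × E := fun γ r ↦ (e (γ r), dcoord e (γ r) (velocity E γ r))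
  have hF : ContDiffAt ℝ ∞ F (c γ₁ s) := by
    have h1 : ContDiffAt ℝ ∞ (chris cov he) (e (γ₁ s)) :=
      (contDiffOn_chris cov hcov he).contDiffAt (e.open_target.mem_nhds (e.map_source hs))
    have h2 : ContDiffAt ℝ ∞ (fun y : E × E ↦ chris cov he y.1) (c γ₁ s) :=
      ContDiffAt.comp (g := chris cov he) (f := Prod.fst) (c γ₁ s) h1 contDiffAt_fst
    exact contDiffAt_snd.prodMk ((h2.clm_apply contDiffAt_snd).clm_apply contDiffAt_snd).neg
  obtain ⟨K, N, hN, hK⟩ := (hF.of_le (by norm_cast)).exists_lipschitzOnWith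
  have key : ∀ γ : ℝ → M, (∀ᶠ r in 𝓝 s, IsGeodesicAt cov γ r) → γ s ∈ e.source →
      c γ s = c γ₁ s →
      ∀ᶠ r in 𝓝 s, γ r ∈ e.source ∧ HasDerivAt (c γ) (F (c γ r)) r ∧ c γ r ∈ N := by
    intro γ hγ hγs hγ₁
    have h1 : ∀ᶠ r in 𝓝 s, γ r ∈ e.source ∧ HasDerivAt (c γ) (F (c γ r)) r := by
      filter_upwards [hγ, hγ.self_of_nhds.mdifferentiableAt.continuousAt.eventually
        (e.open_source.mem_nhds hγs)] with r hr hr'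
      exact ⟨hr', (hasDerivAt_coord he hr' hr.mdifferentiableAt).prodMk
        ((isGeodesicAt_iff he hr').1 hr).2⟩
    have h2 := h1.self_of_nhds.2.continuousAt.eventually (by rw [hγ₁]; exact hN)
    filter_upwards [h1, h2] with r hr hr' using ⟨hr.1, hr.2, hr'⟩
  have h1 := key γ₁ h₁ hs rfl
  have h2 := key γ₂ h₂ (hp ▸ hs) (by simp only [c, dcoord_congr h, hp])
  have h3 := ODE_solution_unique_of_eventually (v := fun _ ↦ F) (s := fun _ ↦ N) (t₀ := s)
    (Eventually.of_forall fun _ ↦ hK) (h1.mono fun r hr ↦ hr.2) (h2.mono fun r hr ↦ hr.2)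
    (by simp only [c, dcoord_congr h, hp])
  filter_upwards [h1, h2, h3] with r hr1 hr2 hr3
  exact e.injOn hr1.1 hr2.1 (congrArg Prod.fst hr3)

theorem velocity_eventuallyEq {γ₁ γ₂ : ℝ → M} {s : ℝ} (h : γ₁ =ᶠ[𝓝 s] γ₂) :
    (⟨γ₁ s, velocity E γ₁ s⟩ : TangentBundle 𝓘(ℝ, E) M) = ⟨γ₂ s, velocity E γ₂ s⟩ := by
  have h1 : mfderiv 𝓘(ℝ, ℝ) 𝓘(ℝ, E) γ₁ s = mfderiv 𝓘(ℝ, ℝ) 𝓘(ℝ, E) γ₂ s := h.mfderiv_eq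
  have h2 : (velocity E γ₁ s : E) = velocity E γ₂ s := DFunLike.congr_fun h1 (1 : ℝ)
  have h3 := h.self_of_nhds
  exact TotalSpace.ext h3 (heq_of_eq h2)

/-- The times at which the germs coincide form an open set. It is also closed in `I`, because
positions and velocities agree in the limit and local uniqueness then applies. -/
theorem geodesic_eqOn [T2Space M]
    (hcov : CovariantDerivative.ContMDiffCovariantDerivative cov ∞) {γ₁ γ₂ : ℝ → M} {I : Set ℝ}
    (hI : IsOpen I) (hI' : IsPreconnected I) (h₁ : ∀ s ∈ I, IsGeodesicAt cov γ₁ s)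
    (h₂ : ∀ s ∈ I, IsGeodesicAt cov γ₂ s) {s₀ : ℝ} (hs₀ : s₀ ∈ I)
    (h : (⟨γ₁ s₀, velocity E γ₁ s₀⟩ : TangentBundle 𝓘(ℝ, E) M) = ⟨γ₂ s₀, velocity E γ₂ s₀⟩) :
    EqOn γ₁ γ₂ I := by
  have hev₁ : ∀ s ∈ I, ∀ᶠ r in 𝓝 s, IsGeodesicAt cov γ₁ r :=
    fun s hs ↦ eventually_of_mem (hI.mem_nhds hs) h₁
  have hev₂ : ∀ s ∈ I, ∀ᶠ r in 𝓝 s, IsGeodesicAt cov γ₂ r :=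
    fun s hs ↦ eventually_of_mem (hI.mem_nhds hs) h₂
  suffices I ⊆ {s | γ₁ =ᶠ[𝓝 s] γ₂} from fun s hs ↦ (this hs : γ₁ =ᶠ[𝓝 s] γ₂).eq_of_nhds
  refine hI'.subset_of_closure_inter_subset ?_ ⟨s₀, hs₀,
    geodesic_eventuallyEq hcov (hev₁ s₀ hs₀) (hev₂ s₀ hs₀) h⟩ ?_
  · exact isOpen_iff_mem_nhds.2 fun s hs ↦ hs.eventually_nhds
  · rintro s ⟨hs, hsI⟩
    refine geodesic_eventuallyEq hcov (hev₁ s hsI) (hev₂ s hsI) ?_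
    rw [mem_closure_iff_frequently] at hs
    set c₁ := (h₁ s hsI).mdifferentiableAt.continuousAt
    set c₂ := (h₂ s hsI).mdifferentiableAt.continuousAt
    have hp : γ₁ s = γ₂ s := by
      by_contra hne
      obtain ⟨A, B, hA, hB, hsA, hsB, hAB⟩ := t2_separation hne
      obtain ⟨r, hr, hrA, hrB⟩ := (hs.and_eventually ((c₁.eventually (hA.mem_nhds hsA)).and
        (c₂.eventually (hB.mem_nhds hsB)))).exists
      exact disjoint_left.1 hAB hrA (by rw [(hr : γ₁ =ᶠ[𝓝 r] γ₂).eq_of_nhds]; exact hrB)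
    set e := chartAt E (γ₁ s)
    have he : IsCoord e := isCoord_chartAt (γ₁ s)
    have hes : γ₁ s ∈ e.source := mem_chart_source E (γ₁ s)
    refine he.totalSpace_ext hes hp ?_
    have hv₁ := ((isGeodesicAt_iff he hes).1 (h₁ s hsI)).2.continuousAt
    have hv₂ := ((isGeodesicAt_iff he (hp ▸ hes)).1 (h₂ s hsI)).2.continuousAt
    exact tendsto_nhds_unique_of_frequently_eq hv₁ hv₂
      (hs.mono fun r hr ↦ dcoord_congr (velocity_eventuallyEq hr))

/-- By uniqueness, the geodesic chosen in the definition of `expMap` is the reparametrization `r ↦ γ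
(s * r)`. -/
theorem IsGeodesic.expMap_eq [T2Space M]
    (hcov : CovariantDerivative.ContMDiffCovariantDerivative cov ∞) {γ : ℝ → M}
    (h : IsGeodesic cov γ) {p : M} {v : TangentSpace 𝓘(ℝ, E) p}
    (h0 : (⟨γ 0, velocity E γ 0⟩ : TangentBundle 𝓘(ℝ, E) M) = ⟨p, v⟩) (s : ℝ) :
    expMap cov p (s • v) = γ s := by
  have h1 : IsGeodesic cov (fun r ↦ γ (s * r)) :=
    fun r ↦ IsGeodesicAt.comp_mul (Eventually.of_forall h)
  have h2 : (⟨γ (s * 0), velocity E (fun r ↦ γ (s * r)) 0⟩ : TangentBundle 𝓘(ℝ, E) M) =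
      ⟨p, s • v⟩ := by
    rw [velocity_comp_mul (IsGeodesicAt.mdifferentiableAt (h _)), mul_zero]
    exact congrArg (fun a : TangentBundle 𝓘(ℝ, E) M ↦
      (⟨a.1, s • a.2⟩ : TangentBundle 𝓘(ℝ, E) M)) h0
  have h3 : ∃ γ : ℝ → M, IsGeodesic cov γ ∧
      (⟨γ 0, velocity E γ 0⟩ : TangentBundle 𝓘(ℝ, E) M) = ⟨p, s • v⟩ := ⟨_, h1, h2⟩
  rw [expMap, dif_pos h3]
  have h4 := geodesic_eqOn hcov isOpen_univ isPreconnected_univ (fun s _ ↦ h3.choose_spec.1 s)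
    (fun s _ ↦ h1 s) (mem_univ 0) (h3.choose_spec.2.trans h2.symm)
  rw [h4 (mem_univ 1)]
  exact congrArg γ (mul_one s)

theorem isGeodesic_expMap [T2Space M]
    (hcov : CovariantDerivative.ContMDiffCovariantDerivative cov ∞)
    (hcomplete : GeodesicallyComplete cov) (p : M) (v : TangentSpace 𝓘(ℝ, E) p) :
    IsGeodesic cov (fun s ↦ expMap cov p (s • v)) ∧
      (⟨expMap cov p ((0 : ℝ) • v), velocity E (fun s ↦ expMap cov p (s • v)) 0⟩ :
        TangentBundle 𝓘(ℝ, E) M) = ⟨p, v⟩ := by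
  obtain ⟨γ, h, h0⟩ := hcomplete ⟨p, v⟩
  obtain rfl : (fun s : ℝ ↦ expMap cov p (s • v)) = γ := funext (h.expMap_eq hcov h0)
  exact ⟨h, h0⟩

end Geodesics

/-- Induction along the unit interval. -/
theorem unitInterval_induction {Q : ℝ → Prop}
    (h₁ : ∀ x ∈ Icc (0 : ℝ) 1, (∀ y ∈ Ico 0 x, Q y) → Q x)
    (h₂ : ∀ x ∈ Ico (0 : ℝ) 1, (∀ y ∈ Icc 0 x, Q y) → ∀ᶠ y in 𝓝[>] x, Q y) :
    ∀ x ∈ Icc (0 : ℝ) 1, Q x := by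
  by_contra! hne
  set B := {x | x ∈ Icc (0 : ℝ) 1 ∧ ¬ Q x}
  obtain ⟨x, hx, hQx⟩ := hne
  have hB : BddBelow B := ⟨0, fun y hy ↦ hy.1.1⟩
  have hB' : B.Nonempty := ⟨x, hx, hQx⟩
  -- The first obstruction: `h₁` gives `Q` at `b` itself, and `h₂` then pushes `Q` beyond `b`,
  -- contradicting the choice of `b`.
  set b := sInf B
  have hb0 : 0 ≤ b := le_csInf hB' fun y hy ↦ hy.1.1
  have hbx : b ≤ x := csInf_le hB ⟨hx, hQx⟩
  have hlt : ∀ y ∈ Ico 0 b, Q y := by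
    intro y hy
    by_contra hQ
    exact absurd (csInf_le hB ⟨⟨hy.1, hy.2.le.trans (hbx.trans hx.2)⟩, hQ⟩) (not_le.2 hy.2)
  have hQb := h₁ b ⟨hb0, hbx.trans hx.2⟩ hlt
  have hle : ∀ y ∈ Icc 0 b, Q y := by
    intro y hy
    rcases hy.2.eq_or_lt with rfl | h
    · exact hQb
    · exact hlt y ⟨hy.1, h⟩
  have hbx' : b < x := lt_of_le_of_ne hbx fun h ↦ hQx (h ▸ hQb)
  obtain ⟨c, hc, hc'⟩ := mem_nhdsGT_iff_exists_Ioo_subset.1 (h₂ b ⟨hb0, hbx'.trans_le hx.2⟩ hle)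
  have : c ≤ b := le_csInf hB' fun y hy ↦ by
    by_contra! hyc
    rcases (csInf_le hB hy : b ≤ y).eq_or_lt with h | h
    · exact hy.2 (h ▸ hQb)
    · exact hy.2 (hc' ⟨h, hyc⟩)
  exact absurd hc (not_lt.2 this)

/-! ### Uniqueness of flow lines -/

section Flow

variable {E : Type*} [NormedAddCommGroup E] [NormedSpace ℝ E]
  {M : Type*} [TopologicalSpace M] [ChartedSpace E M] [IsManifold 𝓘(ℝ, E) ∞ M]
  {V : Type*} [NormedAddCommGroup V] [NormedSpace ℝ V]

theorem contMDiffAt_dcoord {F : Type*} [NormedAddCommGroup F] [NormedSpace ℝ F]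
    {H : Type*} [TopologicalSpace H] {J : ModelWithCorners ℝ F H}
    {N : Type*} [TopologicalSpace N] [ChartedSpace H N] {f : N → TangentBundle 𝓘(ℝ, E) M} {n : N}
    (hf : ContMDiffAt J 𝓘(ℝ, E).tangent ∞ f n) :
    ContMDiffAt J 𝓘(ℝ, E) ∞ (fun x ↦ dcoord (chartAt E (f n).1) (f x).1 (f x).2) n := by
  have h := contMDiffAt_totalSpace.1 hf
  refine h.2.congr_of_eventuallyEq ?_
  filter_upwards [h.1.continuousAt.eventually
    ((chartAt E (f n).1).open_source.mem_nhds (mem_chart_source E (f n).1))] with x hx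
  change (f x).1 ∈ (chartAt E (f n).1).source at hx
  rw [← dcoord_chartAt hx, Bundle.Trivialization.continuousLinearMapAt_apply,
    Bundle.Trivialization.coe_linearMapAt_of_mem _ (by simpa using hx)]

theorem Dynamics.contDiffAt_rep (W : Dynamics V E M) (u : V) (x : M) :
    ContDiffAt ℝ ∞ (fun y : V × E ↦ rep (chartAt E x) (W.field y.1) y.2) (u, chartAt E x x) := by
  rw [← contMDiffAt_iff_contDiffAt]
  have h1 : ContMDiffAt 𝓘(ℝ, V × E) (𝓘(ℝ, V).prod 𝓘(ℝ, E)) ∞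
      (fun y : V × E ↦ (y.1, (chartAt E x).symm y.2)) (u, chartAt E x x) := by
    refine ContMDiffAt.prodMk contDiffAt_fst.contMDiffAt ?_
    exact ContMDiffAt.comp (g := (chartAt E x).symm) (f := Prod.snd) (u, chartAt E x x)
      ((isCoord_chartAt x).contMDiffAt_symm (mem_chart_target E x)) contDiffAt_snd.contMDiffAt
  have h2 := contMDiffAt_dcoord (W.smooth.contMDiffAt (x := (u, (chartAt E x).symm (chartAt E x x))))
  have h3 := ContMDiffAt.comp (u, chartAt E x x) h2 h1
  rw [(chartAt E x).left_inv (mem_chart_source E x)] at h3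
  exact h3

/-- The input is merely continuous in time. A Lipschitz bound in the joint variable `(u, x)`
restricts to the slices at `u τ`, with one constant for all times near `t`. -/
theorem flow_eventuallyEq (W : Dynamics V E M) {u : ℝ → V} {t : ℝ} (hu : ContinuousAt u t)
    {x₁ x₂ : ℝ → M}
    (h₁ : ∀ᶠ τ in 𝓝 t, HasMFDerivAt 𝓘(ℝ, ℝ) 𝓘(ℝ, E) x₁ τ
      ((1 : ℝ →L[ℝ] ℝ).smulRight (W.field (u τ) (x₁ τ))))
    (h₂ : ∀ᶠ τ in 𝓝 t, HasMFDerivAt 𝓘(ℝ, ℝ) 𝓘(ℝ, E) x₂ τ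
      ((1 : ℝ →L[ℝ] ℝ).smulRight (W.field (u τ) (x₂ τ))))
    (h : x₁ t = x₂ t) : x₁ =ᶠ[𝓝 t] x₂ := by
  set e := chartAt E (x₁ t)
  have he : IsCoord e := isCoord_chartAt (x₁ t)
  have hs : x₁ t ∈ e.source := mem_chart_source E (x₁ t)
  set G : V × E → E := fun y ↦ rep e (W.field y.1) y.2
  obtain ⟨K, N, hN, hK⟩ :=
    ((W.contDiffAt_rep (u t) (x₁ t)).of_le (m := 1) (by norm_cast)).exists_lipschitzOnWith
  have key : ∀ x : ℝ → M, (∀ᶠ τ in 𝓝 t, HasMFDerivAt 𝓘(ℝ, ℝ) 𝓘(ℝ, E) x τ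
      ((1 : ℝ →L[ℝ] ℝ).smulRight (W.field (u τ) (x τ)))) → x t = x₁ t →
      ∀ᶠ τ in 𝓝 t, x τ ∈ e.source ∧ HasDerivAt (fun τ ↦ e (x τ)) (G (u τ, e (x τ))) τ ∧
        e (x τ) ∈ {z | (u τ, z) ∈ N} := by
    intro x hx hxt
    have hc : ContinuousAt x t := hx.self_of_nhds.continuousAt
    have h1 : Tendsto (fun τ ↦ (u τ, e (x τ))) (𝓝 t) (𝓝 (u t, e (x₁ t))) := by
      have : ContinuousAt e (x t) := e.continuousAt (by rwa [hxt])
      have h2 := hu.prodMk (ContinuousAt.comp (f := x) (g := e) this hc)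
      rw [ContinuousAt] at h2
      simpa only [Function.comp_apply, hxt] using h2
    filter_upwards [hx, hc.eventually (e.open_source.mem_nhds (by rwa [hxt])), h1.eventually hN]
      with τ h2 h3 h4
    refine ⟨h3, ?_, h4⟩
    have h5 := ((hasMFDerivWithinAt_curve_iff he h3 (S := univ) _).1
      (hasMFDerivWithinAt_univ.2 h2)).2
    rw [hasDerivWithinAt_univ, ← rep_apply (Y := W.field (u τ)) h3] at h5
    exact h5
  have h3 := key x₁ h₁ rfl
  have h4 := key x₂ h₂ h.symm
  have h5 := ODE_solution_unique_of_eventually (v := fun τ z ↦ G (u τ, z))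
    (s := fun τ ↦ {z | (u τ, z) ∈ N}) (t₀ := t) (K := K) (Eventually.of_forall fun τ ↦ ?_)
    (h3.mono fun r hr ↦ hr.2) (h4.mono fun r hr ↦ hr.2) (congrArg e h)
  · filter_upwards [h3, h4, h5] with τ h1 h2 h3 using e.injOn h1.1 h2.1 h3
  · refine LipschitzOnWith.of_dist_le_mul fun z hz w hw ↦ ?_
    refine (hK.dist_le_mul _ hz _ hw).trans_eq ?_
    simp [Prod.dist_eq]

theorem flow_eqOn [T2Space M] (W : Dynamics V E M) {u : ℝ → V} {I : Set ℝ} (hI : IsOpen I)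
    (hI' : IsPreconnected I) (hu : ContinuousOn u I) {x₁ x₂ : ℝ → M}
    (h₁ : ∀ τ ∈ I, HasMFDerivAt 𝓘(ℝ, ℝ) 𝓘(ℝ, E) x₁ τ
      ((1 : ℝ →L[ℝ] ℝ).smulRight (W.field (u τ) (x₁ τ))))
    (h₂ : ∀ τ ∈ I, HasMFDerivAt 𝓘(ℝ, ℝ) 𝓘(ℝ, E) x₂ τ
      ((1 : ℝ →L[ℝ] ℝ).smulRight (W.field (u τ) (x₂ τ))))
    {t : ℝ} (ht : t ∈ I) (h : x₁ t = x₂ t) : EqOn x₁ x₂ I := by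
  have key : ∀ s ∈ I, x₁ s = x₂ s → x₁ =ᶠ[𝓝 s] x₂ := fun s hs ↦
    flow_eventuallyEq W (hu.continuousAt (hI.mem_nhds hs)) (eventually_of_mem (hI.mem_nhds hs) h₁)
      (eventually_of_mem (hI.mem_nhds hs) h₂)
  suffices I ⊆ {s | x₁ =ᶠ[𝓝 s] x₂} from fun s hs ↦ (this hs : x₁ =ᶠ[𝓝 s] x₂).eq_of_nhds
  refine hI'.subset_of_closure_inter_subset ?_ ⟨t, ht, key t ht h⟩ ?_
  · exact isOpen_iff_mem_nhds.2 fun s hs ↦ hs.eventually_nhds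
  · rintro s ⟨hs, hsI⟩
    rw [mem_closure_iff_frequently] at hs
    exact key s hsI (tendsto_nhds_unique_of_frequently_eq (h₁ s hsI).continuousAt
      (h₂ s hsI).continuousAt (hs.mono fun r hr ↦ (hr : x₁ =ᶠ[𝓝 r] x₂).eq_of_nhds))

end Flow

/-! ### Domains of the flow and error vectors -/

namespace VectorErrorRep

variable {E : Type*} [NormedAddCommGroup E] [NormedSpace ℝ E] [FiniteDimensional ℝ E]
  {M : Type*} [TopologicalSpace M] [ChartedSpace E M] [IsManifold 𝓘(ℝ, E) ∞ M]
  {V : Type*} [NormedAddCommGroup V] [NormedSpace ℝ V]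
  {cov : AffineConnection E M} {W : Dynamics V E M} (R : VectorErrorRep cov W)

theorem zero_mem : (0 : ℝ) ∈ Ioo (-R.ε) R.ε := ⟨by linarith [R.ε_pos], R.ε_pos⟩

/-- Flow lines that meet at time `t` coincide on the whole interval, in particular at time `0`. -/
theorem injOn_Φ [T2Space M] {t : ℝ} (ht : t ∈ Ioo (-R.ε) R.ε) : InjOn (R.Φ t) R.U := by
  intro p hp q hq hpq
  have h := flow_eqOn W isOpen_Ioo isPreconnected_Ioo R.continuousOn_u (R.flow p hp) (R.flow q hq)
    ht hpq R.zero_mem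
  simpa only [R.Φ_zero p hp, R.Φ_zero q hq] using h

theorem domain_subset (t : ℝ) : R.domain t ⊆ R.U := fun _ h ↦ h.1

theorem mapsTo_domain (t : ℝ) : MapsTo (R.Φ t) (R.domain t) R.U := fun _ h ↦ h.2 t right_mem_uIcc

theorem domain_mono {t τ : ℝ} (h : τ ∈ uIcc 0 t) : R.domain t ⊆ R.domain τ :=
  fun _ hp ↦ ⟨hp.1, fun r hr ↦ hp.2 r (uIcc_subset_uIcc left_mem_uIcc h hr)⟩

theorem uIcc_subset {t : ℝ} (ht : t ∈ Ioo (-R.ε) R.ε) : uIcc 0 t ⊆ Ioo (-R.ε) R.ε :=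
  ordConnected_Ioo.uIcc_subset R.zero_mem ht

/-- Tube lemma: the compact set `[0, t] × {p}` lies in the open set where the flow takes values in
`U`. -/
theorem isOpen_total : IsOpen {z : ℝ × M | z.1 ∈ Ioo (-R.ε) R.ε ∧ z.2 ∈ R.domain z.1} := by
  rw [isOpen_iff_mem_nhds]
  rintro ⟨t, p⟩ ⟨ht, hp⟩
  have hO : IsOpen ((Ioo (-R.ε) R.ε ×ˢ R.U) ∩ (fun z : ℝ × M ↦ R.Φ z.1 z.2) ⁻¹' R.U) :=
    R.continuousOn_Φ.isOpen_inter_preimage (isOpen_Ioo.prod R.isOpen) R.isOpen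
  obtain ⟨u, v, hu, hv, h0u, hpv, huv⟩ := generalized_tube_lemma (isCompact_uIcc (a := 0) (b := t))
    (isCompact_singleton (x := p)) hO (by
      rintro ⟨τ, q⟩ ⟨hτ, rfl⟩
      exact ⟨⟨R.uIcc_subset ht hτ, hp.1⟩, hp.2 τ hτ⟩)
  obtain ⟨δ, hδ, hball⟩ := Metric.isOpen_iff.1 hu t (h0u right_mem_uIcc)
  filter_upwards [prod_mem_nhds (Metric.ball_mem_nhds t hδ) (hv.mem_nhds (hpv rfl))]
    with ⟨τ, q⟩ ⟨hτ, hq⟩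
  have h1 : uIcc 0 τ ⊆ u := by
    refine uIcc_subset_uIcc_union_uIcc.trans (union_subset h0u ?_)
    refine Subset.trans ?_ hball
    exact (convex_ball t δ).ordConnected.uIcc_subset (Metric.mem_ball_self hδ) hτ
  exact ⟨(huv (mk_mem_prod (h1 right_mem_uIcc) hq)).1.1, (huv (mk_mem_prod (h1 right_mem_uIcc) hq)).1.2,
    fun r hr ↦ (huv (mk_mem_prod (h1 hr) hq)).2⟩

theorem isOpen_domain {t : ℝ} (ht : t ∈ Ioo (-R.ε) R.ε) : IsOpen (R.domain t) := by
  have := R.isOpen_total.preimage (f := fun p ↦ (t, p)) (by fun_prop)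
  convert this using 1
  ext p
  exact ⟨fun h ↦ ⟨ht, h⟩, fun h ↦ h.2⟩

theorem isOpen_times (p : M) : IsOpen (R.times p) :=
  R.isOpen_total.preimage (f := fun t ↦ (t, p)) (by fun_prop)

theorem er_expMap {p : M} (hp : p ∈ R.U) {v : TangentSpace 𝓘(ℝ, E) p}
    (h : ∀ s ∈ Icc (0 : ℝ) 1, expMap cov p (s • v) ∈ R.U) : R.er (expMap cov p v) p = v :=
  (R.isErrorFunction.unique p hp _ (by simpa using h 1 (by simp)) v h rfl).symm

theorem er_smul {p q : M} (hp : p ∈ R.U) (hq : q ∈ R.U) {s : ℝ} (hs : s ∈ Icc (0 : ℝ) 1) :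
    R.er (expMap cov p (s • R.er q p)) p = s • R.er q p := by
  refine R.er_expMap hp fun r hr ↦ ?_
  rw [smul_smul]
  exact R.isErrorFunction.mem p hp q hq _
    ⟨mul_nonneg hr.1 hs.1, mul_le_one₀ hr.2 hs.1 hs.2⟩

theorem patch_zero {p q : M} (hp : p ∈ R.U) (hq : q ∈ R.U) :
    R.patch p q 0 = fun s ↦ expMap cov q (s • R.er p q) := by
  funext s
  rw [patch, R.Φ_zero p hp, R.Φ_zero q hq]

theorem patch_mem {t : ℝ} {p q : M} (hp : p ∈ R.domain t) (hq : q ∈ R.domain t) {s : ℝ}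
    (hs : s ∈ Icc (0 : ℝ) 1) : R.patch p q t s ∈ R.U :=
  R.isErrorFunction.mem _ (R.mapsTo_domain t hq) _ (R.mapsTo_domain t hp) s hs

/-- A short geodesic issuing from `p` stays in `U`, so uniqueness of geodesics in `U` makes its
initial velocity the error vector. Every direction is thus realized by error vectors at small scale.
-/
theorem eventually_er_smul [T2Space M]
    (hcov : CovariantDerivative.ContMDiffCovariantDerivative cov ∞)
    (hcomplete : GeodesicallyComplete cov) {p : M} (hp : p ∈ R.U) (v : TangentSpace 𝓘(ℝ, E) p) :
    ∀ᶠ r : ℝ in 𝓝 0, R.er (expMap cov p (r • v)) p = r • v := by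
  obtain ⟨h, h0⟩ := isGeodesic_expMap hcov hcomplete p v
  have h1 : ContinuousAt (fun r : ℝ ↦ expMap cov p (r • v)) 0 :=
    (IsGeodesicAt.mdifferentiableAt (h 0)).continuousAt
  have h2 : expMap cov p ((0 : ℝ) • v) = p := congrArg TotalSpace.proj h0
  obtain ⟨δ, hδ, hball⟩ := Metric.eventually_nhds_iff_ball.1
    (h1.eventually (R.isOpen.mem_nhds (h2.symm ▸ hp : expMap cov p ((0 : ℝ) • v) ∈ R.U)))
  filter_upwards [Metric.ball_mem_nhds 0 hδ] with r hr
  refine R.er_expMap hp fun s hs ↦ ?_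
  rw [smul_smul]
  refine hball _ ?_
  rw [mem_ball_zero_iff, Real.norm_eq_abs] at hr ⊢
  rw [abs_mul, abs_of_nonneg hs.1]
  exact (mul_le_of_le_one_left (abs_nonneg r) hs.2).trans_lt hr

theorem contMDiffAt_er {p q : M} (hp : p ∈ R.U) (hq : q ∈ R.U) :
    ContMDiffAt (𝓘(ℝ, E).prod 𝓘(ℝ, E)) 𝓘(ℝ, E) ∞
      (fun z : M × M ↦ dcoord (chartAt E p) z.2 (R.er z.1 z.2)) (q, p) :=
  contMDiffAt_dcoord (f := fun z : M × M ↦ (⟨z.2, R.er z.1 z.2⟩ : TangentBundle 𝓘(ℝ, E) M))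
    (n := (q, p)) (R.isErrorFunction.smooth.contMDiffAt
    (prod_mem_nhds (R.isOpen.mem_nhds hq) (R.isOpen.mem_nhds hp)))

end VectorErrorRep


/-! ### Naturality of transports and geodesics under affine maps -/

section Transport

variable {E : Type*} [NormedAddCommGroup E] [NormedSpace ℝ E] [FiniteDimensional ℝ E]
  {M : Type*} [TopologicalSpace M] [ChartedSpace E M] [IsManifold 𝓘(ℝ, E) ∞ M]
  {cov : AffineConnection E M}

/-- At the endpoints the curves agree on one side only, but one-sided derivatives already determine
the velocities of curves differentiable there. -/
theorem velocity_eq_of_eqOn {γ σ : ℝ → M} (h : EqOn γ σ (Icc 0 1)) {s : ℝ}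
    (hs : s ∈ Icc (0 : ℝ) 1) (hγ : MDifferentiableAt 𝓘(ℝ, ℝ) 𝓘(ℝ, E) γ s)
    (hσ : MDifferentiableAt 𝓘(ℝ, ℝ) 𝓘(ℝ, E) σ s) :
    (⟨γ s, velocity E γ s⟩ : TangentBundle 𝓘(ℝ, E) M) = ⟨σ s, velocity E σ s⟩ := by
  have he := isCoord_chartAt (E := E) (γ s)
  have hes := mem_chart_source E (γ s)
  refine he.totalSpace_ext hes (h hs) ?_
  have h1 := (hasDerivAt_coord he hes hγ).hasDerivWithinAt (s := Icc 0 1)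
  have h2 := (hasDerivAt_coord he ((h hs) ▸ hes) hσ).hasDerivWithinAt (s := Icc 0 1)
  refine (uniqueDiffOn_Icc zero_lt_one s hs).eq_deriv _ h1 (h2.congr (fun r hr ↦ ?_) ?_)
  · exact congrArg _ (h hr)
  · exact congrArg _ (h hs)

theorem totalSpace_add_torsion {x y : M} {j k v : TangentSpace 𝓘(ℝ, E) x}
    {j' k' v' : TangentSpace 𝓘(ℝ, E) y}
    (hj : (⟨x, j⟩ : TangentBundle 𝓘(ℝ, E) M) = ⟨y, j'⟩)
    (hk : (⟨x, k⟩ : TangentBundle 𝓘(ℝ, E) M) = ⟨y, k'⟩)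
    (hv : (⟨x, v⟩ : TangentBundle 𝓘(ℝ, E) M) = ⟨y, v'⟩) :
    (⟨x, k + cov.torsion x j v⟩ : TangentBundle 𝓘(ℝ, E) M) = ⟨y, k' + cov.torsion y j' v'⟩ := by
  simp only [TotalSpace.mk.injEq] at hj hk hv
  obtain ⟨rfl, hj⟩ := hj
  rw [eq_of_heq hj, eq_of_heq hk.2, eq_of_heq hv.2]

theorem totalSpace_neg_curvature {x y : M} {j v : TangentSpace 𝓘(ℝ, E) x}
    {j' v' : TangentSpace 𝓘(ℝ, E) y}
    (hj : (⟨x, j⟩ : TangentBundle 𝓘(ℝ, E) M) = ⟨y, j'⟩)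
    (hv : (⟨x, v⟩ : TangentBundle 𝓘(ℝ, E) M) = ⟨y, v'⟩) :
    (⟨x, -curvature cov x j v v⟩ : TangentBundle 𝓘(ℝ, E) M) =
      ⟨y, -curvature cov y j' v' v'⟩ := by
  simp only [TotalSpace.mk.injEq] at hj hv
  obtain ⟨rfl, hj⟩ := hj
  rw [eq_of_heq hj, eq_of_heq hv.2]

theorem AffineAt.mdifferentiableAt {f : M → M} {x : M} (h : AffineAt cov f x) :
    MDifferentiableAt 𝓘(ℝ, E) 𝓘(ℝ, E) f x := by
  obtain ⟨e, e', he, he', hrel, -⟩ := h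
  exact hrel.mdifferentiableAt he he'

theorem IsParallelTransport.map {f : M → M} {γ σ : ℝ → M}
    (hσ : ∀ s ∈ Icc (0 : ℝ) 1, f (γ s) = σ s) (hf : ∀ s ∈ Icc (0 : ℝ) 1, AffineAt cov f (γ s))
    {a b : TangentBundle 𝓘(ℝ, E) M} (h : IsParallelTransport cov γ a b) :
    IsParallelTransport cov σ (tangentMap 𝓘(ℝ, E) 𝓘(ℝ, E) f a)
      (tangentMap 𝓘(ℝ, E) 𝓘(ℝ, E) f b) := by
  obtain ⟨X, hX, rfl, rfl⟩ := h
  -- Each tangent space is a copy of `E`, so reading the vector in `E` gives a field along `σ`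
  -- although `f (γ s) = σ s` is known only on `[0, 1]`.
  set X' : (s : ℝ) → TangentSpace 𝓘(ℝ, E) (σ s) :=
    fun s ↦ (mfderiv 𝓘(ℝ, E) 𝓘(ℝ, E) f (γ s) (X s) : E)
  have key : ∀ s ∈ Icc (0 : ℝ) 1,
      (⟨f (γ s), mfderiv 𝓘(ℝ, E) 𝓘(ℝ, E) f (γ s) (X s)⟩ : TangentBundle 𝓘(ℝ, E) M) =
        ⟨σ s, X' s⟩ := fun s hs ↦ TotalSpace.ext (hσ s hs) (heq_of_eq rfl)
  refine ⟨X', fun s hs ↦ ?_, (key 0 (by simp)).symm, (key 1 (by simp)).symm⟩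
  refine ((hX s hs).map (hf s hs)).congr_set (eventually_of_mem self_mem_nhdsWithin key)
    (key s hs) ?_
  rw [map_zero, hσ s hs]

theorem IsJacobiTransport.map [T2Space M]
    (hcov : CovariantDerivative.ContMDiffCovariantDerivative cov ∞) {f : M → M} {γ σ : ℝ → M}
    (hσ : ∀ s ∈ Icc (0 : ℝ) 1, f (γ s) = σ s) (hf : ∀ s ∈ Icc (0 : ℝ) 1, AffineAt cov f (γ s))
    (hγd : ∀ s ∈ Icc (0 : ℝ) 1, MDifferentiableAt 𝓘(ℝ, ℝ) 𝓘(ℝ, E) γ s)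
    (hσd : ∀ s ∈ Icc (0 : ℝ) 1, MDifferentiableAt 𝓘(ℝ, ℝ) 𝓘(ℝ, E) σ s)
    {a a' b : TangentBundle 𝓘(ℝ, E) M} (h : IsJacobiTransport cov γ a a' b) :
    IsJacobiTransport cov σ (tangentMap 𝓘(ℝ, E) 𝓘(ℝ, E) f a)
      (tangentMap 𝓘(ℝ, E) 𝓘(ℝ, E) f a') (tangentMap 𝓘(ℝ, E) 𝓘(ℝ, E) f b) := by
  obtain ⟨J, J', hJ, rfl, rfl, rfl⟩ := h
  set K : (s : ℝ) → TangentSpace 𝓘(ℝ, E) (σ s) :=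
    fun s ↦ (mfderiv 𝓘(ℝ, E) 𝓘(ℝ, E) f (γ s) (J s) : E)
  set K' : (s : ℝ) → TangentSpace 𝓘(ℝ, E) (σ s) :=
    fun s ↦ (mfderiv 𝓘(ℝ, E) 𝓘(ℝ, E) f (γ s) (J' s) : E)
  have key : ∀ s ∈ Icc (0 : ℝ) 1,
      (⟨f (γ s), mfderiv 𝓘(ℝ, E) 𝓘(ℝ, E) f (γ s) (J s)⟩ : TangentBundle 𝓘(ℝ, E) M) =
        ⟨σ s, K s⟩ := fun s hs ↦ TotalSpace.ext (hσ s hs) (heq_of_eq rfl)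
  have key' : ∀ s ∈ Icc (0 : ℝ) 1,
      (⟨f (γ s), mfderiv 𝓘(ℝ, E) 𝓘(ℝ, E) f (γ s) (J' s)⟩ : TangentBundle 𝓘(ℝ, E) M) =
        ⟨σ s, K' s⟩ := fun s hs ↦ TotalSpace.ext (hσ s hs) (heq_of_eq rfl)
  have hvel : ∀ s ∈ Icc (0 : ℝ) 1,
      (⟨f (γ s), mfderiv 𝓘(ℝ, E) 𝓘(ℝ, E) f (γ s) (velocity E γ s)⟩ : TangentBundle 𝓘(ℝ, E) M) =
        ⟨σ s, velocity E σ s⟩ := by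
    intro s hs
    have h1 := (hf s hs).mdifferentiableAt
    rw [← velocity_comp h1 (hγd s hs)]
    exact velocity_eq_of_eqOn (γ := fun s ↦ f (γ s)) hσ hs (h1.comp s (hγd s hs)) (hσd s hs)
  refine ⟨K, K', fun s hs ↦ ⟨?_, ?_⟩, (key 0 (by simp)).symm, (key' 0 (by simp)).symm,
    (key 1 (by simp)).symm⟩
  · exact ((hJ s hs).1.map (hf s hs)).congr_set (eventually_of_mem self_mem_nhdsWithin key)
      (key s hs) (key' s hs)
  · have h1 : ∀ r ∈ Icc (0 : ℝ) 1,
        (⟨f (γ r), mfderiv 𝓘(ℝ, E) 𝓘(ℝ, E) f (γ r)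
          (J' r + cov.torsion (γ r) (J r) (velocity E γ r))⟩ : TangentBundle 𝓘(ℝ, E) M) =
          ⟨σ r, K' r + cov.torsion (σ r) (K r) (velocity E σ r)⟩ := by
      intro r hr
      rw [map_add, (hf r hr).mfderiv_torsion]
      exact totalSpace_add_torsion (key r hr) (key' r hr) (hvel r hr)
    refine ((hJ s hs).2.map (hf s hs)).congr_set (eventually_of_mem self_mem_nhdsWithin h1)
      (h1 s hs) ?_
    rw [map_neg, (hf s hs).mfderiv_curvature hcov]
    exact totalSpace_neg_curvature (key s hs) (hvel s hs)

theorem AffineAt.congr {f g : M → M} {x : M} (h : AffineAt cov f x) (hfg : f =ᶠ[𝓝 x] g) :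
    AffineAt cov g x := by
  obtain ⟨e, e', he, he', hrel, hΓ⟩ := h
  refine ⟨e, e', he, he', ?_, hΓ⟩
  filter_upwards [hrel, hfg] with y hy hy'
  rwa [← hy']

theorem AffineAt.expMap [T2Space M]
    (hcov : CovariantDerivative.ContMDiffCovariantDerivative cov ∞)
    (hcomplete : GeodesicallyComplete cov) {f : M → M} {N : Set M} (hN : IsOpen N)
    (hf : ∀ x ∈ N, AffineAt cov f x) {p : M} {v : TangentSpace 𝓘(ℝ, E) p}
    (h : ∀ s ∈ Icc (0 : ℝ) 1, LinObs.expMap cov p (s • v) ∈ N) :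
    f (LinObs.expMap cov p v) =
      LinObs.expMap cov (f p) (mfderiv 𝓘(ℝ, E) 𝓘(ℝ, E) f p v) := by
  obtain ⟨hγ, hγ0⟩ := isGeodesic_expMap hcov hcomplete p v
  set γ : ℝ → M := fun s ↦ LinObs.expMap cov p (s • v)
  obtain ⟨hσ, hσ0⟩ := isGeodesic_expMap hcov hcomplete (f p) (mfderiv 𝓘(ℝ, E) 𝓘(ℝ, E) f p v)
  have hc : Continuous γ :=
    continuous_iff_continuousAt.2 fun s ↦ (IsGeodesicAt.mdifferentiableAt (hγ s)).continuousAt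
  -- `f ∘ γ` is known to be a geodesic only where `γ` runs in `N`. This component is open and
  -- connected and contains `[0, 1]`, so uniqueness can be applied on it.
  set I := connectedComponentIn (γ ⁻¹' N) 0
  have h0 : (0 : ℝ) ∈ γ ⁻¹' N := h 0 (by simp)
  have hI : Icc (0 : ℝ) 1 ⊆ I := isPreconnected_Icc.subset_connectedComponentIn (by simp) h
  have hIN : ∀ s ∈ I, γ s ∈ N := fun s hs ↦
    connectedComponentIn_subset (γ ⁻¹' N) 0 hs
  have h1 := geodesic_eqOn hcov (hN.preimage hc).connectedComponentIn
    isPreconnected_connectedComponentIn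
    (fun s hs ↦ IsGeodesicAt.map (Eventually.of_forall hγ) (hf _ (hIN s hs))) (fun s _ ↦ hσ s)
    (hI (by simp : (0 : ℝ) ∈ Icc (0 : ℝ) 1)) (hσ0.symm ▸ ?_) (hI (by simp : (1 : ℝ) ∈ Icc (0 : ℝ) 1))
  · simpa [γ] using h1
  · rw [velocity_comp (hf _ h0).mdifferentiableAt (IsGeodesicAt.mdifferentiableAt (hγ 0))]
    exact congrArg (fun a : TangentBundle 𝓘(ℝ, E) M ↦
      (⟨f a.1, mfderiv 𝓘(ℝ, E) 𝓘(ℝ, E) f a.1 a.2⟩ : TangentBundle 𝓘(ℝ, E) M)) hγ0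

end Transport

/-! ### Exact linearization implies preintegrability -/

namespace VectorErrorRep

variable {E : Type*} [NormedAddCommGroup E] [NormedSpace ℝ E] [FiniteDimensional ℝ E]
  {M : Type*} [TopologicalSpace M] [ChartedSpace E M] [IsManifold 𝓘(ℝ, E) ∞ M]
  {V : Type*} [NormedAddCommGroup V] [NormedSpace ℝ V]
  {cov : AffineConnection E M} {W : Dynamics V E M} {R : VectorErrorRep cov W}

theorem continuousAt_Φ {t : ℝ} (ht : t ∈ Ioo (-R.ε) R.ε) {p : M} (hp : p ∈ R.U) :
    ContinuousAt (fun z : ℝ × M ↦ R.Φ z.1 z.2) (t, p) :=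
  R.continuousOn_Φ.continuousAt (prod_mem_nhds (isOpen_Ioo.mem_nhds ht) (R.isOpen.mem_nhds hp))

theorem continuousAt_flow {t : ℝ} (ht : t ∈ Ioo (-R.ε) R.ε) {p : M} (hp : p ∈ R.U) :
    ContinuousAt (fun τ ↦ R.Φ τ p) t :=
  (R.flow p hp t ht).continuousAt

theorem continuous_expMap [T2Space M]
    (hcov : CovariantDerivative.ContMDiffCovariantDerivative cov ∞)
    (hcomplete : GeodesicallyComplete cov) (p : M) (v : TangentSpace 𝓘(ℝ, E) p) :
    Continuous (fun s : ℝ ↦ expMap cov p (s • v)) :=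
  continuous_iff_continuousAt.2 fun s ↦
    (IsGeodesicAt.mdifferentiableAt ((isGeodesic_expMap hcov hcomplete p v).1 s)).continuousAt

theorem expMap_zero [T2Space M]
    (hcov : CovariantDerivative.ContMDiffCovariantDerivative cov ∞)
    (hcomplete : GeodesicallyComplete cov) (p : M) (v : TangentSpace 𝓘(ℝ, E) p) :
    expMap cov p ((0 : ℝ) • v) = p :=
  congrArg TotalSpace.proj (isGeodesic_expMap hcov hcomplete p v).2

/-- The linearization formula along the segment shows that `s ↦ exp (s F v)` stays in `U`;
uniqueness of geodesics in `U` then identifies `F v` with the error vector. -/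
theorem er_eq_of_segment {f : M → M} {τ : ℝ} {p q : M} (hp : p ∈ R.domain τ) (hq : q ∈ R.domain τ)
    (hfq : f q = R.Φ τ q)
    (hf : ∀ x ∈ R.domain τ, R.Φ τ x =
      expMap cov (f q) (mfderiv 𝓘(ℝ, E) 𝓘(ℝ, E) f q (R.er x q)))
    (hseg : ∀ s ∈ Icc (0 : ℝ) 1, expMap cov q (s • R.er p q) ∈ R.domain τ) :
    (⟨R.Φ τ q, R.er (R.Φ τ p) (R.Φ τ q)⟩ : TangentBundle 𝓘(ℝ, E) M) =
      ⟨f q, mfderiv 𝓘(ℝ, E) 𝓘(ℝ, E) f q (R.er p q)⟩ := by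
  have h1 : ∀ s ∈ Icc (0 : ℝ) 1,
      expMap cov (f q) (s • mfderiv 𝓘(ℝ, E) 𝓘(ℝ, E) f q (R.er p q)) ∈ R.U := by
    intro s hs
    have h2 := hf _ (hseg s hs)
    rw [R.er_smul hq.1 hp.1 hs, map_smul] at h2
    rw [← h2]
    exact R.mapsTo_domain τ (hseg s hs)
  have h3 := R.er_expMap (by rw [hfq]; exact R.mapsTo_domain τ hq) h1
  rw [← hf p hp] at h3
  rw [← h3, ← hfq]

/-- Continuity argument along the segment at a fixed time. As long as the image lies in `U`, it
coincides with the geodesic `σ` given by the current error vector; its limit points lie on `σ` as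
well, and `σ` stays in `U` up to its end. The hypothesis `hseg` records that earlier times are
already settled. -/
theorem segment_mem_of_er_eq [T2Space M]
    (hcov : CovariantDerivative.ContMDiffCovariantDerivative cov ∞)
    (hcomplete : GeodesicallyComplete cov) {f : M → M} {τ : ℝ} (hτ : τ ∈ Ioo (-R.ε) R.ε)
    {p q : M} (hp : p ∈ R.domain τ) (hq : q ∈ R.domain τ)
    (hf : ∀ x ∈ R.domain τ, R.Φ τ x =
      expMap cov (f q) (mfderiv 𝓘(ℝ, E) 𝓘(ℝ, E) f q (R.er x q)))
    (her : (⟨R.Φ τ q, R.er (R.Φ τ p) (R.Φ τ q)⟩ : TangentBundle 𝓘(ℝ, E) M) =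
      ⟨f q, mfderiv 𝓘(ℝ, E) 𝓘(ℝ, E) f q (R.er p q)⟩)
    (hseg : ∀ s ∈ Icc (0 : ℝ) 1, R.Φ τ (expMap cov q (s • R.er p q)) ∈ R.U →
      expMap cov q (s • R.er p q) ∈ R.domain τ) :
    ∀ s ∈ Icc (0 : ℝ) 1, R.Φ τ (expMap cov q (s • R.er p q)) ∈ R.U := by
  set γ : ℝ → M := fun s ↦ expMap cov q (s • R.er p q)
  set σ : ℝ → M := fun s ↦ expMap cov (R.Φ τ q) (s • R.er (R.Φ τ p) (R.Φ τ q))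
  have hγU : ∀ s ∈ Icc (0 : ℝ) 1, γ s ∈ R.U := R.isErrorFunction.mem _ hq.1 _ hp.1
  have hγ : Continuous γ := continuous_expMap hcov hcomplete _ _
  have hσ : Continuous σ := continuous_expMap hcov hcomplete _ _
  have hΦγ : ∀ s ∈ Icc (0 : ℝ) 1, ContinuousAt (fun s ↦ R.Φ τ (γ s)) s := by
    intro s hs
    exact ContinuousAt.comp (f := fun s ↦ (τ, γ s)) (g := fun z : ℝ × M ↦ R.Φ z.1 z.2)
      (continuousAt_Φ hτ (hγU s hs)) (by fun_prop)
  have hfγ : ∀ s ∈ Icc (0 : ℝ) 1, R.Φ τ (γ s) ∈ R.U → R.Φ τ (γ s) = σ s := by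
    intro s hs h
    have h2 := hf _ (hseg s hs h)
    rw [R.er_smul hq.1 hp.1 hs, map_smul] at h2
    refine h2.trans ?_
    exact congrArg (fun a : TangentBundle 𝓘(ℝ, E) M ↦ expMap cov a.1 (s • a.2)) her.symm
  refine unitInterval_induction (fun s hs h ↦ ?_) fun s hs h ↦ ?_
  · rcases hs.1.eq_or_lt with rfl | h0
    · rw [expMap_zero hcov hcomplete]
      exact R.mapsTo_domain τ hq
    · have h1 : ∀ᶠ r in 𝓝[<] s, R.Φ τ (γ r) = σ r := by
        filter_upwards [Ioo_mem_nhdsLT h0] with r hr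
        exact hfγ r ⟨hr.1.le, hr.2.le.trans hs.2⟩ (h r ⟨hr.1.le, hr.2⟩)
      have h2 : Tendsto (fun r ↦ R.Φ τ (γ r)) (𝓝[<] s) (𝓝 (σ s)) :=
        (hσ.continuousAt.tendsto.mono_left nhdsWithin_le_nhds).congr' (h1.mono fun _ h ↦ h.symm)
      have h3 := tendsto_nhds_unique ((hΦγ s hs).tendsto.mono_left nhdsWithin_le_nhds) h2
      rw [h3]
      exact R.patch_mem hp hq hs
  · have hs' : s ∈ Icc (0 : ℝ) 1 := ⟨hs.1, hs.2.le⟩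
    exact nhdsWithin_le_nhds ((hΦγ s hs').eventually
      (R.isOpen.mem_nhds (h s ⟨hs.1, le_rfl⟩)))

/-- Both sides are continuous in time: the left by smoothness of `er`, the right because a field
with a covariant derivative has continuous coordinates. -/
theorem er_eq_of_frequently
    {f : ℝ → M → M} {τ : ℝ} (hτ : τ ∈ Ioo (-R.ε) R.ε) {p q : M} (hp : p ∈ R.domain τ)
    (hq : q ∈ R.domain τ) (hfq : f τ q = R.Φ τ q) {D : TangentSpace 𝓘(ℝ, E) (f τ q)}
    (hD : HasCovDerivWithinAt cov (fun r ↦ f r q)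
      (fun r ↦ mfderiv 𝓘(ℝ, E) 𝓘(ℝ, E) (f r) q (R.er p q)) (R.times q) τ D)
    (h : ∃ᶠ r in 𝓝 τ, (⟨R.Φ r q, R.er (R.Φ r p) (R.Φ r q)⟩ : TangentBundle 𝓘(ℝ, E) M) =
      ⟨f r q, mfderiv 𝓘(ℝ, E) 𝓘(ℝ, E) (f r) q (R.er p q)⟩) :
    (⟨R.Φ τ q, R.er (R.Φ τ p) (R.Φ τ q)⟩ : TangentBundle 𝓘(ℝ, E) M) =
      ⟨f τ q, mfderiv 𝓘(ℝ, E) 𝓘(ℝ, E) (f τ) q (R.er p q)⟩ := by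
  set e := chartAt E (R.Φ τ q)
  have he : IsCoord e := isCoord_chartAt (R.Φ τ q)
  have hes : R.Φ τ q ∈ e.source := mem_chart_source E (R.Φ τ q)
  refine he.totalSpace_ext hes hfq.symm ?_
  have h1 : ContinuousAt (fun r ↦ dcoord e (R.Φ r q) (R.er (R.Φ r p) (R.Φ r q))) τ :=
    ContinuousAt.comp (f := fun r ↦ (R.Φ r p, R.Φ r q))
      (g := fun z : M × M ↦ dcoord e z.2 (R.er z.1 z.2))
      (R.contMDiffAt_er (R.mapsTo_domain τ hq) (R.mapsTo_domain τ hp)).continuousAt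
      ((continuousAt_flow hτ hp.1).prodMk (continuousAt_flow hτ hq.1))
  rw [hasCovDerivWithinAt_iff he (by rw [hfq]; exact hes)] at hD
  obtain ⟨-, -, j', -, h2, -⟩ := hD
  have h3 := h2.continuousWithinAt.continuousAt ((R.isOpen_times q).mem_nhds ⟨hτ, hq⟩)
  exact tendsto_nhds_unique_of_frequently_eq h1 h3 (h.mono fun r hr ↦ dcoord_congr hr)

theorem exists_mul_of_mem_uIcc {t l r : ℝ} (hl : 0 ≤ l) (hr : r ∈ uIcc 0 (l * t)) :
    ∃ m ∈ Icc 0 l, r = m * t := by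
  have h := image_mul_const_uIcc t 0 l
  rw [zero_mul] at h
  rw [← h, uIcc_of_le hl] at hr
  obtain ⟨m, hm, rfl⟩ := hr
  exact ⟨m, hm, rfl⟩

theorem mul_mem_uIcc {t l : ℝ} (hl : l ∈ Icc (0 : ℝ) 1) : l * t ∈ uIcc 0 t := by
  have h := image_mul_const_uIcc t 0 1
  rw [zero_mul, one_mul] at h
  rw [← h, uIcc_of_le zero_le_one]
  exact ⟨l, hl, rfl⟩

/-- Continuity argument in time for the whole segment at once. Writing times as `l * t` with `l ∈
[0, 1]` treats both signs of `t` together. -/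
theorem segment_mem_domain [T2Space M]
    (hcov : CovariantDerivative.ContMDiffCovariantDerivative cov ∞)
    (hcomplete : GeodesicallyComplete cov) {f : ℝ → M → M} {q : M}
    {D : (τ : ℝ) → (v : TangentSpace 𝓘(ℝ, E) q) → TangentSpace 𝓘(ℝ, E) (f τ q)}
    (hfq : ∀ τ ∈ R.times q, f τ q = R.Φ τ q)
    (hf : ∀ τ ∈ R.times q, ∀ x ∈ R.domain τ, R.Φ τ x =
      expMap cov (f τ q) (mfderiv 𝓘(ℝ, E) 𝓘(ℝ, E) (f τ) q (R.er x q)))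
    (hD : ∀ τ ∈ R.times q, ∀ v, HasCovDerivWithinAt cov (fun r ↦ f r q)
      (fun r ↦ mfderiv 𝓘(ℝ, E) 𝓘(ℝ, E) (f r) q v) (R.times q) τ (D τ v))
    {t : ℝ} (ht : t ∈ Ioo (-R.ε) R.ε) {p : M} (hp : p ∈ R.domain t) (hq : q ∈ R.domain t) :
    ∀ s ∈ Icc (0 : ℝ) 1, expMap cov q (s • R.er p q) ∈ R.domain t := by
  set γ : ℝ → M := fun s ↦ expMap cov q (s • R.er p q)
  have hγU : ∀ s ∈ Icc (0 : ℝ) 1, γ s ∈ R.U := R.isErrorFunction.mem _ hq.1 _ hp.1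
  have hγ : Continuous γ := continuous_expMap hcov hcomplete _ _
  have hmul : ∀ l ∈ Icc (0 : ℝ) 1, l * t ∈ Ioo (-R.ε) R.ε :=
    fun l hl ↦ R.uIcc_subset ht (mul_mem_uIcc hl)
  have hpd : ∀ l ∈ Icc (0 : ℝ) 1, p ∈ R.domain (l * t) :=
    fun l hl ↦ R.domain_mono (mul_mem_uIcc hl) hp
  have hqd : ∀ l ∈ Icc (0 : ℝ) 1, q ∈ R.domain (l * t) :=
    fun l hl ↦ R.domain_mono (mul_mem_uIcc hl) hq
  have hdom : ∀ l : ℝ, 0 ≤ l → ∀ s ∈ Icc (0 : ℝ) 1, (∀ m ∈ Icc 0 l, R.Φ (m * t) (γ s) ∈ R.U) →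
      γ s ∈ R.domain (l * t) := by
    intro l hl s hs h
    refine ⟨hγU s hs, fun r hr ↦ ?_⟩
    obtain ⟨m, hm, rfl⟩ := exists_mul_of_mem_uIcc hl hr
    exact h m hm
  have key : ∀ l ∈ Icc (0 : ℝ) 1, ∀ s ∈ Icc (0 : ℝ) 1, R.Φ (l * t) (γ s) ∈ R.U := by
    refine unitInterval_induction (fun l hl h ↦ ?_) fun l hl h ↦ ?_
    · rcases hl.1.eq_or_lt with rfl | h0
      · intro s hs
        rw [zero_mul, R.Φ_zero _ (hγU s hs)]
        exact hγU s hs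
      · have hlt : l * t ∈ R.times q := ⟨hmul l hl, hqd l hl⟩
        refine segment_mem_of_er_eq hcov hcomplete (hmul l hl) (hpd l hl) (hqd l hl)
          (hf _ hlt) ?_ fun s hs hsU ↦ ?_
        -- Before time `l * t` the whole segment lies in the domain, so the error vector is
        -- transported by `F`; the relation is carried to time `l * t` by letting `m ↑ l`.
        · refine er_eq_of_frequently (hmul l hl) (hpd l hl) (hqd l hl) (hfq _ hlt) (hD _ hlt _) ?_
          have h1 : Tendsto (fun m ↦ m * t) (𝓝[<] l) (𝓝 (l * t)) :=
            (Continuous.tendsto (by fun_prop) l).mono_left nhdsWithin_le_nhds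
          refine h1.frequently (Eventually.frequently ?_)
          filter_upwards [Ioo_mem_nhdsLT h0] with m hm
          have hm1 : m ∈ Icc (0 : ℝ) 1 := ⟨hm.1.le, hm.2.le.trans hl.2⟩
          have hmt : m * t ∈ R.times q := ⟨hmul m hm1, hqd m hm1⟩
          exact er_eq_of_segment (hpd m hm1) (hqd m hm1) (hfq _ hmt) (hf _ hmt) fun s hs ↦
            hdom m hm.1.le s hs fun k hk ↦ h k ⟨hk.1, hk.2.trans_lt hm.2⟩ s hs
        · refine hdom l hl.1 s hs fun m hm ↦ ?_
          rcases hm.2.eq_or_lt with rfl | hml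
          · exact hsU
          · exact h m ⟨hm.1, hml⟩ s hs
    · have hl' : l ∈ Icc (0 : ℝ) 1 := ⟨hl.1, hl.2.le⟩
      -- Compactness of `[0, 1]` provides one time step that is good for all `s`.
      refine nhdsWithin_le_nhds (isCompact_Icc.eventually_forall_of_forall_eventually
        fun s hs ↦ ?_)
      have h1 : ContinuousAt (fun z : ℝ × ℝ ↦ R.Φ (z.1 * t) (γ z.2)) (l, s) :=
        ContinuousAt.comp (f := fun z : ℝ × ℝ ↦ (z.1 * t, γ z.2))
          (g := fun z : ℝ × M ↦ R.Φ z.1 z.2) (continuousAt_Φ (hmul l hl') (hγU s hs))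
          (by fun_prop)
      exact h1.eventually (R.isOpen.mem_nhds (h l ⟨hl.1, le_rfl⟩ s hs))
  intro s hs
  have := hdom 1 zero_le_one s hs fun m hm ↦ key m hm s hs
  rwa [one_mul] at this

theorem mdifferentiableAt_patch [T2Space M]
    (hcov : CovariantDerivative.ContMDiffCovariantDerivative cov ∞)
    (hcomplete : GeodesicallyComplete cov) (p q : M) (t s : ℝ) :
    MDifferentiableAt 𝓘(ℝ, ℝ) 𝓘(ℝ, E) (R.patch p q t) s :=
  IsGeodesicAt.mdifferentiableAt ((isGeodesic_expMap hcov hcomplete _ _).1 s)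

theorem ExactLinearization.preintegrable [T2Space M]
    (hcov : CovariantDerivative.ContMDiffCovariantDerivative cov ∞)
    (hcomplete : GeodesicallyComplete cov) (h : R.ExactLinearization) : R.Preintegrable := by
  obtain ⟨ψ, A, h₁, h₂, -⟩ := h
  have hconv : ∀ t ∈ Ioo (-R.ε) R.ε, ∀ p ∈ R.domain t, ∀ q ∈ R.domain t, ∀ s ∈ Icc (0 : ℝ) 1,
      expMap cov q (s • R.er p q) ∈ R.domain t := fun t ht p hp q hq ↦
    segment_mem_domain hcov hcomplete (f := ψ q) (fun τ hτ ↦ (h₁ τ hτ.1 q hτ.2).2.1)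
      (fun τ hτ ↦ (h₁ τ hτ.1 q hτ.2).2.2) (h₂ q hq.1) ht hp hq
  have hself : R.SelfSimilar := by
    intro t ht p hp q hq s hs
    have h3 := er_eq_of_segment hp hq (h₁ t ht q hq).2.1 (h₁ t ht q hq).2.2 (hconv t ht p hp q hq)
    have h4 := (h₁ t ht q hq).2.2 _ (hconv t ht p hp q hq s hs)
    rw [R.er_smul hq.1 hp.1 hs, map_smul] at h4
    rw [R.patch_zero hp.1 hq.1, h4]
    exact congrArg (fun a : TangentBundle 𝓘(ℝ, E) M ↦ expMap cov a.1 (s • a.2)) h3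
  -- The domain is star-shaped about `x` by `hconv`, so the affine map `ψ x t` commutes with
  -- exponentials from `x`; the linearization formula then says that it equals `Φ t` on the domain.
  have haff : ∀ t ∈ Ioo (-R.ε) R.ε, ∀ x ∈ R.domain t, AffineAt cov (R.Φ t) x := by
    intro t ht x hx
    have h3 : ∀ y ∈ R.domain t, AffineAt cov (ψ x t) y := fun y hy ↦ (h₁ t ht x hx).1.affineAt hy
    refine (h3 x hx).congr ?_
    filter_upwards [(R.isOpen_domain ht).mem_nhds hx] with y hy
    have h4 := AffineAt.expMap hcov hcomplete (R.isOpen_domain ht) h3 (hconv t ht y hy x hx)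
    rw [R.isErrorFunction.exp_er x hx.1 y hy.1] at h4
    rw [h4, ← (h₁ t ht x hx).2.2 y hy]
  refine ⟨hself, fun t ht p hp q hq a a' b hab ↦ ?_⟩
  refine hab.map hcov (fun s hs ↦ (hself t ht p hp q hq s hs).symm) (fun s hs ↦ haff t ht _ ?_)
    (fun s _ ↦ mdifferentiableAt_patch hcov hcomplete _ _ _ _)
    (fun s _ ↦ mdifferentiableAt_patch hcov hcomplete _ _ _ _)
  rw [R.patch_zero hp.1 hq.1]
  exact hconv t ht p hp q hq s hs

end VectorErrorRep


/-! ### Normed structure on bilinear maps -/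

section BilinearInstances

variable {E : Type*} [NormedAddCommGroup E] [NormedSpace ℝ E]

instance normedAddCommGroupBilin : NormedAddCommGroup (E →L[ℝ] E →L[ℝ] E) :=
  ContinuousLinearMap.toNormedAddCommGroup

instance seminormedAddCommGroupBilin : SeminormedAddCommGroup (E →L[ℝ] E →L[ℝ] E) :=
  ContinuousLinearMap.toSeminormedAddCommGroup

instance normedSpaceBilin : NormedSpace ℝ (E →L[ℝ] E →L[ℝ] E) :=
  ContinuousLinearMap.toNormedSpace

end BilinearInstances

/-! ### Existence and uniqueness of Jacobi fields in coordinates -/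

section Jacobi

variable {E : Type*} [NormedAddCommGroup E] [NormedSpace ℝ E] [FiniteDimensional ℝ E]
  {M : Type*} [TopologicalSpace M] [ChartedSpace E M] [IsManifold 𝓘(ℝ, E) ∞ M]
  {cov : AffineConnection E M}

omit [FiniteDimensional ℝ E] in
theorem hasDerivAt_fst {F : Type*} [NormedAddCommGroup F] [NormedSpace ℝ F] {y : ℝ → E × F}
    {y' : E × F} {r : ℝ} (h : HasDerivAt y y' r) : HasDerivAt (fun r ↦ (y r).1) y'.1 r :=
  HasFDerivAt.comp_hasDerivAt (l := Prod.fst)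
    (l' := ContinuousLinearMap.fst ℝ E F) r hasFDerivAt_fst h

omit [FiniteDimensional ℝ E] in
theorem hasDerivAt_snd {F : Type*} [NormedAddCommGroup F] [NormedSpace ℝ F] {y : ℝ → E × F}
    {y' : E × F} {r : ℝ} (h : HasDerivAt y y' r) : HasDerivAt (fun r ↦ (y r).2) y'.2 r :=
  HasFDerivAt.comp_hasDerivAt (l := Prod.snd)
    (l' := ContinuousLinearMap.snd ℝ E F) r hasFDerivAt_snd h

variable (cov) in
/-- The Jacobi equation in coordinates, for the coordinates `j` of the field and `k` of its
covariant derivative plus torsion. -/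
def IsCoordJacobi {e : OpenPartialHomeomorph M E} (he : IsCoord e) (γ : ℝ → M) (j k : ℝ → E)
    (r : ℝ) : Prop :=
  HasDerivAt j (k r - chris cov he (e (γ r)) (dcoord e (γ r) (velocity E γ r)) (j r)) r ∧
    HasDerivAt k (-coordCurvature cov he (e (γ r)) (j r) (dcoord e (γ r) (velocity E γ r))
        (dcoord e (γ r) (velocity E γ r)) -
      chris cov he (e (γ r)) (k r) (dcoord e (γ r) (velocity E γ r))) r

theorem coordCurvature_smul {e : OpenPartialHomeomorph M E} (he : IsCoord e) (z u v w : E)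
    (h : ℝ) : coordCurvature cov he z u (h • v) (h • w) =
      h • h • coordCurvature cov he z u v w := by
  simp only [coordCurvature, map_smul, _root_.smul_apply, smul_sub, smul_add]

theorem norm_coordCurvature_le {e : OpenPartialHomeomorph M E} (he : IsCoord e) (z u v : E) :
    ‖coordCurvature cov he z u v v‖ ≤
      2 * (‖fderiv ℝ (chris cov he) z‖ + ‖chris cov he z‖ ^ 2) * ‖v‖ ^ 2 * ‖u‖ := by
  have h2 : ∀ (L : E →L[ℝ] E →L[ℝ] E) (a b : E), ‖L a b‖ ≤ ‖L‖ * ‖a‖ * ‖b‖ := fun L a b ↦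
    L.le_opNorm₂ a b
  have h3 : ∀ a b c : E, ‖fderiv ℝ (chris cov he) z a b c‖ ≤
      ‖fderiv ℝ (chris cov he) z‖ * ‖a‖ * ‖b‖ * ‖c‖ := by
    intro a b c
    refine (h2 _ b c).trans ?_
    gcongr
    exact ContinuousLinearMap.le_opNorm _ _
  have h4 : ∀ a b c : E, ‖chris cov he z (chris cov he z a b) c‖ ≤
      ‖chris cov he z‖ ^ 2 * ‖a‖ * ‖b‖ * ‖c‖ := by
    intro a b c
    refine (h2 _ _ c).trans ?_
    calc ‖chris cov he z‖ * ‖chris cov he z a b‖ * ‖c‖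
        ≤ ‖chris cov he z‖ * (‖chris cov he z‖ * ‖a‖ * ‖b‖) * ‖c‖ := by gcongr; exact h2 _ _ _
      _ = _ := by ring
  calc ‖coordCurvature cov he z u v v‖
      ≤ (‖fderiv ℝ (chris cov he) z u v v‖ + ‖fderiv ℝ (chris cov he) z v v u‖) +
        (‖chris cov he z (chris cov he z v v) u‖ + ‖chris cov he z (chris cov he z v u) v‖) :=
        (norm_add_le _ _).trans (add_le_add (norm_sub_le _ _) (norm_sub_le _ _))
    _ ≤ _ := by linarith [h3 u v v, h3 v v u, h4 v v u, h4 v u v]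

theorem contDiffAt_coordCurvature [T2Space M]
    (hcov : CovariantDerivative.ContMDiffCovariantDerivative cov ∞)
    {e : OpenPartialHomeomorph M E} (he : IsCoord e) {F : Type*} [NormedAddCommGroup F]
    [NormedSpace ℝ F] {z u v w : F → E} {y : F} (hz : ContDiffAt ℝ ∞ z y) (hu : ContDiffAt ℝ ∞ u y)
    (hv : ContDiffAt ℝ ∞ v y) (hw : ContDiffAt ℝ ∞ w y) (hy : z y ∈ e.target) :
    ContDiffAt ℝ ∞ (fun x ↦ coordCurvature cov he (z x) (u x) (v x) (w x)) y := by
  have h1 : ContDiffAt ℝ ∞ (chris cov he) (z y) :=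
    (contDiffOn_chris cov hcov he).contDiffAt (e.open_target.mem_nhds hy)
  have h2 : ContDiffAt ℝ ∞ (fun x ↦ chris cov he (z x)) y := h1.comp y hz
  have h3 : ContDiffAt ℝ ∞ (fun x ↦ fderiv ℝ (chris cov he) (z x)) y :=
    (h1.fderiv_right (m := ∞) (by simp)).comp y hz
  exact ((((h3.clm_apply hu).clm_apply hw).clm_apply hv).sub
    (((h3.clm_apply hv).clm_apply hw).clm_apply hu)).add
    (((h2.clm_apply ((h2.clm_apply hw).clm_apply hv)).clm_apply hu).sub
    ((h2.clm_apply ((h2.clm_apply hw).clm_apply hu)).clm_apply hv))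

/-- The geodesic and Jacobi equations are joined into one autonomous system, so that local existence
for smooth vector fields applies. Uniqueness of geodesics identifies the position component with
`γ`. -/
theorem exists_isCoordJacobi [T2Space M]
    (hcov : CovariantDerivative.ContMDiffCovariantDerivative cov ∞)
    {e : OpenPartialHomeomorph M E} (he : IsCoord e) {γ : ℝ → M} (hγ : IsGeodesic cov γ)
    (h0 : γ 0 ∈ e.source) (j₀ k₀ : E) :
    ∃ j k : ℝ → E, j 0 = j₀ ∧ k 0 = k₀ ∧
      ∀ᶠ r in 𝓝 0, γ r ∈ e.source ∧ IsCoordJacobi cov he γ j k r := by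
  set F : E × E × E × E → E × E × E × E := fun y ↦
    (y.2.1, -chris cov he y.1 y.2.1 y.2.1, y.2.2.2 - chris cov he y.1 y.2.1 y.2.2.1,
      -coordCurvature cov he y.1 y.2.2.1 y.2.1 y.2.1 - chris cov he y.1 y.2.2.2 y.2.1)
  set y₀ : E × E × E × E := (e (γ 0), dcoord e (γ 0) (velocity E γ 0), j₀, k₀)
  have hF : ContDiffAt ℝ ∞ F y₀ := by
    have ht : y₀.1 ∈ e.target := e.map_source h0
    have h1 : ContDiffAt ℝ ∞ (chris cov he) y₀.1 :=
      (contDiffOn_chris cov hcov he).contDiffAt (e.open_target.mem_nhds ht)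
    have h2 : ContDiffAt ℝ ∞ (fun y : E × E × E × E ↦ chris cov he y.1) y₀ :=
      ContDiffAt.comp (g := chris cov he) (f := Prod.fst) y₀ h1 contDiffAt_fst
    have hc : ContDiffAt ℝ ∞ (fun y : E × E × E × E ↦ y.1) y₀ := by fun_prop
    have hd : ContDiffAt ℝ ∞ (fun y : E × E × E × E ↦ y.2.1) y₀ := by fun_prop
    have hj : ContDiffAt ℝ ∞ (fun y : E × E × E × E ↦ y.2.2.1) y₀ := by fun_prop
    have hk : ContDiffAt ℝ ∞ (fun y : E × E × E × E ↦ y.2.2.2) y₀ := by fun_prop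
    exact hd.prodMk ((((h2.clm_apply hd).clm_apply hd).neg).prodMk
      ((hk.sub ((h2.clm_apply hd).clm_apply hj)).prodMk
      ((contDiffAt_coordCurvature hcov he hc hj hd hd ht).neg.sub
        ((h2.clm_apply hk).clm_apply hd))))
  obtain ⟨y, hy0, δ, hδ, hy⟩ :=
    (hF.of_le (m := 1) (by norm_cast)).exists_forall_mem_closedBall_exists_eq_forall_mem_Ioo_hasDerivAt₀ 0
  have hy' : ∀ᶠ r in 𝓝 (0 : ℝ), HasDerivAt y (F (y r)) r :=
    eventually_of_mem (Ioo_mem_nhds (by linarith) (by linarith)) hy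
  set σ : ℝ → M := fun r ↦ e.symm (y r).1
  have hσ0 : σ 0 = γ 0 := by simp only [σ, hy0, y₀, e.left_inv h0]
  have hyc : ∀ᶠ r in 𝓝 (0 : ℝ), (y r).1 ∈ e.target := by
    refine (continuous_fst.continuousAt.comp hy'.self_of_nhds.continuousAt).eventually
      (e.open_target.mem_nhds ?_)
    change (y 0).1 ∈ e.target
    rw [hy0]
    exact e.map_source h0
  have h1 : ∀ᶠ r in 𝓝 (0 : ℝ), ContinuousAt σ r ∧ HasDerivAt (fun r ↦ e (σ r)) (y r).2.1 r ∧
      HasDerivAt (fun r ↦ (y r).2.1) (-chris cov he (y r).1 (y r).2.1 (y r).2.1) r := by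
    filter_upwards [hy', hyc.eventually_nhds] with r hr hr'
    refine ⟨?_, ?_, ?_⟩
    · exact ContinuousAt.comp (g := e.symm) (f := fun r ↦ (y r).1)
        (e.continuousAt_symm hr'.self_of_nhds) (hasDerivAt_fst hr).continuousAt
    · refine (hasDerivAt_fst hr).congr_of_eventuallyEq ?_
      filter_upwards [hr'] with q hq using e.right_inv hq
    · exact hasDerivAt_fst (hasDerivAt_snd hr)
  have h2 : ∀ᶠ r in 𝓝 (0 : ℝ), σ r ∈ e.source ∧ dcoord e (σ r) (velocity E σ r) = (y r).2.1 := by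
    filter_upwards [h1, hyc] with r hr hr'
    exact ⟨e.map_target hr', dcoord_velocity he (e.map_target hr') hr.1 hr.2.1⟩
  have h3 : ∀ᶠ r in 𝓝 (0 : ℝ), IsGeodesicAt cov σ r := by
    filter_upwards [h1, h2.eventually_nhds, hyc] with r hr hr' hr''
    refine (isGeodesicAt_iff he hr'.self_of_nhds.1).2
      ⟨mdifferentiableAt_curve he hr'.self_of_nhds.1 hr.1 hr.2.1, ?_⟩
    rw [hr'.self_of_nhds.2, show e (σ r) = (y r).1 from e.right_inv hr'']
    exact hr.2.2.congr_of_eventuallyEq (hr'.mono fun q hq ↦ hq.2)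
  have h4 : σ =ᶠ[𝓝 0] γ := by
    refine geodesic_eventuallyEq hcov h3 (Eventually.of_forall hγ) ?_
    refine he.totalSpace_ext (hσ0 ▸ h0) hσ0 ?_
    rw [h2.self_of_nhds.2, hy0]
  refine ⟨fun r ↦ (y r).2.2.1, fun r ↦ (y r).2.2.2,
    congrArg (fun z ↦ z.2.2.1) hy0, congrArg (fun z ↦ z.2.2.2) hy0, ?_⟩
  filter_upwards [h2, h4.eventually_nhds, hy', hyc] with r hr hr' hr'' hr3
  have h5 := hr'.self_of_nhds
  have h6 : dcoord e (γ r) (velocity E γ r) = (y r).2.1 := by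
    rw [← hr.2]
    exact dcoord_congr (velocity_eventuallyEq (E := E) (show σ =ᶠ[𝓝 r] γ from hr')).symm
  have h7 : e (γ r) = (y r).1 := by rw [← h5]; exact e.right_inv hr3
  refine ⟨h5 ▸ hr.1, ?_⟩
  rw [IsCoordJacobi, h6, h7]
  exact ⟨hasDerivAt_fst (hasDerivAt_snd (hasDerivAt_snd hr'')),
    hasDerivAt_snd (hasDerivAt_snd (hasDerivAt_snd hr''))⟩

/-- Rescales a field on `[0, h]` to `[0, 1]`, which multiplies covariant derivatives by `h`. The
condition `hk` says that `k 0` is the torsion term, i.e. that the initial covariant derivative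
vanishes, a condition unaffected by rescaling. -/
theorem isJacobiTransport_of_isCoordJacobi [T2Space M]
    (hcov : CovariantDerivative.ContMDiffCovariantDerivative cov ∞)
    {e : OpenPartialHomeomorph M E} (he : IsCoord e) {γ : ℝ → M}
    (hγ : IsGeodesic cov γ) {j k : ℝ → E} {h : ℝ}
    (hjk : ∀ s ∈ Icc (0 : ℝ) 1, γ (h * s) ∈ e.source ∧ IsCoordJacobi cov he γ j k (h * s))
    (hk : k 0 = chris cov he (e (γ 0)) (dcoord e (γ 0) (velocity E γ 0)) (j 0) -
      chris cov he (e (γ 0)) (j 0) (dcoord e (γ 0) (velocity E γ 0))) :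
    IsJacobiTransport cov (fun s ↦ γ (h * s)) ⟨γ 0, dframe e (γ 0) (j 0)⟩ ⟨γ 0, 0⟩
      ⟨γ h, dframe e (γ h) (j h)⟩ := by
  set σ : ℝ → M := fun s ↦ γ (h * s)
  set d : ℝ → E := fun r ↦ dcoord e (γ r) (velocity E γ r)
  have hγd : ∀ r, MDifferentiableAt 𝓘(ℝ, ℝ) 𝓘(ℝ, E) γ r := fun r ↦
    IsGeodesicAt.mdifferentiableAt (hγ r)
  have hσd : ∀ s, MDifferentiableAt 𝓘(ℝ, ℝ) 𝓘(ℝ, E) σ s := fun s ↦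
    IsGeodesicAt.mdifferentiableAt (IsGeodesicAt.comp_mul (Eventually.of_forall hγ))
  have hvel : ∀ s, velocity E σ s = h • velocity E γ (h * s) := fun s ↦ velocity_comp_mul (hγd _)
  set J : (s : ℝ) → TangentSpace 𝓘(ℝ, E) (σ s) := fun s ↦ dframe e (σ s) (j (h * s))
  set J' : (s : ℝ) → TangentSpace 𝓘(ℝ, E) (σ s) := fun s ↦ dframe e (σ s)
    (h • (k (h * s) - (chris cov he (e (σ s)) (d (h * s)) (j (h * s)) -
      chris cov he (e (σ s)) (j (h * s)) (d (h * s)))))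
  have hsrc : ∀ s ∈ Icc (0 : ℝ) 1, σ s ∈ e.source := fun s hs ↦ (hjk s hs).1
  have hK : ∀ s ∈ Icc (0 : ℝ) 1, dcoord e (σ s)
      (J' s + cov.torsion (σ s) (J s) (velocity E σ s)) = h • k (h * s) := by
    intro s hs
    rw [map_add, dcoord_torsion cov he (hsrc s hs), he.dcoord_dframe (hsrc s hs),
      he.dcoord_dframe (hsrc s hs), hvel, map_smul]
    change h • (k (h * s) - (chris cov he (e (σ s)) (d (h * s)) (j (h * s)) -
      chris cov he (e (σ s)) (j (h * s)) (d (h * s)))) +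
      (chris cov he (e (σ s)) (h • d (h * s)) (j (h * s)) -
      chris cov he (e (σ s)) (j (h * s)) (h • d (h * s))) = _
    simp only [map_smul, _root_.smul_apply, smul_sub]
    abel
  have hm : ∀ s, HasDerivAt (fun s ↦ h * s) h s := fun s ↦ by
    simpa using (hasDerivAt_id s).const_mul h
  have hc : ∀ s ∈ Icc (0 : ℝ) 1, HasDerivWithinAt (fun r ↦ e (σ r)) (h • d (h * s)) (Icc 0 1) s := by
    intro s hs
    have := hasDerivAt_coord he (hsrc s hs) (hσd s)
    rw [hvel, map_smul] at this
    exact this.hasDerivWithinAt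
  refine ⟨J, J', fun s hs ↦ ⟨?_, ?_⟩, ?_, ?_, ?_⟩
  · rw [hasCovDerivWithinAt_iff he (hsrc s hs)]
    refine ⟨(hσd s).continuousAt.continuousWithinAt, _, _, hc s hs,
      (HasDerivAt.hasDerivWithinAt (HasDerivAt.scomp (g₁ := j) s (hjk s hs).2.1 (hm s))).congr
      (fun r hr ↦ he.dcoord_dframe (hsrc r hr) _) (he.dcoord_dframe (hsrc s hs) _), ?_⟩
    rw [he.dcoord_dframe (hsrc s hs), he.dcoord_dframe (hsrc s hs)]
    simp only [map_smul, smul_sub, d, σ]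
    abel
  · rw [hasCovDerivWithinAt_iff he (hsrc s hs)]
    refine ⟨(hσd s).continuousAt.continuousWithinAt, _, _, hc s hs,
      (HasDerivAt.hasDerivWithinAt ((HasDerivAt.scomp (g₁ := k) s (hjk s hs).2.2
        (hm s)).const_smul h)).congr (fun r hr ↦ hK r hr) (hK s hs), ?_⟩
    rw [hK s hs, map_neg, dcoord_curvature cov hcov he (hsrc s hs), hvel, map_smul,
      coordCurvature_smul, he.dcoord_dframe (hsrc s hs)]
    simp only [map_smul, _root_.smul_apply, smul_sub, smul_neg, d, σ]
    abel
  · exact congrArg (fun r ↦ (⟨γ r, dframe e (γ r) (j r)⟩ : TangentBundle 𝓘(ℝ, E) M)) (mul_zero h)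
  · refine (congrArg (fun r ↦ (⟨γ r, dframe e (γ r)
      (h • (k r - (chris cov he (e (γ r)) (d r) (j r) -
      chris cov he (e (γ r)) (j r) (d r))))⟩ : TangentBundle 𝓘(ℝ, E) M)) (mul_zero h)).trans ?_
    simp only [hk, d, sub_self, smul_zero, map_zero]
  · exact congrArg (fun r ↦ (⟨γ r, dframe e (γ r) (j r)⟩ : TangentBundle 𝓘(ℝ, E) M)) (mul_one h)

theorem HasCovDerivWithinAt.hasDerivWithinAt {e : OpenPartialHomeomorph M E} (he : IsCoord e)
    {γ : ℝ → M} {X : (s : ℝ) → TangentSpace 𝓘(ℝ, E) (γ s)} {s : ℝ}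
    {D : TangentSpace 𝓘(ℝ, E) (γ s)} {S : Set ℝ} (h : HasCovDerivWithinAt cov γ X S s D)
    (hs : UniqueDiffWithinAt ℝ S s)
    (hes : γ s ∈ e.source) (hγ : MDifferentiableAt 𝓘(ℝ, ℝ) 𝓘(ℝ, E) γ s) :
    HasDerivWithinAt (fun s ↦ dcoord e (γ s) (X s)) (dcoord e (γ s) D -
      chris cov he (e (γ s)) (dcoord e (γ s) (X s)) (dcoord e (γ s) (velocity E γ s))) S s := by
  rw [hasCovDerivWithinAt_iff he hes] at h
  obtain ⟨-, c', j', h1, h2, h3⟩ := h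
  have h4 := hs.eq_deriv _ (hasDerivAt_coord he hes hγ).hasDerivWithinAt h1
  rw [h3, h4, add_sub_cancel_right]
  exact h2

/-- The coordinate system is linear with coefficients bounded on `[0, 1]`; Grönwall applies to the
difference of two solutions. -/
theorem IsJacobiTransport.unique [T2Space M]
    (hcov : CovariantDerivative.ContMDiffCovariantDerivative cov ∞)
    {e : OpenPartialHomeomorph M E} (he : IsCoord e) {γ : ℝ → M}
    (hγ : IsGeodesic cov γ) (hsrc : ∀ s ∈ Icc (0 : ℝ) 1, γ s ∈ e.source)
    {a a' b₁ b₂ : TangentBundle 𝓘(ℝ, E) M} (h₁ : IsJacobiTransport cov γ a a' b₁)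
    (h₂ : IsJacobiTransport cov γ a a' b₂) : b₁ = b₂ := by
  obtain ⟨J₁, J₁', hJ₁, h10, h10', rfl⟩ := h₁
  obtain ⟨J₂, J₂', hJ₂, h20, h20', rfl⟩ := h₂
  have hγd : ∀ r, MDifferentiableAt 𝓘(ℝ, ℝ) 𝓘(ℝ, E) γ r := fun r ↦
    IsGeodesicAt.mdifferentiableAt (hγ r)
  set d : ℝ → E := fun s ↦ dcoord e (γ s) (velocity E γ s)
  set j : ((s : ℝ) → TangentSpace 𝓘(ℝ, E) (γ s)) → ℝ → E := fun J s ↦ dcoord e (γ s) (J s)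
  set k : ((s : ℝ) → TangentSpace 𝓘(ℝ, E) (γ s)) → ((s : ℝ) → TangentSpace 𝓘(ℝ, E) (γ s)) →
    ℝ → E := fun J J' s ↦ dcoord e (γ s) (J' s + cov.torsion (γ s) (J s) (velocity E γ s))
  have key : ∀ J J' : (s : ℝ) → TangentSpace 𝓘(ℝ, E) (γ s), IsJacobiField cov γ J J' →
      ∀ s ∈ Icc (0 : ℝ) 1, HasDerivWithinAt (fun s ↦ (j J s, k J J' s))
        (k J J' s - chris cov he (e (γ s)) (d s) (j J s),
          -coordCurvature cov he (e (γ s)) (j J s) (d s) (d s) -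
            chris cov he (e (γ s)) (k J J' s) (d s)) (Icc 0 1) s := by
    intro J J' hJ s hs
    have hu := uniqueDiffOn_Icc (zero_lt_one (α := ℝ)) s hs
    have h1 := (hJ s hs).1.hasDerivWithinAt he hu (hsrc s hs) (hγd s)
    have h2 := (hJ s hs).2.hasDerivWithinAt he hu (hsrc s hs) (hγd s)
    rw [map_neg, dcoord_curvature cov hcov he (hsrc s hs)] at h2
    refine HasDerivWithinAt.prodMk (h1.congr_deriv ?_) h2
    simp only [k, map_add, dcoord_torsion cov he (hsrc s hs), j, d]
    abel
  -- Bounds both components in the maximum norm: `1` comes from `k` in the equation for `j`, the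
  -- second term from the Christoffel terms, the last from the curvature.
  set K : ℝ → ℝ := fun s ↦ 1 + ‖chris cov he (e (γ s))‖ * ‖d s‖ +
    2 * (‖fderiv ℝ (chris cov he) (e (γ s))‖ + ‖chris cov he (e (γ s))‖ ^ 2) * ‖d s‖ ^ 2
  have hK : ContinuousOn K (Icc 0 1) := by
    intro s hs
    have h1 : ContDiffAt ℝ ∞ (chris cov he) (e (γ s)) :=
      (contDiffOn_chris cov hcov he).contDiffAt (e.open_target.mem_nhds (e.map_source (hsrc s hs)))
    have hc : ContinuousAt (fun s ↦ e (γ s)) s :=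
      (hasDerivAt_coord he (hsrc s hs) (hγd s)).continuousAt
    have hΓ : ContinuousAt (fun s ↦ chris cov he (e (γ s))) s :=
      ContinuousAt.comp (g := chris cov he) h1.continuousAt hc
    have hΓ' : ContinuousAt (fun s ↦ fderiv ℝ (chris cov he) (e (γ s))) s :=
      ContinuousAt.comp (g := fderiv ℝ (chris cov he))
        (h1.fderiv_right (m := ∞) (by simp)).continuousAt hc
    have hd : ContinuousAt d s := ((isGeodesicAt_iff he (hsrc s hs)).1 (hγ s)).2.continuousAt
    exact ContinuousAt.continuousWithinAt (by fun_prop)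
  obtain ⟨C, hC⟩ := isCompact_Icc.bddAbove_image hK
  have hC' : ∀ s ∈ Icc (0 : ℝ) 1, K s ≤ C := fun s hs ↦ hC (mem_image_of_mem K hs)
  set f : ℝ → E × E := fun s ↦ (j J₁ s, k J₁ J₁' s) - (j J₂ s, k J₂ J₂' s)
  have hf := fun s hs ↦ (key J₁ J₁' hJ₁ s hs).sub (key J₂ J₂' hJ₂ s hs)
  have hf0 : f 0 = 0 := by
    have h1 := dcoord_congr (e := e) (h10.trans h20.symm)
    have h2 := dcoord_congr (e := e) (h10'.trans h20'.symm)
    have h3 : J₁ 0 = J₂ 0 := he.dcoord_injective (hsrc 0 (by simp)) h1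
    have h4 : J₁' 0 = J₂' 0 := he.dcoord_injective (hsrc 0 (by simp)) h2
    simp only [f, j, k, h3, h4, sub_self]
  have h0 := eq_zero_of_abs_deriv_le_mul_abs_self_of_eq_zero_right (f := f) (K := C) (a := 0)
    (b := 1) (fun s hs ↦ (hf s hs).continuousWithinAt)
    (fun s hs ↦ (hf s ⟨hs.1, hs.2.le⟩).mono_of_mem_nhdsWithin (Icc_mem_nhdsGE_of_mem hs)) hf0
    (fun s hs ↦ ?_) 1 (by simp)
  · have h1 : j J₁ 1 = j J₂ 1 := sub_eq_zero.1 (congrArg Prod.fst h0)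
    exact he.totalSpace_ext (hsrc 1 (by simp)) rfl h1
  · set z := e (γ s)
    refine le_trans ?_ (mul_le_mul_of_nonneg_right (hC' s ⟨hs.1, hs.2.le⟩) (norm_nonneg _))
    have hf1 : ‖j J₁ s - j J₂ s‖ ≤ ‖f s‖ := norm_fst_le (f s)
    have hf2 : ‖k J₁ J₁' s - k J₂ J₂' s‖ ≤ ‖f s‖ := norm_snd_le (f s)
    have h1 : (k J₁ J₁' s - chris cov he z (d s) (j J₁ s)) -
        (k J₂ J₂' s - chris cov he z (d s) (j J₂ s)) =
        (k J₁ J₁' s - k J₂ J₂' s) - chris cov he z (d s) (j J₁ s - j J₂ s) := by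
      rw [map_sub]; abel
    have h2 : (-coordCurvature cov he z (j J₁ s) (d s) (d s) - chris cov he z (k J₁ J₁' s) (d s)) -
        (-coordCurvature cov he z (j J₂ s) (d s) (d s) - chris cov he z (k J₂ J₂' s) (d s)) =
        -coordCurvature cov he z (j J₁ s - j J₂ s) (d s) (d s) -
          chris cov he z (k J₁ J₁' s - k J₂ J₂' s) (d s) := by
      simp only [coordCurvature, map_sub, _root_.sub_apply]; abel
    have hΓ := (chris cov he z).le_opNorm₂
    have hR := norm_coordCurvature_le (cov := cov) he z (j J₁ s - j J₂ s) (d s)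
    have hp1 : 0 ≤ ‖chris cov he z‖ * ‖d s‖ := by positivity
    have hp2 : 0 ≤ 2 * (‖fderiv ℝ (chris cov he) z‖ + ‖chris cov he z‖ ^ 2) * ‖d s‖ ^ 2 := by
      positivity
    rw [Prod.mk_sub_mk, h1, h2, Prod.norm_mk]
    refine max_le ?_ ?_
    · refine (norm_sub_le _ _).trans ?_
      have h3 := (hΓ (d s) (j J₁ s - j J₂ s)).trans (mul_le_mul_of_nonneg_left hf1 hp1)
      have h4 : 0 ≤ 2 * (‖fderiv ℝ (chris cov he) z‖ + ‖chris cov he z‖ ^ 2) * ‖d s‖ ^ 2 * ‖f s‖ :=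
        mul_nonneg hp2 (norm_nonneg _)
      simp only [K, add_mul, one_mul]
      linarith
    · refine (norm_sub_le _ _).trans ?_
      rw [norm_neg]
      have h3 := (hΓ (k J₁ J₁' s - k J₂ J₂' s) (d s)).trans_eq (mul_right_comm _ _ _)
      have h4 := h3.trans (mul_le_mul_of_nonneg_left hf2 hp1)
      have h5 := hR.trans (mul_le_mul_of_nonneg_left hf1 hp2)
      simp only [K, add_mul, one_mul]
      linarith [norm_nonneg (f s)]

end Jacobi

/-! ### Linearity and uniqueness of covariant derivatives along curves -/

section CovDerivAlgebra

variable {E : Type*} [NormedAddCommGroup E] [NormedSpace ℝ E] [FiniteDimensional ℝ E]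
  {M : Type*} [TopologicalSpace M] [ChartedSpace E M] [IsManifold 𝓘(ℝ, E) ∞ M]
  {cov : AffineConnection E M}

theorem hasCovDerivAt_iff {e : OpenPartialHomeomorph M E} (he : IsCoord e)
    {γ : ℝ → M} {X : (s : ℝ) → TangentSpace 𝓘(ℝ, E) (γ s)} {s : ℝ}
    {D : TangentSpace 𝓘(ℝ, E) (γ s)}
    (hes : γ s ∈ e.source) (hγ : MDifferentiableAt 𝓘(ℝ, ℝ) 𝓘(ℝ, E) γ s) :
    HasCovDerivWithinAt cov γ X univ s D ↔
      HasDerivAt (fun s ↦ dcoord e (γ s) (X s)) (dcoord e (γ s) D -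
        chris cov he (e (γ s)) (dcoord e (γ s) (X s)) (dcoord e (γ s) (velocity E γ s))) s := by
  constructor
  · intro h
    exact hasDerivWithinAt_univ.1 (h.hasDerivWithinAt he uniqueDiffWithinAt_univ hes hγ)
  · intro h
    rw [hasCovDerivWithinAt_iff he hes]
    exact ⟨hγ.continuousAt.continuousWithinAt, _, _, (hasDerivAt_coord he hes hγ).hasDerivWithinAt,
      h.hasDerivWithinAt, (sub_add_cancel _ _).symm⟩

variable {γ : ℝ → M} {X Y : (s : ℝ) → TangentSpace 𝓘(ℝ, E) (γ s)} {s : ℝ}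
    {D D' : TangentSpace 𝓘(ℝ, E) (γ s)} (hγ : MDifferentiableAt 𝓘(ℝ, ℝ) 𝓘(ℝ, E) γ s)
include hγ

theorem HasCovDerivWithinAt.add (h : HasCovDerivWithinAt cov γ X univ s D)
    (h' : HasCovDerivWithinAt cov γ Y univ s D') :
    HasCovDerivWithinAt cov γ (fun s ↦ X s + Y s) univ s (D + D') := by
  have he := isCoord_chartAt (E := E) (γ s)
  have hes := mem_chart_source E (γ s)
  rw [hasCovDerivAt_iff he hes hγ] at h h' ⊢
  refine ((h.add h').congr_deriv ?_).congr_of_eventuallyEq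
    (Eventually.of_forall fun r ↦ map_add _ _ _)
  simp only [map_add, _root_.add_apply]
  abel

theorem HasCovDerivWithinAt.smul (h : HasCovDerivWithinAt cov γ X univ s D) (c : ℝ) :
    HasCovDerivWithinAt cov γ (fun s ↦ c • X s) univ s (c • D) := by
  have he := isCoord_chartAt (E := E) (γ s)
  have hes := mem_chart_source E (γ s)
  rw [hasCovDerivAt_iff he hes hγ] at h ⊢
  refine ((h.const_smul c).congr_deriv ?_).congr_of_eventuallyEq
    (Eventually.of_forall fun r ↦ map_smul _ _ _)
  simp only [map_smul, _root_.smul_apply, smul_sub]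

theorem HasCovDerivWithinAt.unique (h : HasCovDerivWithinAt cov γ X univ s D)
    (h' : HasCovDerivWithinAt cov γ X univ s D') : D = D' := by
  have he := isCoord_chartAt (E := E) (γ s)
  have hes := mem_chart_source E (γ s)
  rw [hasCovDerivAt_iff he hes hγ] at h h'
  exact he.dcoord_injective hes (sub_left_inj.1 (h.unique h'))

end CovDerivAlgebra

/-! ### Preintegrability implies exact linearization -/

namespace VectorErrorRep

variable {E : Type*} [NormedAddCommGroup E] [NormedSpace ℝ E] [FiniteDimensional ℝ E]
  {M : Type*} [TopologicalSpace M] [ChartedSpace E M] [IsManifold 𝓘(ℝ, E) ∞ M]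
  {V : Type*} [NormedAddCommGroup V] [NormedSpace ℝ V]
  {cov : AffineConnection E M} {W : Dynamics V E M} {R : VectorErrorRep cov W}

/-- Self-similarity at each intermediate time puts the moved point on a patch, and patches lie in
`U`. -/
theorem SelfSimilar.expMap_mem_domain (h : R.SelfSimilar) {t : ℝ} (ht : t ∈ Ioo (-R.ε) R.ε)
    {p q : M} (hp : p ∈ R.domain t) (hq : q ∈ R.domain t) {s : ℝ} (hs : s ∈ Icc (0 : ℝ) 1) :
    expMap cov q (s • R.er p q) ∈ R.domain t := by
  refine ⟨R.isErrorFunction.mem q hq.1 p hp.1 s hs, fun τ hτ ↦ ?_⟩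
  have h1 := h τ (R.uIcc_subset ht hτ) p (R.domain_mono hτ hp) q (R.domain_mono hτ hq) s hs
  rw [R.patch_zero hp.1 hq.1] at h1
  rw [← h1]
  exact R.patch_mem (R.domain_mono hτ hp) (R.domain_mono hτ hq) hs

theorem mdifferentiableAt_Φ {t : ℝ} (ht : t ∈ Ioo (-R.ε) R.ε) {p : M} (hp : p ∈ R.U) :
    MDifferentiableAt 𝓘(ℝ, E) 𝓘(ℝ, E) (R.Φ t) p := by
  obtain ⟨e', he', hrel⟩ := exists_relCoord (R.isLocalDiffeomorphOn_Φ t ht ⟨p, hp⟩)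
    (isCoord_chartAt (E := E) p) (mem_chart_source E p)
  exact hrel.mdifferentiableAt (isCoord_chartAt p) he'

/-- `Φ t` maps the segment from `q` to `p` onto the patch at time `t`; compare initial velocities.
-/
theorem SelfSimilar.mfderiv_er [T2Space M]
    (hcov : CovariantDerivative.ContMDiffCovariantDerivative cov ∞)
    (hcomplete : GeodesicallyComplete cov) (h : R.SelfSimilar) {t : ℝ} (ht : t ∈ Ioo (-R.ε) R.ε)
    {p q : M} (hp : p ∈ R.domain t) (hq : q ∈ R.domain t) :
    mfderiv 𝓘(ℝ, E) 𝓘(ℝ, E) (R.Φ t) q (R.er p q) = R.er (R.Φ t p) (R.Φ t q) := by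
  obtain ⟨hγ, hγ0⟩ := isGeodesic_expMap hcov hcomplete q (R.er p q)
  obtain ⟨hσ, hσ0⟩ := isGeodesic_expMap hcov hcomplete (R.Φ t q) (R.er (R.Φ t p) (R.Φ t q))
  set γ : ℝ → M := fun s ↦ expMap cov q (s • R.er p q)
  have hγU : γ 0 ∈ R.U := (h.expMap_mem_domain ht hp hq (by simp)).1
  have hγd := IsGeodesicAt.mdifferentiableAt (hγ 0)
  have h1 : EqOn (fun s ↦ R.Φ t (γ s)) (R.patch p q t) (Icc 0 1) := fun s hs ↦ by
    rw [h t ht p hp q hq s hs, R.patch_zero hp.1 hq.1]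
  have hΦ := mdifferentiableAt_Φ ht hγU
  have h2 := velocity_eq_of_eqOn h1 (by simp) (hΦ.comp 0 hγd)
    (mdifferentiableAt_patch hcov hcomplete p q t 0)
  rw [velocity_comp hΦ hγd] at h2
  have h3 := congrArg (fun a : TangentBundle 𝓘(ℝ, E) M ↦
      (⟨R.Φ t a.1, mfderiv 𝓘(ℝ, E) 𝓘(ℝ, E) (R.Φ t) a.1 a.2⟩ : TangentBundle 𝓘(ℝ, E) M)) hγ0
  have h4 := h3.symm.trans (h2.trans hσ0)
  simpa using h4

/-- A Jacobi field with `J(0) = a` and `D_s J(0) = 0` has coordinate derivative `-Γ(a, v)` at `0`.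
Shrinking the patches to `x` turns equality of Jacobi transports into equality of these derivatives
in `e` and `e'`, hence of all Christoffel symbols. -/
theorem Preintegrable.chris_eq [T2Space M]
    (hcov : CovariantDerivative.ContMDiffCovariantDerivative cov ∞)
    (hcomplete : GeodesicallyComplete cov) (h : R.Preintegrable) {t : ℝ} (ht : t ∈ Ioo (-R.ε) R.ε)
    {x : M} (hx : x ∈ R.domain t) {e e' : OpenPartialHomeomorph M E} (he : IsCoord e)
    (he' : IsCoord e') (hrel : RelCoord (R.Φ t) e e' x) :
    chris cov he' (e x) = chris cov he (e x) := by
  ext a v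
  set w : TangentSpace 𝓘(ℝ, E) x := dframe e x v
  obtain ⟨hγ, hγ0⟩ := isGeodesic_expMap hcov hcomplete x w
  obtain ⟨hσ, hσ0⟩ := isGeodesic_expMap hcov hcomplete (R.Φ t x)
    (mfderiv 𝓘(ℝ, E) 𝓘(ℝ, E) (R.Φ t) x w)
  set γ : ℝ → M := fun s ↦ expMap cov x (s • w)
  set σ : ℝ → M := fun s ↦ expMap cov (R.Φ t x) (s • mfderiv 𝓘(ℝ, E) 𝓘(ℝ, E) (R.Φ t) x w)
  have hγx : γ 0 = x := congrArg TotalSpace.proj hγ0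
  have hσx : σ 0 = R.Φ t x := congrArg TotalSpace.proj hσ0
  have hγv : dcoord e (γ 0) (velocity E γ 0) = v :=
    (dcoord_congr hγ0).trans (he.dcoord_dframe hrel.mem_source v)
  have hσv : dcoord e' (σ 0) (velocity E σ 0) = v :=
    (dcoord_congr hσ0).trans
      ((hrel.dcoord_mfderiv he he' w).trans (he.dcoord_dframe hrel.mem_source v))
  have heγ : e (γ 0) = e x := by rw [hγx]
  have heσ : e' (σ 0) = e x := by rw [hσx, hrel.apply_eq]
  -- The second initial value is the coordinate expression of `τ(a, v)`, so that the covariant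
  -- derivative itself starts at zero.
  obtain ⟨j, k, hj0, hk0, hjk⟩ := exists_isCoordJacobi hcov he hγ (hγx ▸ hrel.mem_source) a
    (chris cov he (e x) v a - chris cov he (e x) a v)
  obtain ⟨j', k', hj0', hk0', hjk'⟩ := exists_isCoordJacobi hcov he' hσ (hσx ▸ hrel.map_mem_source)
    a (chris cov he' (e x) v a - chris cov he' (e x) a v)
  have hγc : ContinuousAt γ 0 := (IsGeodesicAt.mdifferentiableAt (hγ 0)).continuousAt
  have hγc' : Tendsto γ (𝓝 0) (𝓝 x) := by
    rw [ContinuousAt, hγx] at hγc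
    exact hγc
  -- For each small `r`, apply the Jacobi condition to the patch with endpoints `x` and `γ r`, which
  -- is `γ` rescaled by `r`, and compare with the field along `σ` by uniqueness.
  have key : ∀ᶠ r in 𝓝[>] (0 : ℝ), j r = j' r := by
    obtain ⟨δ, hδ, hball⟩ := Metric.eventually_nhds_iff_ball.1 (hjk.and (hjk'.and
      ((hγc'.eventually ((R.isOpen_domain ht).mem_nhds hx)).and
      ((hγc'.eventually hrel.eventually).and (R.eventually_er_smul hcov hcomplete hx.1 w)))))
    filter_upwards [Ioo_mem_nhdsGT hδ] with r hr
    have hrs : ∀ s ∈ Icc (0 : ℝ) 1, r * s ∈ Metric.ball (0 : ℝ) δ := by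
      intro s hs
      rw [mem_ball_zero_iff, Real.norm_eq_abs, abs_of_nonneg (mul_nonneg hr.1.le hs.1)]
      exact (mul_le_of_le_one_right hr.1.le hs.2).trans_lt hr.2
    have hr' : r ∈ Metric.ball (0 : ℝ) δ := by simpa using hrs 1 (by simp)
    obtain ⟨-, -, hrd, hrrel, hrer⟩ := hball r hr'
    have hrer' : R.er (γ r) x = r • w := hrer
    have h1 := isJacobiTransport_of_isCoordJacobi hcov he hγ
      (fun s hs ↦ (hball _ (hrs s hs)).1) (by rw [hγv, heγ, hj0, hk0])
    have h2 := isJacobiTransport_of_isCoordJacobi hcov he' hσ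
      (fun s hs ↦ (hball _ (hrs s hs)).2.1) (by rw [hσv, heσ, hj0', hk0'])
    have hp0 : R.patch (γ r) x 0 = fun s ↦ γ (r * s) := by
      rw [R.patch_zero hrd.1 hx.1, hrer']
      funext s
      rw [smul_smul, mul_comm]
    have hpt : R.patch (γ r) x t = fun s ↦ σ (r * s) := by
      funext s
      rw [patch, ← h.selfSimilar.mfderiv_er hcov hcomplete ht hrd hx, hrer', map_smul, smul_smul,
        mul_comm]
    rw [← hp0] at h1
    have h3 := h.jacobi t ht _ hrd _ hx _ _ _ h1
    rw [hpt] at h3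
    have hrel0 : RelCoord (R.Φ t) e e' (γ 0) := hγx ▸ hrel
    have hγσ : R.Φ t (γ 0) = σ 0 := by rw [hγx, hσx]
    have h4 : tangentMap 𝓘(ℝ, E) 𝓘(ℝ, E) (R.Φ t) ⟨γ 0, dframe e (γ 0) (j 0)⟩ =
        ⟨σ 0, dframe e' (σ 0) (j' 0)⟩ := by
      refine he'.totalSpace_ext hrel0.map_mem_source hγσ ?_
      rw [hrel0.dcoord_mfderiv he he', he.dcoord_dframe hrel0.mem_source,
        he'.dcoord_dframe (hσx ▸ hrel.map_mem_source), hj0, hj0']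
    have h5 : tangentMap 𝓘(ℝ, E) 𝓘(ℝ, E) (R.Φ t) ⟨γ 0, 0⟩ =
        (⟨σ 0, 0⟩ : TangentBundle 𝓘(ℝ, E) M) := by
      refine he'.totalSpace_ext hrel0.map_mem_source hγσ ?_
      rw [hrel0.dcoord_mfderiv he he', map_zero, map_zero]
    rw [h4, h5] at h3
    have h6 := IsJacobiTransport.unique hcov he'
      (fun s ↦ IsGeodesicAt.comp_mul (Eventually.of_forall hσ))
      (fun s hs ↦ (hball _ (hrs s hs)).2.1.1) h3 h2
    have h7 := dcoord_congr (e := e') h6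
    have hσs : σ r ∈ e'.source := (hball r hr').2.1.1
    rwa [hrrel.dcoord_mfderiv he he', he.dcoord_dframe hrrel.mem_source,
      he'.dcoord_dframe hσs] at h7
  have h1 := hjk.self_of_nhds.2.1
  have h2 := hjk'.self_of_nhds.2.1
  rw [hγv, heγ, hj0, hk0] at h1
  rw [hσv, heσ, hj0', hk0'] at h2
  have h3 := (uniqueDiffWithinAt_Ioi (0 : ℝ)).eq_deriv _ (h1.hasDerivWithinAt (s := Ioi 0))
    (h2.hasDerivWithinAt.congr_of_eventuallyEq key (hj0.trans hj0'.symm))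
  simpa using h3.symm

theorem Preintegrable.affineAt [T2Space M]
    (hcov : CovariantDerivative.ContMDiffCovariantDerivative cov ∞)
    (hcomplete : GeodesicallyComplete cov) (h : R.Preintegrable) {t : ℝ} (ht : t ∈ Ioo (-R.ε) R.ε)
    {x : M} (hx : x ∈ R.domain t) : AffineAt cov (R.Φ t) x := by
  obtain ⟨e', he', hrel⟩ := exists_relCoord (R.isLocalDiffeomorphOn_Φ t ht ⟨x, hx.1⟩)
    (isCoord_chartAt (E := E) x) (mem_chart_source E x)
  have he := isCoord_chartAt (E := E) x
  refine ⟨_, e', he, he', hrel, ?_⟩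
  have h1 := (chartAt E x).continuousAt_symm (mem_chart_target E x)
  rw [ContinuousAt, (chartAt E x).left_inv hrel.mem_source] at h1
  filter_upwards [h1.eventually hrel.eventually,
    h1.eventually ((R.isOpen_domain ht).mem_nhds hx),
    (chartAt E x).open_target.mem_nhds (mem_chart_target E x)] with z hz hzd hzt
  have := h.chris_eq hcov hcomplete ht hzd he he' hz
  rwa [(chartAt E x).right_inv hzt] at this

theorem Preintegrable.isLocalAffine [T2Space M]
    (hcov : CovariantDerivative.ContMDiffCovariantDerivative cov ∞)
    (hcomplete : GeodesicallyComplete cov) (h : R.Preintegrable) {t : ℝ}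
    (ht : t ∈ Ioo (-R.ε) R.ε) : IsLocalAffine cov (R.Φ t) (R.domain t) :=
  isLocalAffine_of_affineAt (R.isOpen_domain ht) ((R.injOn_Φ ht).mono (R.domain_subset t))
    (fun x ↦ R.isLocalDiffeomorphOn_Φ t ht ⟨x, x.2.1⟩) fun _ hx ↦ h.affineAt hcov hcomplete ht hx

variable (R)

/-- The coordinate expression of the error function near `(y, x)`. -/
def erCoord (y x : M) (z : E × E) : E :=
  dcoord (chartAt E x) ((chartAt E x).symm z.2)
    (R.er ((chartAt E y).symm z.1) ((chartAt E x).symm z.2))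

/-- The covariant rate of change of the error of `y` with respect to `x`, when both points move
along the vector field of the input `u`. -/
def errorRate (u : V) (x y : M) : TangentSpace 𝓘(ℝ, E) x :=
  dframe (chartAt E x) x
    (fderiv ℝ (R.erCoord y x) (chartAt E y y, chartAt E x x)
      (dcoord (chartAt E y) y (W.field u y), dcoord (chartAt E x) x (W.field u x)) +
    chris cov (isCoord_chartAt x) (chartAt E x x) (dcoord (chartAt E x) x (R.er y x))
      (dcoord (chartAt E x) x (W.field u x)))

theorem differentiableAt_erCoord {x y : M} (hx : x ∈ R.U) (hy : y ∈ R.U) :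
    DifferentiableAt ℝ (R.erCoord y x) (chartAt E y y, chartAt E x x) := by
  have h1 : ContMDiffAt 𝓘(ℝ, E × E) (𝓘(ℝ, E).prod 𝓘(ℝ, E)) ∞
      (fun z : E × E ↦ ((chartAt E y).symm z.1, (chartAt E x).symm z.2))
      (chartAt E y y, chartAt E x x) := by
    refine ContMDiffAt.prodMk ?_ ?_
    · exact ContMDiffAt.comp (g := (chartAt E y).symm) (f := Prod.fst) (_, _)
        ((isCoord_chartAt y).contMDiffAt_symm (mem_chart_target E y)) contDiffAt_fst.contMDiffAt
    · exact ContMDiffAt.comp (g := (chartAt E x).symm) (f := Prod.snd) (_, _)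
        ((isCoord_chartAt x).contMDiffAt_symm (mem_chart_target E x)) contDiffAt_snd.contMDiffAt
  have h2 : ContMDiffAt 𝓘(ℝ, E × E) 𝓘(ℝ, E) ∞ (R.erCoord y x) (chartAt E y y, chartAt E x x) :=
    ContMDiffAt.comp (g := fun z : M × M ↦ dcoord (chartAt E x) z.2 (R.er z.1 z.2)) _
      (by
        simp only [(chartAt E x).left_inv (mem_chart_source E x),
          (chartAt E y).left_inv (mem_chart_source E y)]
        exact R.contMDiffAt_er hx hy) h1
  exact (contMDiffAt_iff_contDiffAt.1 h2).differentiableAt (by simp)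

variable {R}

theorem hasDerivAt_flow_coord {e : OpenPartialHomeomorph M E} (he : IsCoord e) {t : ℝ}
    (ht : t ∈ Ioo (-R.ε) R.ε) {p : M} (hp : p ∈ R.U) (hs : R.Φ t p ∈ e.source) :
    HasDerivAt (fun τ ↦ e (R.Φ τ p)) (dcoord e (R.Φ t p) (W.field (R.u t) (R.Φ t p))) t := by
  have := ((hasMFDerivWithinAt_curve_iff he hs (S := univ) _).1
    (hasMFDerivWithinAt_univ.2 (R.flow p hp t ht))).2
  rwa [hasDerivWithinAt_univ] at this

/-- Chain rule. What matters is that the rate depends only on the current input value and the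
current positions, not on the time or the initial points. -/
theorem hasCovDerivWithinAt_er {t : ℝ} (ht : t ∈ Ioo (-R.ε) R.ε) {p q : M}
    (hp : p ∈ R.domain t) (hq : q ∈ R.domain t) :
    HasCovDerivWithinAt cov (fun τ ↦ R.Φ τ p) (fun τ ↦ R.er (R.Φ τ q) (R.Φ τ p)) univ t
      (R.errorRate (R.u t) (R.Φ t p) (R.Φ t q)) := by
  set x := R.Φ t p
  set y := R.Φ t q
  have hx : x ∈ (chartAt E x).source := mem_chart_source E x
  have hy : y ∈ (chartAt E y).source := mem_chart_source E y
  have hd := (R.flow p hp.1 t ht).mdifferentiableAt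
  rw [hasCovDerivAt_iff (isCoord_chartAt x) hx hd]
  have h1 := hasDerivAt_flow_coord (isCoord_chartAt (E := E) x) ht hp.1 hx
  have h2 := hasDerivAt_flow_coord (isCoord_chartAt (E := E) y) ht hq.1 hy
  have h3 := HasFDerivAt.comp_hasDerivAt t (R.differentiableAt_erCoord (R.mapsTo_domain t hp)
    (R.mapsTo_domain t hq)).hasFDerivAt (h2.prodMk h1)
  refine (h3.congr_of_eventuallyEq ?_).congr_deriv ?_
  · filter_upwards [hd.continuousAt.eventually ((chartAt E x).open_source.mem_nhds hx),
      (continuousAt_flow ht hq.1).eventually ((chartAt E y).open_source.mem_nhds hy)] with τ h4 h5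
    have h6 : (chartAt E x).symm (chartAt E x (R.Φ τ p)) = R.Φ τ p := (chartAt E x).left_inv h4
    have h7 : (chartAt E y).symm (chartAt E y (R.Φ τ q)) = R.Φ τ q := (chartAt E y).left_inv h5
    change dcoord (chartAt E x) (R.Φ τ p) (R.er (R.Φ τ q) (R.Φ τ p)) =
      dcoord (chartAt E x) ((chartAt E x).symm (chartAt E x (R.Φ τ p)))
        (R.er ((chartAt E y).symm (chartAt E y (R.Φ τ q)))
          ((chartAt E x).symm (chartAt E x (R.Φ τ p))))
    rw [h6, h7]
  · rw [velocity_eq_of_hasMFDerivAt (R.flow p hp.1 t ht), errorRate,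
      (isCoord_chartAt x).dcoord_dframe hx, add_sub_cancel_right]

theorem eventually_mem_domain {t : ℝ} (ht : t ∈ Ioo (-R.ε) R.ε) {p : M} (hp : p ∈ R.domain t) :
    ∀ᶠ τ in 𝓝 t, τ ∈ Ioo (-R.ε) R.ε ∧ p ∈ R.domain τ :=
  (R.isOpen_times p).mem_nhds ⟨ht, hp⟩

/-- For small `r` the error of `exp_p (r v)` with respect to `p` is exactly `r • dΦ^τ v` at all
times `τ` near `t`, so this field inherits a covariant derivative from the error. One positive `r`
yields `D`, and uniqueness of the covariant derivative gives the relation for all small `r`. -/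
theorem Preintegrable.exists_hasCovDerivWithinAt [T2Space M]
    (hcov : CovariantDerivative.ContMDiffCovariantDerivative cov ∞)
    (hcomplete : GeodesicallyComplete cov) (h : R.Preintegrable) {t : ℝ} (ht : t ∈ Ioo (-R.ε) R.ε)
    {p : M} (hp : p ∈ R.domain t) (v : TangentSpace 𝓘(ℝ, E) p) :
    ∃ D : TangentSpace 𝓘(ℝ, E) (R.Φ t p),
      HasCovDerivWithinAt cov (fun τ ↦ R.Φ τ p)
        (fun τ ↦ mfderiv 𝓘(ℝ, E) 𝓘(ℝ, E) (R.Φ τ) p v) univ t D ∧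
      ∀ᶠ r in 𝓝[>] (0 : ℝ), r • D = R.errorRate (R.u t) (R.Φ t p)
        (expMap cov (R.Φ t p) (r • mfderiv 𝓘(ℝ, E) 𝓘(ℝ, E) (R.Φ t) p v)) := by
  have hd := (R.flow p hp.1 t ht).mdifferentiableAt
  have hc : Tendsto (fun r : ℝ ↦ expMap cov p (r • v)) (𝓝 0) (𝓝 p) := by
    have := (continuous_expMap hcov hcomplete p v).tendsto 0
    rwa [expMap_zero hcov hcomplete] at this
  have h1 : ∀ᶠ r in 𝓝 (0 : ℝ), HasCovDerivWithinAt cov (fun τ ↦ R.Φ τ p)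
      (fun τ ↦ r • mfderiv 𝓘(ℝ, E) 𝓘(ℝ, E) (R.Φ τ) p v) univ t
      (R.errorRate (R.u t) (R.Φ t p)
        (expMap cov (R.Φ t p) (r • mfderiv 𝓘(ℝ, E) 𝓘(ℝ, E) (R.Φ t) p v))) := by
    filter_upwards [R.eventually_er_smul hcov hcomplete hp.1 v,
      hc.eventually ((R.isOpen_domain ht).mem_nhds hp)] with r hr hrd
    set q := expMap cov p (r • v)
    have h2 : ∀ τ ∈ Ioo (-R.ε) R.ε, p ∈ R.domain τ → q ∈ R.domain τ →
        R.er (R.Φ τ q) (R.Φ τ p) = r • mfderiv 𝓘(ℝ, E) 𝓘(ℝ, E) (R.Φ τ) p v := by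
      intro τ hτ hpτ hqτ
      rw [← h.selfSimilar.mfderiv_er hcov hcomplete hτ hqτ hpτ, hr, map_smul]
    have h3 := hasCovDerivWithinAt_er (R := R) ht hp hrd
    have h4 : expMap cov (R.Φ t p) (r • mfderiv 𝓘(ℝ, E) 𝓘(ℝ, E) (R.Φ t) p v) = R.Φ t q := by
      rw [← h2 t ht hp hrd]
      exact R.isErrorFunction.exp_er _ (R.mapsTo_domain t hp) _ (R.mapsTo_domain t hrd)
    rw [h4]
    refine h3.congr_set ?_ ?_ rfl
    · rw [nhdsWithin_univ]
      filter_upwards [eventually_mem_domain ht hp, eventually_mem_domain ht hrd] with τ h5 h6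
      rw [h2 τ h5.1 h5.2 h6.2]
    · rw [h2 t ht hp hrd]
  have h2 : ∀ᶠ r in 𝓝[>] (0 : ℝ), _ := nhdsWithin_le_nhds h1
  obtain ⟨r, hr, hr0⟩ := (h2.and self_mem_nhdsWithin).exists
  have hr0' : r ≠ 0 := (show 0 < r from hr0).ne'
  have h3 := hr.smul hd r⁻¹
  simp only [inv_smul_smul₀ hr0'] at h3
  exact ⟨_, h3, h2.mono fun s hs ↦ (h3.smul hd s).unique hd hs⟩

variable (R) in
/-- The characterization of the Jacobian of the linear error equation at `x` for the input `u`. -/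
def IsErrorJacobian (u : V) (x : M)
    (B : TangentSpace 𝓘(ℝ, E) x →L[ℝ] TangentSpace 𝓘(ℝ, E) x) : Prop :=
  ∀ w, ∀ᶠ r in 𝓝[>] (0 : ℝ), r • B w = R.errorRate u x (expMap cov x (r • w))

theorem IsErrorJacobian.unique {u : V} {x : M}
    {B B' : TangentSpace 𝓘(ℝ, E) x →L[ℝ] TangentSpace 𝓘(ℝ, E) x} (h : R.IsErrorJacobian u x B)
    (h' : R.IsErrorJacobian u x B') : B = B' := by
  ext w
  obtain ⟨r, ⟨hr, hr'⟩, hr0⟩ := (((h w).and (h' w)).and self_mem_nhdsWithin).exists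
  exact smul_right_injective _ (show 0 < r from hr0).ne' (hr.trans hr'.symm)

open Classical in
variable (R) in
/-- The Jacobian of the linear error equation, where it exists. -/
def errorJacobian (u : V) (x : M) : TangentSpace 𝓘(ℝ, E) x →L[ℝ] TangentSpace 𝓘(ℝ, E) x :=
  if h : ∃ B, R.IsErrorJacobian u x B then h.choose else 0

theorem IsErrorJacobian.errorJacobian_eq {u : V} {x : M}
    {B : TangentSpace 𝓘(ℝ, E) x →L[ℝ] TangentSpace 𝓘(ℝ, E) x} (h : R.IsErrorJacobian u x B) :
    R.errorJacobian u x = B := by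
  have h' : ∃ B, R.IsErrorJacobian u x B := ⟨B, h⟩
  rw [errorJacobian, dif_pos h']
  exact h'.choose_spec.unique h

/-- Uniqueness of covariant derivatives makes `v ↦ D v` linear. Composed with the inverse of `dΦ^t`,
it satisfies `IsErrorJacobian`, whose unique solution refers neither to `p` nor to `t`. -/
theorem Preintegrable.hasCovDerivWithinAt [T2Space M]
    (hcov : CovariantDerivative.ContMDiffCovariantDerivative cov ∞)
    (hcomplete : GeodesicallyComplete cov) (h : R.Preintegrable) {t : ℝ} (ht : t ∈ Ioo (-R.ε) R.ε)
    {p : M} (hp : p ∈ R.domain t) (v : TangentSpace 𝓘(ℝ, E) p) :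
    HasCovDerivWithinAt cov (fun τ ↦ R.Φ τ p)
      (fun τ ↦ mfderiv 𝓘(ℝ, E) 𝓘(ℝ, E) (R.Φ τ) p v) univ t
      (R.errorJacobian (R.u t) (R.Φ t p) (mfderiv 𝓘(ℝ, E) 𝓘(ℝ, E) (R.Φ t) p v)) := by
  have hd := (R.flow p hp.1 t ht).mdifferentiableAt
  choose D hD hDr using fun v ↦ h.exists_hasCovDerivWithinAt hcov hcomplete ht hp v
  have he := isCoord_chartAt (E := E) p
  obtain ⟨e', he', hrel⟩ := exists_relCoord (R.isLocalDiffeomorphOn_Φ t ht ⟨p, hp.1⟩)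
    he (mem_chart_source E p)
  set e := chartAt E p
  have hadd : ∀ v w, D (v + w) = D v + D w := by
    intro v w
    refine (hD (v + w)).unique hd ?_
    simpa only [map_add] using (hD v).add hd (hD w)
  have hsmul : ∀ (c : ℝ) v, D (c • v) = c • D v := by
    intro c v
    refine (hD (c • v)).unique hd ?_
    simpa only [map_smul] using (hD v).smul hd c
  set L : E →L[ℝ] E := LinearMap.toContinuousLinearMap
    { toFun := fun f ↦ dcoord e' (R.Φ t p) (D (dframe e p f))
      map_add' := fun f g ↦ by rw [map_add, hadd, map_add]
      map_smul' := fun c f ↦ by rw [map_smul, hsmul, map_smul]; rfl }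
  -- This is `D ∘ (dΦ^t)⁻¹`: in related coordinates `dΦ^t` is the identity, so its inverse is
  -- `dframe e p` after `dcoord e'`.
  set B : TangentSpace 𝓘(ℝ, E) (R.Φ t p) →L[ℝ] TangentSpace 𝓘(ℝ, E) (R.Φ t p) :=
    (dframe e' (R.Φ t p)).comp (L.comp (dcoord e' (R.Φ t p)))
  have hB : ∀ w, B w = D (dframe e p (dcoord e' (R.Φ t p) w)) := fun w ↦
    he'.dframe_dcoord hrel.map_mem_source _
  have hBv : ∀ v, B (mfderiv 𝓘(ℝ, E) 𝓘(ℝ, E) (R.Φ t) p v) = D v := by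
    intro v
    rw [hB, hrel.dcoord_mfderiv he he', he.dframe_dcoord hrel.mem_source]
  have hBJ : R.IsErrorJacobian (R.u t) (R.Φ t p) B := by
    intro w
    have h1 : mfderiv 𝓘(ℝ, E) 𝓘(ℝ, E) (R.Φ t) p (dframe e p (dcoord e' (R.Φ t p) w)) = w := by
      refine he'.dcoord_injective hrel.map_mem_source ?_
      rw [hrel.dcoord_mfderiv he he', he.dcoord_dframe hrel.mem_source]
    have h2 := hDr (dframe e p (dcoord e' (R.Φ t p) w))
    rw [h1] at h2
    simpa only [hB] using h2
  rw [hBJ.errorJacobian_eq, hBv]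
  exact hD v

theorem Preintegrable.exactLinearization [T2Space M]
    (hcov : CovariantDerivative.ContMDiffCovariantDerivative cov ∞)
    (hcomplete : GeodesicallyComplete cov) (h : R.Preintegrable) : R.ExactLinearization := by
  -- The flow itself is the affine transformation for every estimate, so `F_t` is `dΦ^t` throughout.
  refine ⟨fun _ ↦ R.Φ, R.errorJacobian, fun t ht q hq ↦ ⟨h.isLocalAffine hcov hcomplete ht, rfl,
    fun p hp ↦ ?_⟩, fun p _ t ht v ↦ ?_, fun t ht p hp q hq a b hab ↦ ?_⟩
  · rw [h.selfSimilar.mfderiv_er hcov hcomplete ht hp hq]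
    exact (R.isErrorFunction.exp_er _ (R.mapsTo_domain t hq) _ (R.mapsTo_domain t hp)).symm
  · exact (h.hasCovDerivWithinAt hcov hcomplete ht.1 ht.2 v).mono (subset_univ _)
  · refine hab.map (fun s hs ↦ (h.selfSimilar t ht q hq p hp s hs).symm) fun s hs ↦ ?_
    refine h.affineAt hcov hcomplete ht ?_
    rw [R.patch_zero hq.1 hp.1]
    exact h.selfSimilar.expMap_mem_domain ht hq hp hs

end VectorErrorRep

end LinObs

end

theorem mainTheorem5
    {E : Type*} [NormedAddCommGroup E] [NormedSpace ℝ E] [FiniteDimensional ℝ E]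
    {M : Type*} [TopologicalSpace M] [T2Space M] [ChartedSpace E M] [IsManifold 𝓘(ℝ, E) ∞ M]
    {V : Type*} [NormedAddCommGroup V] [NormedSpace ℝ V] [FiniteDimensional ℝ V]
    (cov : LinObs.AffineConnection E M) (hcov : CovariantDerivative.ContMDiffCovariantDerivative cov ∞)
    (hcomplete : LinObs.GeodesicallyComplete cov) (htorsion : LinObs.ParallelTorsion cov)
    (W : LinObs.Dynamics V E M) (R : LinObs.VectorErrorRep cov W) :
    R.ExactLinearization ↔ R.Preintegrable := by
  exact ⟨fun h ↦ LinObs.VectorErrorRep.ExactLinearization.preintegrable hcov hcomplete h,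
    fun h ↦ LinObs.VectorErrorRep.Preintegrable.exactLinearization hcov hcomplete h⟩
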